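/- All graphs are finite and simple; a vertex set also stands for the subgraph it induces; a clique may be empty. **Definitions.** A *hole* is an induced cycle on at least four vertices. A graph is *clock-free* if it has no hole $C$ together with a vertex outside $C$ that has two non-adjacent neighbours in $C$, and *diamond-free* if it has no induced four-vertex subgraph with exactly five edges. A *cutset* of $G$ is a set $X\subseteq V(G)$ such that $G\setminus X$ is non-empty and not connected; it is a *star cutset* if $X\subseteq N[x]$ for some $x\in X$. A *weight function* on $G$ is a map $w:V(G)\to[0,1]$ with $\sum_v w(v)=1$; we put $w(X)=\sum_{x\in X}w(x)$. A set $X$ is a *$(w,\frac12)$-balanced separator* if every component $D$ of $G\setminus X$ has $w(D)\le\frac12$. Otherwise the *canonical separation* of $X$ is $S(X)=(A,C,B)$, where $B$ is the unique component of $G\setminus X$ with $w(B)>\frac12$, $C=X$ and $A=V(G)\setminus(B\cup C)$. Let $\omega(G)$ be the clique number of $G$, and let $\gamma_3(H)$ be the maximum degree of the subgraph of $H$ induced by the vertices of degree at least $3$ in $H$ (it is $0$ if there are none). A vertex is a *claw center* of $H$ if it has three pairwise non-adjacent neighbours in $H$. **Assumptions.** Let $G$ be a (clock, diamond)-free graph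 with no star cutset, and let $w$ be a weight function on $G$ such that $G$ has no $(w,\frac12)$-balanced separator of size at most $4\omega(G)$. **Construction.** For a clique $K$ and a set $S$ of vertices let $c_S(K)=K$ if $|K|\le1$, and $c_S(K)=K\cup(N(x)\cap N(y)\cap S)$ for distinct $x,y\in K$ otherwise (this does not depend on $x,y$, as $G$ is diamond-free). For cliques $K_1,K_2$ with $S(K_1\cup K_2)=(A,C,B)$ let $\mathrm{cl}(K_1,K_2)=c_{A\cup C}(K_1\cap N(B))\cup c_{A\cup C}(K_2\cap N(B))$, and let $\mathcal X$ be the set of all $\mathrm{cl}(K_1,K_2)$ with $K_1,K_2$ cliques of $G$. For $X,X'\in\mathcal X$ with $S(X)=(A,C,B)$ and $S(X')=(A',C',B')$, call $X$ a *shield* for $X'$ if $B\cup C\subsetneq B'\cup C'$, or $B\cup C=B'\cup C'$ and $B'\subsetneq B$. Let $\mathrm{core}$ be the set of those $X'\in\mathcal X$ for which no $X\in\mathcal X$ is a shield, and let the *central bag* $\beta$ be the intersection of the sets $B\cup C$ over all $X\in\mathrm{core}$, where $S(X)=(A,C,B)$. For every component $D$ of $G\setminus\beta$ choose $X(D)\in\mathrm{core}$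 such that $D\subseteq A$, where $S(X(D))=(A,C,B)$. For $X\in\mathrm{core}$ let $D(X)$ be the union of the components $D$ with $X(D)=X$. If $D(X)=\emptyset$, put $P(X)=\emptyset$; otherwise choose a component $D$ of $G\setminus\beta$ with $X(D)=X$ and a path $P(X)$ with at least three vertices, with non-adjacent ends in $X$ and interior in $D$, such that every interior vertex of $P(X)$ has degree $2$ in $G[P(X)\cup X]$. Finally let $\beta^*=\beta\cup\bigcup_{X\in\mathrm{core}}P(X)$, regarded as an induced subgraph of $G$. **Statement.** Such choices of all $X(D)$ and $P(X)$ exist, and for every such choice the following hold. (i) For every $x\in\beta^*$ there is a set $Z_1\subseteq N_{\beta^*}(x)$ of the form $Z_1=K\cup\{x'\}$ with $K$ a clique, such that every $v\in N_{\beta^*}(x)\setminus Z_1$ has $\deg_{\beta^*}(v)\le2$. (ii) For every $x\in\beta^*$ that is a claw center of $\beta^*$ there is a set $Z_2\subseteq N_{\beta^*}(x)$ of the form $Z_2=K\cup\{x',x''\}$ with $K$ a clique, such that for every $y\in N_{\beta^*}(x)\setminus Z_2$ there are no $X\in\mathrm{core}$ and cliques $K_1,K_2$ with $X=K_1\cup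 K_2=\mathrm{cl}(K_1,K_2)$ such that $x,y\in K_1$ and $y$ has a neighbour in $D(X)$. (iii) $\gamma_3(\beta^*)\le\omega(G)$. -/

import Mathlib

noncomputable section

namespace CentralBag

/-! Vertex sets are `Set V`; a vertex set stands for the subgraph it induces. -/

section Basic

variable {V : Type*}

/-- `C` is the vertex set of a hole: an induced cycle on at least four vertices. -/
def IsHole (G : SimpleGraph V) (C : Set V) : Prop :=
  ∃ n : ℕ, 4 ≤ n ∧ ∃ f : SimpleGraph.cycleGraph n ↪g G, Set.range f = C

/-- `G` contains no clock, i.e. no hole `C` together with a vertex outside `C` that has two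
non-adjacent neighbours in `C`. -/
def ClockFree (G : SimpleGraph V) : Prop :=
  ¬ ∃ (C : Set V) (v a b : V), IsHole G C ∧ v ∉ C ∧ a ∈ C ∧ b ∈ C ∧ a ≠ b ∧
    G.Adj v a ∧ G.Adj v b ∧ ¬ G.Adj a b

/-- `G` contains no diamond (induced four-vertex graph with exactly five edges). -/
def DiamondFree (G : SimpleGraph V) : Prop :=
  ¬ ∃ a b c d : V, a ≠ b ∧ ¬ G.Adj a b ∧ G.Adj c d ∧
    G.Adj a c ∧ G.Adj a d ∧ G.Adj b c ∧ G.Adj b d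

/-- `X` is a cutset: `G \ X` is non-empty and not connected. -/
def IsCutset (G : SimpleGraph V) (X : Set V) : Prop :=
  Xᶜ.Nonempty ∧ ¬ (G.induce Xᶜ).Connected

/-- `X` is a star cutset: a cutset contained in `N[x]` for some `x ∈ X`. -/
def IsStarCutset (G : SimpleGraph V) (X : Set V) : Prop :=
  IsCutset G X ∧ ∃ x ∈ X, ∀ y ∈ X, y = x ∨ G.Adj x y

/-- `D` is (the vertex set of) a connected component of `G[S]`. -/
def IsComponent (G : SimpleGraph V) (S D : Set V) : Prop :=
  ∃ c : (G.induce S).ConnectedComponent, D = Subtype.val '' c.supp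

/-- The neighbourhood `N(B)` of a vertex set: vertices outside `B` with a neighbour in `B`. -/
def setNbhd (G : SimpleGraph V) (B : Set V) : Set V :=
  {v | v ∉ B ∧ ∃ b ∈ B, G.Adj v b}

/-- The neighbours of `x` in the induced subgraph `G[S]` (for `x ∈ S`). -/
def nbrs (G : SimpleGraph V) (S : Set V) (x : V) : Set V :=
  G.neighborSet x ∩ S

/-- The degree of `x` in the induced subgraph `G[S]` (for `x ∈ S`). -/
def degIn (G : SimpleGraph V) (S : Set V) (x : V) : ℕ :=
  (nbrs G S x).ncard

/-- `x` is a claw center in `G[S]` (for `x ∈ S`): it has three pairwise non-adjacent neighbours. -/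
def IsClawCenter (G : SimpleGraph V) (S : Set V) (x : V) : Prop :=
  ∃ a ∈ nbrs G S x, ∃ b ∈ nbrs G S x, ∃ c ∈ nbrs G S x,
    a ≠ b ∧ a ≠ c ∧ b ≠ c ∧ ¬ G.Adj a b ∧ ¬ G.Adj a c ∧ ¬ G.Adj b c

open Classical in
/-- `γ_d(H)`: the maximum degree of the subgraph of the finite graph `H` induced by the vertices
of degree at least `d` in `H`. -/
def gammaDeg (d : ℕ) [Finite V] (H : SimpleGraph V) : ℕ :=
  letI := Fintype.ofFinite V
  (H.induce {v | d ≤ H.degree v}).maxDegree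

end Basic

section Weighted

variable {V : Type*} [Fintype V]

/-- A weight function: values in `[0, 1]` with total sum `1`. -/
def IsWeight (w : V → ℝ) : Prop :=
  (∀ v, 0 ≤ w v ∧ w v ≤ 1) ∧ ∑ v, w v = 1

/-- `w(X)`, the sum of `w` over `X`. -/
def weight (w : V → ℝ) (X : Set V) : ℝ :=
  ∑ v, X.indicator w v

/-- `X` is a `(w, c)`-balanced separator of `G`. -/
def IsBalancedSep (G : SimpleGraph V) (w : V → ℝ) (c : ℝ) (X : Set V) : Prop :=
  ∀ D : Set V, IsComponent G Xᶜ D → weight w D ≤ c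

/-- The side `B` of the canonical separation `(A, C, B)` of `X`, where `C = X`: the component of
`G \ X` of weight more than `1/2`. (There is at most one such component, and exactly one if `X` is
not a `(w, 1/2)`-balanced separator; the set below is the union of all of them.) -/
def sideB (G : SimpleGraph V) (w : V → ℝ) (X : Set V) : Set V :=
  {v | ∃ D : Set V, IsComponent G Xᶜ D ∧ 1 / 2 < weight w D ∧ v ∈ D}

/-- The side `A` of the canonical separation `(A, C, B)` of `X`, where `C = X`. -/
def sideA (G : SimpleGraph V) (w : V → ℝ) (X : Set V) : Set V :=
  (sideB G w X ∪ X)ᶜ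

/-- `c_S(K)` for a clique `K` of a diamond-free graph: it is `K` if `|K| ≤ 1`, and otherwise it is
`K ∪ (N(x) ∩ N(y) ∩ S)` for distinct `x, y ∈ K`. In a diamond-free graph this does not depend on
the choice of `x, y`, so that all choices are taken together here. -/
def cliqueExt (G : SimpleGraph V) (S K : Set V) : Set V :=
  K ∪ {v | v ∈ S ∧ ∃ x ∈ K, ∃ y ∈ K, x ≠ y ∧ G.Adj x v ∧ G.Adj y v}

/-- `cl(K₁, K₂) = c_{A ∪ C}(K₁ ∩ N(B)) ∪ c_{A ∪ C}(K₂ ∩ N(B))`, where `(A, C, B)` is the canonical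
separation of `K₁ ∪ K₂`. -/
def cl (G : SimpleGraph V) (w : V → ℝ) (K₁ K₂ : Set V) : Set V :=
  let X := K₁ ∪ K₂
  cliqueExt G (sideA G w X ∪ X) (K₁ ∩ setNbhd G (sideB G w X)) ∪
    cliqueExt G (sideA G w X ∪ X) (K₂ ∩ setNbhd G (sideB G w X))

/-- The family `𝒳(G)` of all closures of two cliques. -/
def cliquePairs (G : SimpleGraph V) (w : V → ℝ) : Set (Set V) :=
  {X | ∃ K₁ K₂ : Set V, G.IsClique K₁ ∧ G.IsClique K₂ ∧ X = cl G w K₁ K₂}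

/-- `X` is a `(w, G)`-shield for `X'`. -/
def IsShield (G : SimpleGraph V) (w : V → ℝ) (X X' : Set V) : Prop :=
  sideB G w X ∪ X ⊂ sideB G w X' ∪ X' ∨
    (sideB G w X ∪ X = sideB G w X' ∪ X' ∧ sideB G w X' ⊂ sideB G w X)

/-- The members of `𝒳` that have no shield in `𝒳`. -/
def core (G : SimpleGraph V) (w : V → ℝ) (𝒳 : Set (Set V)) : Set (Set V) :=
  {X' | X' ∈ 𝒳 ∧ ¬ ∃ X ∈ 𝒳, IsShield G w X X'}

/-- The central bag of `G` and `w` with respect to `𝒳`: the intersection of the sets `B ∪ C` over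
the canonical separations `(A, C, B)` of the members of `𝒳`. -/
def centralBag (G : SimpleGraph V) (w : V → ℝ) (𝒳 : Set (Set V)) : Set V :=
  {v | ∀ X ∈ 𝒳, v ∈ sideB G w X ∪ X}

/-- `core(𝒳(G))`. -/
def coreX (G : SimpleGraph V) (w : V → ℝ) : Set (Set V) :=
  core G w (cliquePairs G w)

/-- `β`, the central bag with respect to `core(𝒳(G))`. -/
def beta (G : SimpleGraph V) (w : V → ℝ) : Set V :=
  centralBag G w (coreX G w)

/-- `P` is the vertex set of a path with at least three vertices, with non-adjacent ends in `X` and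
with interior in `D`, all of whose interior vertices have degree two in `G[P ∪ X]`. -/
def IsMarkerPath (G : SimpleGraph V) (X D P : Set V) : Prop :=
  ∃ (x y : V) (p : G.Walk x y), p.IsPath ∧ P = {v | v ∈ p.support} ∧ 3 ≤ P.ncard ∧
    x ∈ X ∧ y ∈ X ∧ ¬ G.Adj x y ∧
    ∀ v ∈ P, v ≠ x → v ≠ y → v ∈ D ∧ degIn G (P ∪ X) v = 2

/-- The choices made in the construction of `β*`: a set `X(D) ∈ core(𝒳(G))` with `D ⊆ A` for every
component `D` of `G \ β`, where `(A, C, B)` is the canonical separation of `X(D)`; and a path `P(X)`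
for every `X ∈ core(𝒳(G))`, namely the empty one if `X(D) = X` for no component `D` of `G \ β`, and
otherwise a marker path through one such `D`. -/
structure Choices (G : SimpleGraph V) (w : V → ℝ) where
  /-- The map `D ↦ X(D)`; only its values at components of `G \ β` matter. -/
  sep : Set V → Set V
  /-- The map `X ↦ P(X)`; only its values on `core(𝒳(G))` matter. -/
  path : Set V → Set V
  sep_spec : ∀ D, IsComponent G (beta G w)ᶜ D →
    sep D ∈ coreX G w ∧ D ⊆ sideA G w (sep D)
  path_empty : ∀ X ∈ coreX G w,
    (¬ ∃ D, IsComponent G (beta G w)ᶜ D ∧ sep D = X) → path X = ∅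
  path_marker : ∀ X ∈ coreX G w,
    (∃ D, IsComponent G (beta G w)ᶜ D ∧ sep D = X) →
      ∃ D, IsComponent G (beta G w)ᶜ D ∧ sep D = X ∧ IsMarkerPath G X D (path X)

/-- `D(X)`, the union of the components `D` of `G \ β` with `X(D) = X`. -/
def Choices.compUnion {G : SimpleGraph V} {w : V → ℝ} (M : Choices G w) (X : Set V) : Set V :=
  {v | ∃ D, IsComponent G (beta G w)ᶜ D ∧ M.sep D = X ∧ v ∈ D}

/-- `β* = β ∪ ⋃ P(X)`, the union over `X ∈ core(𝒳(G))`. -/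
def Choices.betaStar {G : SimpleGraph V} {w : V → ℝ} (M : Choices G w) : Set V :=
  beta G w ∪ {v | ∃ X ∈ coreX G w, v ∈ M.path X}

end Weighted

end CentralBag

end

/-!
Write `(A, X, B)` for the canonical separation of `X`, and call `B` its heavy and `A` its light
side. Two sets of weight more than `1/2` meet, and the union of two members of `𝒳` is still too
small to be a balanced separator; so the heavy sides of two members of `𝒳` always meet.

Clocks are excluded in the form of `no_clock_of_two_connSets`: if two non-adjacent vertices both
see two anticomplete connected sets, they lie on a hole through these sets, and hence no vertex
outside is adjacent to both.

*The choices exist.* Every member of `𝒳` is a union of two cliques closed under common neighbours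
outside its heavy side (`ClosedPair`). If components of the light sides of two members of `𝒳`
touch, they lie together on the light side of a third member, the closure of the two cliques that
cover the neighbourhood of their union (`exists_union_subset_sideA`). A largest component of a
light side that meets a component of `G \ β` therefore contains it, so that every component of
`G \ β` lies on the light side of a member of the core (`exists_mem_coreX_subset_sideA`). Inside a
component `D` of a light side, a shortest path between non-adjacent vertices of `X` that see `D` is
a marker path: a further vertex of `X` adjacent to its interior would produce a clock, or an edge
between the two cliques that `ClosedPair.not_adj_of_sees` forbids.

*Neighbourhoods in `β`.* Without star cutsets, any two non-adjacent neighbours of a vertex `y` lie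
on a hole through `y`. If a connected set `J` is avoided by all holes through `y` that miss a given
vertex `x`, then its attachments to these holes form a clique `R`
(`HolesAvoid.adj_of_sees_of_sees`), and `{x} ∪ R` cuts off `J`. Since `β` lies in `B ∪ X` for every
`X ∈ 𝒳` (`beta_subset`), and in particular for the closure of `{x}` and `R`, a vertex of `β` on the
light side of `{x} ∪ R` has two neighbours in `R`. Together with the absence of star cutsets this
shows that of two non-adjacent neighbours `y`, `z ∈ β` of `x ∈ β`, one has a clique as its
neighbourhood apart from `x` (`isClique_or_isClique_of_mem_beta`), and that then the neighbourhood
of `x` apart from this vertex is a clique as well (`isClique_of_isClique_of_mem_beta`). So the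
neighbourhood in `β` of every `x ∈ β` is a clique and one more vertex.

*Degrees in `β*`.* A vertex of `β*` outside `β` is an interior vertex of a marker path through a
component `D` of `G \ β`. All its neighbours in `β*` lie on this path or in `X(D)`, so it has
degree at most two. Hence all but a clique and one vertex among the neighbours of `x` in `β*` have
degree at most two, which also bounds `γ₃(β*)`, because the clique together with `x` is a clique.
The exceptional neighbours are outside `β`, whereas a vertex `y ∈ X` with a neighbour in `D(X)` is
in `β`, for otherwise it would lie in `D(X)` itself, on the light side of `X`.
-/

namespace CentralBag

/-! ### Connected vertex sets -/

section Connectivity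

variable {V : Type*} {G : SimpleGraph V}

/-- `S` is a non-empty vertex set inducing a connected subgraph, stated through cuts: a set that
meets `S` and is closed under adjacency inside `S` contains `S`. -/
def ConnSet (G : SimpleGraph V) (S : Set V) : Prop :=
  S.Nonempty ∧ ∀ T : Set V, (∃ a ∈ S, a ∈ T) →
    (∀ a ∈ S, a ∈ T → ∀ b ∈ S, G.Adj a b → b ∈ T) → S ⊆ T

/-- The vertex `v` has a neighbour in `S`. -/
def Sees (G : SimpleGraph V) (v : V) (S : Set V) : Prop :=
  ∃ s ∈ S, G.Adj v s

/-- `S` and `T` are disjoint and there is no edge between them. -/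
def Anticomplete (G : SimpleGraph V) (S T : Set V) : Prop :=
  ∀ s ∈ S, ∀ t ∈ T, s ≠ t ∧ ¬ G.Adj s t

/-- `D` is a connected component of `G[S]`: connected, contained in `S`, closed under adjacency. -/
def IsComp (G : SimpleGraph V) (S D : Set V) : Prop :=
  ConnSet G D ∧ D ⊆ S ∧ ∀ a ∈ D, ∀ b ∈ S, G.Adj a b → b ∈ D

/-- The component of `G[S]` that contains `v` (for `v ∈ S`). -/
def comp (G : SimpleGraph V) (S : Set V) (v : V) : Set V :=
  {u | ∀ T : Set V, v ∈ T → (∀ a ∈ T, ∀ b ∈ S, G.Adj a b → b ∈ T) → u ∈ T}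

lemma Sees.mono {v : V} {S T : Set V} (h : Sees G v S) (hST : S ⊆ T) : Sees G v T :=
  let ⟨s, hs, hv⟩ := h
  ⟨s, hST hs, hv⟩

lemma Anticomplete.symm {S T : Set V} (h : Anticomplete G S T) : Anticomplete G T S :=
  fun t ht s hs => ⟨(h s hs t ht).1.symm, fun e => (h s hs t ht).2 e.symm⟩

lemma Anticomplete.mono {S T S' T' : Set V} (h : Anticomplete G S T) (hS : S' ⊆ S)
    (hT : T' ⊆ T) : Anticomplete G S' T' :=
  fun s hs t ht => h s (hS hs) t (hT ht)

lemma Anticomplete.union_left {S S' T : Set V} (h : Anticomplete G S T)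
    (h' : Anticomplete G S' T) : Anticomplete G (S ∪ S') T := by
  rintro s (hs | hs) t ht
  exacts [h s hs t ht, h' s hs t ht]

lemma Anticomplete.union_right {S T T' : Set V} (h : Anticomplete G S T)
    (h' : Anticomplete G S T') : Anticomplete G S (T ∪ T') :=
  (h.symm.union_left h'.symm).symm

lemma ConnSet.singleton (v : V) : ConnSet G {v} := by
  refine ⟨⟨v, rfl⟩, fun T ⟨a, ha, haT⟩ _ => ?_⟩
  rintro b rfl
  rwa [Set.mem_singleton_iff.1 ha] at haT

lemma ConnSet.union {S T : Set V} (hS : ConnSet G S) (hT : ConnSet G T)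
    (h : ∃ s ∈ S, ∃ t ∈ T, s = t ∨ G.Adj s t) : ConnSet G (S ∪ T) := by
  obtain ⟨s, hs, t, ht, hst⟩ := h
  refine ⟨⟨s, Or.inl hs⟩, fun R ⟨a, ha, haR⟩ hR => ?_⟩
  have hSR : (∃ a ∈ S, a ∈ R) → S ⊆ R := fun h =>
    hS.2 R h fun a ha haR b hb hab => hR a (Or.inl ha) haR b (Or.inl hb) hab
  have hTR : (∃ a ∈ T, a ∈ R) → T ⊆ R := fun h =>
    hT.2 R h fun a ha haR b hb hab => hR a (Or.inr ha) haR b (Or.inr hb) hab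
  have key : s ∈ R ↔ t ∈ R := by
    rcases hst with rfl | hst
    · rfl
    · exact ⟨fun h => hR s (Or.inl hs) h t (Or.inr ht) hst,
        fun h => hR t (Or.inr ht) h s (Or.inl hs) hst.symm⟩
  rcases ha with ha | ha
  · have h1 := hSR ⟨a, ha, haR⟩
    exact Set.union_subset h1 (hTR ⟨t, ht, key.1 (h1 hs)⟩)
  · have h1 := hTR ⟨a, ha, haR⟩
    exact Set.union_subset (hSR ⟨s, hs, key.2 (h1 ht)⟩) h1

lemma ConnSet.union_of_mem {S T : Set V} (hS : ConnSet G S) (hT : ConnSet G T) {v : V}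
    (h1 : v ∈ S) (h2 : v ∈ T) : ConnSet G (S ∪ T) :=
  hS.union hT ⟨v, h1, v, h2, Or.inl rfl⟩

lemma ConnSet.union_singleton {S : Set V} (hS : ConnSet G S) {v : V} (h : Sees G v S) :
    ConnSet G (S ∪ {v}) :=
  let ⟨s, hs, hv⟩ := h
  hS.union (ConnSet.singleton v) ⟨s, hs, v, rfl, Or.inr hv.symm⟩

/-- A connected set that meets `T` without lying inside `T` has an edge leaving `T`. -/
lemma ConnSet.exists_adj {S T : Set V} (hS : ConnSet G S) {a b : V} (ha : a ∈ S) (haT : a ∈ T)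
    (hb : b ∈ S) (hbT : b ∉ T) : ∃ p ∈ S, p ∈ T ∧ ∃ q ∈ S, q ∉ T ∧ G.Adj p q := by
  by_contra hcon
  refine hbT (hS.2 T ⟨a, ha, haT⟩ (fun p hp hpT q hq hpq => ?_) hb)
  by_contra hqT
  exact hcon ⟨p, hp, hpT, q, hq, hqT, hpq⟩

lemma ConnSet.subset_of_anticomplete {S A B : Set V} (hS : ConnSet G S) (hAB : Anticomplete G A B)
    (hsub : S ⊆ A ∪ B) {a : V} (ha : a ∈ S) (haA : a ∈ A) : S ⊆ A := by
  refine hS.2 A ⟨a, ha, haA⟩ fun p _ hpA q hq hpq => ?_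
  rcases hsub hq with h | h
  · exact h
  · exact absurd hpq (hAB p hpA q h).2

lemma mem_comp (S : Set V) (v : V) : v ∈ comp G S v := fun _ hv _ => hv

lemma comp_closed {S : Set V} {v a b : V} (ha : a ∈ comp G S v) (hb : b ∈ S) (hab : G.Adj a b) :
    b ∈ comp G S v :=
  fun T hv hT => hT a (ha T hv hT) b hb hab

lemma comp_subset {S : Set V} {v : V} (hv : v ∈ S) : comp G S v ⊆ S :=
  fun _ hu => hu S hv fun _ _ _ hb _ => hb

lemma connSet_comp (S : Set V) (v : V) : ConnSet G (comp G S v) := by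
  refine ⟨⟨v, mem_comp S v⟩, ?_⟩
  -- the cut condition is first checked for sets containing `v`, then for their complements
  have key : ∀ T : Set V, v ∈ T →
      (∀ a ∈ comp G S v, a ∈ T → ∀ b ∈ comp G S v, G.Adj a b → b ∈ T) → comp G S v ⊆ T := by
    intro T hvT hT u hu
    have := hu (T ∩ comp G S v) ⟨hvT, mem_comp S v⟩ (fun a ha b hb hab =>
      ⟨hT a ha.2 ha.1 b (comp_closed ha.2 hb hab) hab, comp_closed ha.2 hb hab⟩)
    exact this.1
  rintro T ⟨a, ha, haT⟩ hT
  by_cases hvT : v ∈ T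
  · exact key T hvT hT
  · exfalso
    have := key Tᶜ hvT (fun p hp hpT q hq hpq hqT => hpT (hT q hq hqT p hp hpq.symm))
    exact this ha haT

lemma isComp_comp {S : Set V} {v : V} (hv : v ∈ S) : IsComp G S (comp G S v) :=
  ⟨connSet_comp S v, comp_subset hv, fun _ ha _ hb hab => comp_closed ha hb hab⟩

/-- A connected subset of `S` meeting a component of `G[S]` lies inside it. -/
lemma IsComp.subset_of_mem {S D C : Set V} (hD : IsComp G S D) (hC : ConnSet G C) (hCS : C ⊆ S)
    {v : V} (hvC : v ∈ C) (hvD : v ∈ D) : C ⊆ D :=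
  hC.2 D ⟨v, hvC, hvD⟩ fun a _ haD b hb hab => hD.2.2 a haD b (hCS hb) hab

lemma IsComp.eq_of_mem {S D D' : Set V} (hD : IsComp G S D) (hD' : IsComp G S D') {v : V}
    (hv : v ∈ D) (hv' : v ∈ D') : D = D' :=
  (hD'.subset_of_mem hD.1 hD.2.1 hv hv').antisymm (hD.subset_of_mem hD'.1 hD'.2.1 hv' hv)

lemma IsComp.anticomplete {S D D' : Set V} (hD : IsComp G S D) (hD' : IsComp G S D')
    (hne : D ≠ D') : Anticomplete G D D' := by
  refine fun s hs t ht => ⟨fun h => ?_, fun h => ?_⟩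
  · subst h; exact hne (hD.eq_of_mem hD' hs ht)
  · exact hne (hD.eq_of_mem hD' (hD.2.2 s hs t (hD'.2.1 ht) h) ht)

/-- The neighbourhood of a component of `G \ X` lies in `X`. -/
lemma IsComp.setNbhd_subset {X D : Set V} (hD : IsComp G Xᶜ D) : setNbhd G D ⊆ X := by
  rintro v ⟨hv, d, hd, hvd⟩
  by_contra h
  exact hv (hD.2.2 d hd v h hvd.symm)

lemma IsComp.not_mem {X D : Set V} (hD : IsComp G Xᶜ D) {v : V} (hv : v ∈ D) : v ∉ X :=
  hD.2.1 hv

/-- A connected set disjoint from `X` whose neighbourhood lies in `X` is a component of `G \ X`. -/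
lemma isComp_of_setNbhd_subset {X D : Set V} (hD : ConnSet G D) (hdisj : ∀ v ∈ D, v ∉ X)
    (h : setNbhd G D ⊆ X) : IsComp G Xᶜ D := by
  refine ⟨hD, hdisj, fun a ha b hb hab => ?_⟩
  by_contra hbD
  exact hb (h ⟨hbD, a, ha, hab.symm⟩)

lemma isComp_setNbhd {D : Set V} (hD : ConnSet G D) : IsComp G (setNbhd G D)ᶜ D :=
  isComp_of_setNbhd_subset hD (fun _ hv h => h.1 hv) subset_rfl

lemma connSet_iff_connected {S : Set V} : ConnSet G S ↔ (G.induce S).Connected := by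
  constructor
  · rintro ⟨⟨v, hv⟩, h⟩
    have : Nonempty S := ⟨⟨v, hv⟩⟩
    refine ⟨fun a b => ?_⟩
    have := h {u | ∃ hu : u ∈ S, (G.induce S).Reachable a ⟨u, hu⟩}
      ⟨a, a.2, a.2, SimpleGraph.Reachable.refl _⟩ (by
        rintro p hp ⟨_, hr⟩ q hq hpq
        exact ⟨hq, hr.trans (SimpleGraph.Adj.reachable (by simpa using hpq))⟩)
    obtain ⟨_, hr⟩ := this b.2
    exact hr
  · intro hconn
    obtain ⟨v⟩ := hconn.nonempty
    refine ⟨⟨v, v.2⟩, ?_⟩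
    rintro T ⟨a, ha, haT⟩ hT b hb
    obtain ⟨p⟩ := hconn.preconnected ⟨a, ha⟩ ⟨b, hb⟩
    suffices ∀ (x y : S), (G.induce S).Walk x y → (x : V) ∈ T → (y : V) ∈ T from
      this _ _ p haT
    intro x y p
    induction p with
    | nil => exact id
    | cons hadj _ ih =>
      exact fun hx => ih (hT _ (Subtype.prop _) hx _ (Subtype.prop _) (by simpa using hadj))

lemma isComponent_iff {S D : Set V} : IsComponent G S D ↔ IsComp G S D := by
  constructor
  · rintro ⟨c, rfl⟩
    obtain ⟨v, rfl⟩ := c.exists_rep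
    have : Subtype.val '' ((G.induce S).connectedComponentMk v).supp = comp G S v := by
      ext u
      simp only [Set.mem_image, SimpleGraph.ConnectedComponent.mem_supp_iff, Subtype.exists,
        exists_and_right, exists_eq_right, SimpleGraph.ConnectedComponent.eq]
      constructor
      · rintro ⟨hu, hr⟩
        obtain ⟨p⟩ := hr.symm
        suffices ∀ (x y : S), (G.induce S).Walk x y → (x : V) ∈ comp G S v →
            (y : V) ∈ comp G S v from this _ _ p (mem_comp S v)
        intro x y p
        induction p with
        | nil => exact id
        | cons hadj _ ih =>
          exact fun hx => ih (comp_closed hx (Subtype.prop _) (by simpa using hadj))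
      · intro hu
        obtain ⟨h1, h2⟩ := hu {w | ∃ hw : w ∈ S, (G.induce S).Reachable v ⟨w, hw⟩}
          ⟨v.2, SimpleGraph.Reachable.refl _⟩ (by
            rintro p ⟨hp, hr⟩ q hq hpq
            exact ⟨hq, hr.trans (SimpleGraph.Adj.reachable (by simpa using hpq))⟩)
        exact ⟨h1, h2.symm⟩
    change IsComp G S (Subtype.val '' ((G.induce S).connectedComponentMk v).supp)
    rw [this]
    exact isComp_comp v.2
  · intro hD
    obtain ⟨v, hv⟩ := hD.1.1
    refine ⟨(G.induce S).connectedComponentMk ⟨v, hD.2.1 hv⟩, ?_⟩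
    ext u
    simp only [Set.mem_image, SimpleGraph.ConnectedComponent.mem_supp_iff, Subtype.exists,
      exists_and_right, exists_eq_right, SimpleGraph.ConnectedComponent.eq]
    constructor
    · intro hu
      obtain ⟨_, h2⟩ := hD.1.2 {w | ∃ hw : w ∈ S, (G.induce S).Reachable ⟨w, hw⟩ ⟨v, hD.2.1 hv⟩}
        ⟨v, hv, hD.2.1 hv, SimpleGraph.Reachable.refl _⟩ (by
          rintro p hp ⟨hpS, hr⟩ q hq hpq
          exact ⟨hD.2.1 hq, SimpleGraph.Reachable.trans
            (SimpleGraph.Adj.reachable (by simpa using hpq.symm)) hr⟩) hu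
      exact ⟨hD.2.1 hu, h2⟩
    · rintro ⟨hu, hr⟩
      obtain ⟨p⟩ := hr.symm
      suffices ∀ (x y : S), (G.induce S).Walk x y → (x : V) ∈ D → (y : V) ∈ D from this _ _ p hv
      intro x y p
      induction p with
      | nil => exact id
      | cons hadj _ ih =>
        exact fun hx => ih (hD.2.2 _ hx _ (Subtype.prop _) (by simpa using hadj))

/-- How the absence of star cutsets is used: a set `X ⊆ N[x]` with `x ∈ X` does not separate a
non-empty union `E` of components of `G \ X` from another vertex. -/
lemma no_star (hstar : ¬ ∃ X : Set V, IsStarCutset G X) {X E : Set V} {x b : V} (hx : x ∈ X)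
    (hX : ∀ y ∈ X, y = x ∨ G.Adj x y) (hE : E.Nonempty) (hEX : ∀ e ∈ E, e ∉ X)
    (hcl : ∀ a ∈ E, ∀ b, b ∉ X → G.Adj a b → b ∈ E) (hbX : b ∉ X) (hbE : b ∉ E) : False := by
  refine hstar ⟨X, ⟨⟨b, hbX⟩, fun hconn => ?_⟩, x, hx, hX⟩
  obtain ⟨e, he⟩ := hE
  exact hbE ((connSet_iff_connected.2 hconn).2 E ⟨e, hEX e he, he⟩
    (fun a _ haE c hc hac => hcl a haE c hc hac) hbX)

/-- In the absence of star cutsets, the neighbourhood of a connected set is not contained in the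
closed neighbourhood of one of its vertices, as long as something remains outside. -/
lemma exists_nonadj_mem_setNbhd (hstar : ¬ ∃ X : Set V, IsStarCutset G X) {D : Set V}
    (hD : ConnSet G D) {a b : V} (ha : a ∈ setNbhd G D) (hbD : b ∉ D) (hb : b ∉ setNbhd G D) :
    ∃ c ∈ setNbhd G D, c ≠ a ∧ ¬ G.Adj a c := by
  by_contra hcon
  push Not at hcon
  refine no_star hstar ha (fun y hy => ?_) hD.1 (fun e he h => h.1 he)
    (fun p hp q hq hpq => (isComp_setNbhd hD).2.2 p hp q hq hpq) hb hbD
  by_cases h : y = a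
  · exact Or.inl h
  · exact Or.inr (hcon y hy h)

end Connectivity

/-! ### Induced paths and holes -/

section Cycles

variable {V : Type*} {G : SimpleGraph V}

/-- `p 0, …, p k` is a walk inside `S`. -/
def WalkIn (G : SimpleGraph V) (S : Set V) (k : ℕ) (p : ℕ → V) : Prop :=
  (∀ i ≤ k, p i ∈ S) ∧ ∀ i < k, G.Adj (p i) (p (i + 1))

/-- `p 0, …, p k` is an induced path. -/
def IndPath (G : SimpleGraph V) (k : ℕ) (p : ℕ → V) : Prop :=
  ∀ i j, i < j → j ≤ k → p i ≠ p j ∧ (G.Adj (p i) (p j) ↔ j = i + 1)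

/-- `f 0, …, f (n - 1)` is a hole, in this cyclic order. -/
structure Cyc (G : SimpleGraph V) (n : ℕ) (f : ℕ → V) : Prop where
  four_le : 4 ≤ n
  ne : ∀ i j, i < j → j < n → f i ≠ f j
  adj : ∀ i j, i < j → j < n → (G.Adj (f i) (f j) ↔ j = i + 1 ∨ (i = 0 ∧ j + 1 = n))

/-- The set of the vertices `f s, …, f r`. -/
def seg (f : ℕ → V) (s r : ℕ) : Set V :=
  {v | ∃ q, s ≤ q ∧ q ≤ r ∧ f q = v}

lemma mem_seg {f : ℕ → V} {s r q : ℕ} (h1 : s ≤ q) (h2 : q ≤ r) : f q ∈ seg f s r :=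
  ⟨q, h1, h2, rfl⟩

lemma connSet_seg {f : ℕ → V} {s r : ℕ} (hsr : s ≤ r)
    (h : ∀ q, s ≤ q → q < r → G.Adj (f q) (f (q + 1))) : ConnSet G (seg f s r) := by
  induction r, hsr using Nat.le_induction with
  | base =>
    have : seg f s s = {f s} := by
      ext v
      constructor
      · rintro ⟨q, h1, h2, rfl⟩
        rw [le_antisymm h2 h1]; rfl
      · rintro rfl
        exact mem_seg le_rfl le_rfl
    rw [this]
    exact ConnSet.singleton _
  | succ r hr ih =>
    have : seg f s (r + 1) = seg f s r ∪ {f (r + 1)} := by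
      ext v
      constructor
      · rintro ⟨q, h1, h2, rfl⟩
        rcases Nat.lt_or_ge r q with h3 | h3
        · right; rw [le_antisymm h2 h3]; rfl
        · left; exact mem_seg h1 h3
      · rintro (⟨q, h1, h2, rfl⟩ | rfl)
        · exact mem_seg h1 (by omega)
        · exact mem_seg (by omega) le_rfl
    rw [this]
    exact (ih fun q h1 h2 => h q h1 (by omega)).union_singleton
      ⟨f r, mem_seg hr le_rfl, (h r hr (by omega)).symm⟩

/-- In a connected set any two vertices are joined by a walk. -/
lemma ConnSet.exists_walkIn {W : Set V} (hW : ConnSet G W) {a b : V} (ha : a ∈ W) (hb : b ∈ W) :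
    ∃ k p, WalkIn G W k p ∧ p 0 = a ∧ p k = b := by
  refine hW.2 {u | ∃ k p, WalkIn G W k p ∧ p 0 = a ∧ p k = u}
    ⟨a, ha, 0, fun _ => a, ⟨fun _ _ => ha, fun _ h => absurd h (by omega)⟩, rfl, rfl⟩ ?_ hb
  rintro u hu ⟨k, p, hp, h0, hk⟩ v hv huv
  refine ⟨k + 1, fun i => if i ≤ k then p i else v, ⟨fun i hi => ?_, fun i hi => ?_⟩, ?_, ?_⟩
  · dsimp only
    split_ifs with h
    exacts [hp.1 i h, hv]
  · dsimp only
    rw [if_pos (by omega)]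
    split_ifs with h
    · exact hp.2 i (by omega)
    · have : i = k := by omega
      rw [this, hk]; exact huv
  · simpa using h0
  · simp

/-- A walk with a repeated vertex or a chord can be shortened, keeping its ends. -/
lemma WalkIn.shortcut {W : Set V} {k : ℕ} {p : ℕ → V} (hp : WalkIn G W k p) {i j : ℕ}
    (hij : i < j) (hj : j ≤ k)
    (h : p i = p j ∨ (G.Adj (p i) (p j) ∧ j ≠ i + 1)) :
    ∃ k' p', k' < k ∧ WalkIn G W k' p' ∧ p' 0 = p 0 ∧ p' k' = p k := by
  rcases h with h | ⟨h, hne⟩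
  · refine ⟨k - (j - i), fun q => if q ≤ i then p q else p (q + (j - i)), by omega,
      ⟨fun q hq => ?_, fun q hq => ?_⟩, by simp, ?_⟩
    · dsimp only
      split_ifs with h1
      exacts [hp.1 _ (by omega), hp.1 _ (by omega)]
    · dsimp only
      by_cases h1 : q + 1 ≤ i
      · rw [if_pos (by omega), if_pos h1]; exact hp.2 _ (by omega)
      · rw [if_neg h1]
        split_ifs with h2
        · have : q = i := by omega
          subst this
          rw [h, show q + 1 + (j - q) = j + 1 by omega]; exact hp.2 _ (by omega)
        · rw [show q + 1 + (j - i) = (q + (j - i)) + 1 by omega]; exact hp.2 _ (by omega)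
    · dsimp only
      split_ifs with h1
      · have h2 : k - (j - i) = i := by omega
        have h3 : j = k := by omega
        rw [h2, h, h3]
      · congr 1; omega
  · refine ⟨k - (j - i - 1), fun q => if q ≤ i then p q else p (q + (j - i - 1)), by omega,
      ⟨fun q hq => ?_, fun q hq => ?_⟩, by simp, ?_⟩
    · dsimp only
      split_ifs with h1
      exacts [hp.1 _ (by omega), hp.1 _ (by omega)]
    · dsimp only
      by_cases h1 : q + 1 ≤ i
      · rw [if_pos (by omega), if_pos h1]; exact hp.2 _ (by omega)
      · rw [if_neg h1]
        split_ifs with h2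
        · have : q = i := by omega
          subst this
          rw [show q + 1 + (j - q - 1) = j by omega]; exact h
        · rw [show q + 1 + (j - i - 1) = (q + (j - i - 1)) + 1 by omega]; exact hp.2 _ (by omega)
    · dsimp only
      rw [if_neg (by omega)]
      congr 1; omega

/-- A shortest walk with a given property of its ends is an induced path. -/
lemma exists_indPath_of_walkIn {W : Set V} (Q : V → V → Prop)
    (h : ∃ k p, WalkIn G W k p ∧ Q (p 0) (p k)) :
    ∃ k p, WalkIn G W k p ∧ Q (p 0) (p k) ∧ IndPath G k p ∧
      ∀ k' p', k' < k → WalkIn G W k' p' → ¬ Q (p' 0) (p' k') := by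
  classical
  obtain ⟨p, hp, hQ⟩ := Nat.find_spec h
  have hmin : ∀ k' p', k' < Nat.find h → WalkIn G W k' p' → ¬ Q (p' 0) (p' k') :=
    fun k' p' hk hp' hQ' => Nat.find_min h hk ⟨p', hp', hQ'⟩
  refine ⟨Nat.find h, p, hp, hQ, fun i j hij hj => ⟨fun he => ?_, fun ha => ?_, ?_⟩, hmin⟩
  · obtain ⟨k', p', hk, hw, h0, h1⟩ := hp.shortcut hij hj (Or.inl he)
    exact hmin k' p' hk hw (by rwa [h0, h1])
  · by_contra hne
    obtain ⟨k', p', hk, hw, h0, h1⟩ := hp.shortcut hij hj (Or.inr ⟨ha, hne⟩)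
    exact hmin k' p' hk hw (by rwa [h0, h1])
  · rintro rfl
    exact hp.2 i (by omega)

/-- Two vertices that see a connected set `U` are joined by an induced path through `U`. -/
lemma ConnSet.exists_indPath {U : Set V} (hU : ConnSet G U) {u v : V} (hu : Sees G u U)
    (hv : Sees G v U) : ∃ k p, IndPath G k p ∧ p 0 = u ∧ p k = v ∧
      ∀ i, 0 < i → i < k → p i ∈ U := by
  have hW : ConnSet G (U ∪ {u} ∪ {v}) :=
    (hU.union_singleton hu).union_singleton (hv.mono Set.subset_union_left)
  obtain ⟨k, p, hp, h0, hk⟩ := hW.exists_walkIn (a := u) (b := v) (by simp) (by simp)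
  obtain ⟨k, p, hp, ⟨h0, hk⟩, hind, _⟩ :=
    exists_indPath_of_walkIn (fun a b => a = u ∧ b = v) ⟨k, p, hp, h0, hk⟩
  refine ⟨k, p, hind, h0, hk, fun i hi hik => ?_⟩
  rcases hp.1 i hik.le with (h | h) | h
  · exact h
  · exact absurd (h0.trans h.symm) (hind 0 i hi hik.le).1
  · exact absurd (h.trans hk.symm) (hind i k hik le_rfl).1

namespace Cyc

variable {n : ℕ} {f : ℕ → V}

lemma ne' (hf : Cyc G n f) {i j : ℕ} (hi : i < n) (hj : j < n) (h : i ≠ j) : f i ≠ f j := by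
  rcases Nat.lt_or_gt_of_ne h with h | h
  · exact hf.ne i j h hj
  · exact (hf.ne j i h hi).symm

lemma adj_iff (hf : Cyc G n f) {i j : ℕ} (hi : i < n) (hj : j < n) :
    G.Adj (f i) (f j) ↔ j = i + 1 ∨ i = j + 1 ∨ (i = 0 ∧ j + 1 = n) ∨ (j = 0 ∧ i + 1 = n) := by
  have := hf.four_le
  rcases Nat.lt_trichotomy i j with h | h | h
  · rw [hf.adj i j h hj]; omega
  · subst h
    have := G.irrefl (v := f i)
    constructor
    · intro h; exact absurd h this
    · intro h; exfalso; omega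
  · rw [SimpleGraph.adj_comm, hf.adj j i h hi]; omega

lemma isHole (hf : Cyc G n f) : IsHole G {v | ∃ q < n, f q = v} := by
  have h4 := hf.four_le
  obtain ⟨m, rfl⟩ : ∃ m, n = m + 4 := ⟨n - 4, by omega⟩
  refine ⟨m + 4, h4, ⟨⟨fun i => f i, fun i j hij => ?_⟩, ?_⟩, ?_⟩
  · by_contra h
    exact hf.ne' i.2 j.2 (fun e => h (Fin.ext e)) hij
  · intro i j
    change G.Adj (f i) (f j) ↔ _
    rw [hf.adj_iff i.2 j.2, SimpleGraph.cycleGraph_adj']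
    rw [Fin.val_sub, Fin.val_sub]
    have hi := i.2
    have hj := j.2
    generalize (i : ℕ) = a at *
    generalize (j : ℕ) = b at *
    rcases Nat.lt_trichotomy a b with h | h | h
    · rw [show m + 4 - b + a = m + 4 - (b - a) by omega, Nat.mod_eq_of_lt (by omega),
        show m + 4 - a + b = (b - a) + (m + 4) by omega, Nat.add_mod_right,
        Nat.mod_eq_of_lt (by omega)]
      omega
    · subst h
      rw [show m + 4 - a + a = m + 4 by omega, Nat.mod_self]
      omega
    · rw [show m + 4 - a + b = m + 4 - (a - b) by omega,
        Nat.mod_eq_of_lt (by omega : m + 4 - (a - b) < m + 4),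
        show m + 4 - b + a = (a - b) + (m + 4) by omega, Nat.add_mod_right,
        Nat.mod_eq_of_lt (by omega)]
      omega
  · ext v
    constructor
    · rintro ⟨i, rfl⟩
      exact ⟨i, i.2, rfl⟩
    · rintro ⟨q, hq, rfl⟩
      exact ⟨⟨q, hq⟩, rfl⟩

/-- The absence of clocks: the neighbours of an outside vertex on a hole are pairwise adjacent. -/
lemma no_clock (hf : Cyc G n f) (hclock : ClockFree G) {v a b : V} (hv : ∀ q < n, f q ≠ v)
    (ha : ∃ q < n, f q = a) (hb : ∃ q < n, f q = b) (hab : a ≠ b) (hva : G.Adj v a)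
    (hvb : G.Adj v b) (hnab : ¬ G.Adj a b) : False :=
  hclock ⟨_, v, a, b, hf.isHole, fun ⟨q, hq, h⟩ => hv q hq h, ha, hb, hab, hva, hvb, hnab⟩

lemma rotate (hf : Cyc G n f) {s : ℕ} (hs : s < n) :
    ∃ f' : ℕ → V, Cyc G n f' ∧ f' 0 = f s ∧ ∀ v, (∃ q < n, f' q = v) ↔ ∃ q < n, f q = v := by
  have h4 := hf.four_le
  refine ⟨fun q => f (if q + s < n then q + s else q + s - n), ⟨h4, fun i j hij hj => ?_,
    fun i j hij hj => ?_⟩, ?_, fun v => ⟨?_, ?_⟩⟩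
  · apply hf.ne' <;> split_ifs <;> omega
  · rw [hf.adj_iff (by split_ifs <;> omega) (by split_ifs <;> omega)]
    split_ifs <;> omega
  · simp [hs]
  · rintro ⟨q, hq, rfl⟩
    exact ⟨_, by split_ifs <;> omega, rfl⟩
  · rintro ⟨q, hq, rfl⟩
    refine ⟨if s ≤ q then q - s else q + n - s, by split_ifs <;> omega, ?_⟩
    dsimp only
    congr 1
    by_cases hsq : s ≤ q
    · rw [if_pos hsq, if_pos (by omega)]; omega
    · rw [if_neg hsq, if_neg (by omega)]; omega

lemma reverse (hf : Cyc G n f) : Cyc G n (fun q => f (if q = 0 then 0 else n - q)) := by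
  have h4 := hf.four_le
  refine ⟨h4, fun i j hij hj => ?_, fun i j hij hj => ?_⟩
  · apply hf.ne' <;> split_ifs <;> omega
  · rw [hf.adj_iff (by split_ifs <;> omega) (by split_ifs <;> omega)]
    rcases Nat.eq_zero_or_pos i with rfl | hi
    · rw [if_pos rfl, if_neg (by omega)]; omega
    · rw [if_neg (by omega), if_neg (by omega)]; omega

lemma connSet_seg (hf : Cyc G n f) {s r : ℕ} (hsr : s ≤ r) (hr : r < n) :
    ConnSet G (seg f s r) :=
  CentralBag.connSet_seg hsr fun q h1 h2 => (hf.adj q (q + 1) (by omega) (by omega)).2 (Or.inl rfl)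

end Cyc

/-- The vertex set of the closed walk `f 0, …, f (n - 1)`. -/
def cycSet (n : ℕ) (f : ℕ → V) : Set V :=
  {v | ∃ q < n, f q = v}

namespace Cyc

variable {n : ℕ} {f : ℕ → V}

lemma exists_rotate (hf : Cyc G n f) {a : V} (ha : a ∈ cycSet n f) :
    ∃ f' : ℕ → V, Cyc G n f' ∧ f' 0 = a ∧ cycSet n f' = cycSet n f := by
  obtain ⟨s, hs, rfl⟩ := ha
  obtain ⟨f', h1, h2, h3⟩ := hf.rotate hs
  exact ⟨f', h1, h2, Set.ext h3⟩

/-- The neighbours of `f 0` on the hole are `f 1` and `f (n - 1)`. -/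
lemma adj_zero (hf : Cyc G n f) {b : V} (hb : b ∈ cycSet n f) (h : G.Adj (f 0) b) :
    b = f 1 ∨ b = f (n - 1) := by
  obtain ⟨q, hq, rfl⟩ := hb
  have h4 := hf.four_le
  rw [hf.adj_iff (by omega) hq] at h
  rcases h with h | h | h | h
  · left; rw [h]
  · omega
  · right; rw [← h.2]; rfl
  · omega

lemma adj_zero_one (hf : Cyc G n f) : G.Adj (f 0) (f 1) :=
  (hf.adj 0 1 (by omega) (by have := hf.four_le; omega)).2 (Or.inl rfl)

lemma adj_zero_last (hf : Cyc G n f) : G.Adj (f 0) (f (n - 1)) :=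
  (hf.adj 0 (n - 1) (by have := hf.four_le; omega) (by have := hf.four_le; omega)).2
    (Or.inr ⟨rfl, by have := hf.four_le; omega⟩)

lemma adj_succ (hf : Cyc G n f) {q : ℕ} (h : q + 1 < n) : G.Adj (f q) (f (q + 1)) :=
  (hf.adj q (q + 1) (by omega) h).2 (Or.inl rfl)

lemma cycSet_diff_zero (hf : Cyc G n f) : cycSet n f \ {f 0} = seg f 1 (n - 1) := by
  have h4 := hf.four_le
  ext v
  constructor
  · rintro ⟨⟨q, hq, rfl⟩, h⟩
    refine mem_seg ?_ (by omega)
    by_contra hq0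
    exact h (by rw [show q = 0 by omega]; rfl)
  · rintro ⟨q, h1, h2, rfl⟩
    exact ⟨⟨q, by omega, rfl⟩, (hf.ne 0 q (by omega) (by omega)).symm⟩

lemma connSet_diff_one (hf : Cyc G n f) {a : V} (ha : a ∈ cycSet n f) :
    ConnSet G (cycSet n f \ {a}) := by
  obtain ⟨f', h1, rfl, h3⟩ := hf.exists_rotate ha
  rw [← h3, h1.cycSet_diff_zero]
  have := h1.four_le
  exact h1.connSet_seg (by omega) (by omega)

/-- A hole minus an edge is connected and seen by both ends of the edge. -/
lemma connSet_diff_two (hf : Cyc G n f) {a b : V} (ha : a ∈ cycSet n f) (hb : b ∈ cycSet n f)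
    (hab : G.Adj a b) : ConnSet G (cycSet n f \ {a, b}) ∧ Sees G a (cycSet n f \ {a, b}) := by
  obtain ⟨f', h1, rfl, h3⟩ := hf.exists_rotate ha
  rw [← h3] at hb ⊢
  have h4 := h1.four_le
  rcases h1.adj_zero hb hab with rfl | rfl
  · have : cycSet n f' \ {f' 0, f' 1} = seg f' 2 (n - 1) := by
      ext v
      constructor
      · rintro ⟨⟨q, hq, rfl⟩, h⟩
        refine mem_seg ?_ (by omega)
        by_contra hq0
        interval_cases q <;> simp at h
      · rintro ⟨q, h5, h6, rfl⟩
        refine ⟨⟨q, by omega, rfl⟩, ?_⟩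
        rintro (h | h)
        exacts [h1.ne 0 q (by omega) (by omega) h.symm, h1.ne 1 q (by omega) (by omega) h.symm]
    rw [this]
    exact ⟨h1.connSet_seg (by omega) (by omega), f' (n - 1), mem_seg (by omega) le_rfl,
      h1.adj_zero_last⟩
  · have : cycSet n f' \ {f' 0, f' (n - 1)} = seg f' 1 (n - 2) := by
      ext v
      constructor
      · rintro ⟨⟨q, hq, rfl⟩, h⟩
        have : q ≠ 0 := by rintro rfl; simp at h
        have : q ≠ n - 1 := by rintro rfl; simp at h
        exact mem_seg (by omega) (by omega)
      · rintro ⟨q, h5, h6, rfl⟩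
        refine ⟨⟨q, by omega, rfl⟩, ?_⟩
        rintro (h | h)
        exacts [h1.ne 0 q (by omega) (by omega) h.symm,
          h1.ne q (n - 1) (by omega) (by omega) h]
    rw [this]
    exact ⟨h1.connSet_seg (by omega) (by omega), f' 1, mem_seg le_rfl (by omega),
      h1.adj_zero_one⟩

/-- Two distinct neighbours on the hole of a vertex of the hole: they are not adjacent, they are
its only ones, and the rest of the hole is connected and seen by both. -/
lemma two_nbrs (hf : Cyc G n f) {a u v : V} (ha : a ∈ cycSet n f) (hu : u ∈ cycSet n f)
    (hv : v ∈ cycSet n f) (hau : G.Adj a u) (hav : G.Adj a v) (huv : u ≠ v) :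
    ¬ G.Adj u v ∧ (∀ b ∈ cycSet n f, G.Adj a b → b = u ∨ b = v) ∧
    ConnSet G (cycSet n f \ {u, a, v}) ∧ Sees G u (cycSet n f \ {u, a, v}) ∧
    Sees G v (cycSet n f \ {u, a, v}) := by
  obtain ⟨f', h1, rfl, h3⟩ := hf.exists_rotate ha
  rw [← h3] at hu hv ⊢
  have h4 := h1.four_le
  have key : ¬ G.Adj (f' 1) (f' (n - 1)) ∧
      ConnSet G (cycSet n f' \ {f' 1, f' 0, f' (n - 1)}) ∧
      Sees G (f' 1) (cycSet n f' \ {f' 1, f' 0, f' (n - 1)}) ∧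
      Sees G (f' (n - 1)) (cycSet n f' \ {f' 1, f' 0, f' (n - 1)}) := by
    have : cycSet n f' \ {f' 1, f' 0, f' (n - 1)} = seg f' 2 (n - 2) := by
      ext v
      constructor
      · rintro ⟨⟨q, hq, rfl⟩, h⟩
        have : q ≠ 0 := by rintro rfl; simp at h
        have : q ≠ 1 := by rintro rfl; simp at h
        have : q ≠ n - 1 := by rintro rfl; simp at h
        exact mem_seg (by omega) (by omega)
      · rintro ⟨q, h5, h6, rfl⟩
        refine ⟨⟨q, by omega, rfl⟩, ?_⟩
        rintro (h | h | h)
        exacts [h1.ne 1 q (by omega) (by omega) h.symm, h1.ne 0 q (by omega) (by omega) h.symm,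
          h1.ne q (n - 1) (by omega) (by omega) h]
    rw [this]
    refine ⟨?_, h1.connSet_seg (by omega) (by omega), ⟨f' 2, mem_seg le_rfl (by omega),
      h1.adj_succ (by omega)⟩, f' (n - 2), mem_seg (by omega) le_rfl, ?_⟩
    · rw [h1.adj 1 (n - 1) (by omega) (by omega)]; omega
    · have := h1.adj_succ (q := n - 2) (by omega)
      rw [show n - 2 + 1 = n - 1 by omega] at this
      exact this.symm
  obtain ⟨k1, k2, k3, k4⟩ := key
  rcases h1.adj_zero hu hau with rfl | rfl <;> rcases h1.adj_zero hv hav with rfl | rfl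
  · exact absurd rfl huv
  · exact ⟨k1, fun b hb h => h1.adj_zero hb h, k2, k3, k4⟩
  · refine ⟨fun h => k1 h.symm, fun b hb h => (h1.adj_zero hb h).symm, ?_⟩
    rw [show ({f' (n - 1), f' 0, f' 1} : Set V) = {f' 1, f' 0, f' (n - 1)} by
      ext; simp only [Set.mem_insert_iff, Set.mem_singleton_iff]; tauto]
    exact ⟨k2, k4, k3⟩
  · exact absurd rfl huv

end Cyc

/-- The basic use of clock-freeness: two non-adjacent vertices that both see two anticomplete
connected sets lie on a hole through both sets, so an outside vertex is not adjacent to both. -/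
lemma no_clock_of_two_connSets (hclock : ClockFree G) {U₁ U₂ : Set V} (h₁ : ConnSet G U₁)
    (h₂ : ConnSet G U₂) (h : Anticomplete G U₁ U₂) {u v z : V} (huv : u ≠ v)
    (hnuv : ¬ G.Adj u v) (hu₁ : Sees G u U₁) (hv₁ : Sees G v U₁) (hu₂ : Sees G u U₂)
    (hv₂ : Sees G v U₂) (hzu : G.Adj z u) (hzv : G.Adj z v) (hz₁ : z ∉ U₁) (hz₂ : z ∉ U₂) :
    False := by
  obtain ⟨k, p, hp, hp0, hpk, hpU⟩ := h₁.exists_indPath hu₁ hv₁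
  obtain ⟨l, r, hr, hr0, hrl, hrU⟩ := h₂.exists_indPath hu₂ hv₂
  have hk : 2 ≤ k := by
    by_contra hk
    have : k = 0 ∨ k = 1 := by omega
    rcases this with rfl | rfl
    · exact huv (hp0.symm.trans hpk)
    · exact hnuv (by rw [← hp0, ← hpk]; exact (hp 0 1 (by omega) le_rfl).2.2 rfl)
  have hl : 2 ≤ l := by
    by_contra hk
    have : l = 0 ∨ l = 1 := by omega
    rcases this with rfl | rfl
    · exact huv (hr0.symm.trans hrl)
    · exact hnuv (by rw [← hr0, ← hrl]; exact (hr 0 1 (by omega) le_rfl).2.2 rfl)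
  set f : ℕ → V := fun i => if i ≤ k then p i else r (k + l - i) with hfdef
  have hfp : ∀ i ≤ k, f i = p i := fun i hi => if_pos hi
  have hfr : ∀ i, k < i → f i = r (k + l - i) := fun i hi => if_neg (by omega)
  have hcross : ∀ i j, i ≤ k → k < j → j < k + l →
      p i ≠ r (k + l - j) ∧
        (G.Adj (p i) (r (k + l - j)) ↔ j = i + 1 ∨ (i = 0 ∧ j + 1 = k + l)) := by
    intro i j hi hkj hj
    have hmem := hrU (k + l - j) (by omega) (by omega)
    rcases Nat.eq_zero_or_pos i with rfl | hi0
    · rw [hp0, ← hr0]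
      have := hr 0 (k + l - j) (by omega) (by omega)
      exact ⟨this.1, this.2.trans (by omega)⟩
    · rcases Nat.lt_or_ge i k with hik | hik
      · have := h _ (hpU i hi0 hik) _ hmem
        exact ⟨this.1, ⟨fun h => absurd h this.2, fun h => by omega⟩⟩
      · have : i = k := by omega
        subst this
        rw [hpk, ← hrl]
        have := hr (i + l - j) l (by omega) le_rfl
        rw [SimpleGraph.adj_comm]
        exact ⟨this.1.symm, this.2.trans (by omega)⟩
  have hcyc : Cyc G (k + l) f := by
    refine ⟨by omega, fun i j hij hj => ?_, fun i j hij hj => ?_⟩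
    · rcases Nat.lt_or_ge k j with hkj | hkj
      · rw [hfr j hkj]
        rcases Nat.lt_or_ge k i with hki | hki
        · rw [hfr i hki]
          exact (hr (k + l - j) (k + l - i) (by omega) (by omega)).1.symm
        · rw [hfp i hki]; exact (hcross i j hki hkj hj).1
      · rw [hfp j hkj, hfp i (by omega)]
        exact (hp i j hij hkj).1
    · rcases Nat.lt_or_ge k j with hkj | hkj
      · rw [hfr j hkj]
        rcases Nat.lt_or_ge k i with hki | hki
        · rw [hfr i hki, SimpleGraph.adj_comm,
            (hr (k + l - j) (k + l - i) (by omega) (by omega)).2]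
          omega
        · rw [hfp i hki]; exact (hcross i j hki hkj hj).2
      · rw [hfp j hkj, hfp i (by omega), (hp i j hij hkj).2]
        omega
  refine hcyc.no_clock hclock (v := z) (a := u) (b := v) (fun q hq hqz => ?_)
    ⟨0, by omega, by rw [hfp 0 (by omega), hp0]⟩ ⟨k, by omega, by rw [hfp k le_rfl, hpk]⟩
    huv hzu hzv hnuv
  rcases Nat.lt_or_ge k q with hkq | hkq
  · rw [hfr q hkq] at hqz
    exact hz₂ (hqz ▸ hrU _ (by omega) (by omega))
  · rw [hfp q hkq] at hqz
    rcases Nat.eq_zero_or_pos q with rfl | hq0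
    · exact hzu.ne (hqz.symm.trans hp0)
    · rcases Nat.lt_or_ge q k with hqk | hqk
      · exact hz₁ (hqz ▸ hpU _ hq0 hqk)
      · have : q = k := by omega
        subst this
        exact hzv.ne (hqz.symm.trans hpk)

/-- A vertex with two non-adjacent neighbours in a connected set `W` lies on a hole whose other
vertices are in `W`. -/
lemma exists_cyc (hdiamond : DiamondFree G) {W : Set V} (hW : ConnSet G W) {y a b : V}
    (hy : y ∉ W) (ha : a ∈ W) (hb : b ∈ W) (hya : G.Adj y a) (hyb : G.Adj y b) (hab : a ≠ b)
    (hnab : ¬ G.Adj a b) :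
    ∃ n f, Cyc G n f ∧ f 0 = y ∧ ∀ i, 0 < i → i < n → f i ∈ W := by
  obtain ⟨k, p, hp, h0, hk⟩ := hW.exists_walkIn ha hb
  obtain ⟨k, p, hp, ⟨h0, hk, hne, hnadj⟩, hind, hmin⟩ :=
    exists_indPath_of_walkIn (G := G) (W := W)
      (fun a b => G.Adj y a ∧ G.Adj y b ∧ a ≠ b ∧ ¬ G.Adj a b)
      ⟨k, p, hp, by rw [h0, hk]; exact ⟨hya, hyb, hab, hnab⟩⟩
  have hk2 : 2 ≤ k := by
    by_contra hk'
    have : k = 0 ∨ k = 1 := by omega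
    rcases this with rfl | rfl
    · exact hne rfl
    · exact hnadj ((hind 0 1 (by omega) le_rfl).2.2 rfl)
  have hint : ∀ i, 0 < i → i < k → ¬ G.Adj y (p i) := by
    intro i hi hik hyi
    have hi1 : i = 1 := by
      by_contra hi1
      have h := hind 0 i hi hik.le
      exact hmin i p hik ⟨fun q hq => hp.1 q (by omega), fun q hq => hp.2 q (by omega)⟩
        ⟨h0, hyi, h.1, fun e => by have := h.2.1 e; omega⟩
    have hik1 : k = i + 1 := by
      by_contra hk1
      have h := hind i k hik le_rfl
      refine hmin (k - i) (fun q => p (q + i)) (by omega)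
        ⟨fun q hq => hp.1 (q + i) (by omega), fun q hq => ?_⟩ ?_
      · have := hp.2 (q + i) (by omega)
        rwa [show q + i + 1 = q + 1 + i by omega] at this
      · rw [Nat.sub_add_cancel hik.le, Nat.zero_add]
        exact ⟨hyi, hk, h.1, fun e => hk1 (h.2.1 e)⟩
    subst hi1
    subst hik1
    exact hdiamond ⟨p 0, p 2, y, p 1, hne, hnadj, hyi, h0.symm,
      (hind 0 1 (by omega) (by omega)).2.2 rfl, hk.symm,
      ((hind 1 2 (by omega) (by omega)).2.2 rfl).symm⟩
  set f : ℕ → V := fun i => if i = 0 then y else p (i - 1) with hfdef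
  have hf0 : f 0 = y := if_pos rfl
  have hfp : ∀ i, 0 < i → f i = p (i - 1) := fun i hi => if_neg (by omega)
  refine ⟨k + 2, f, ⟨by omega, fun i j hij hj => ?_, fun i j hij hj => ?_⟩, hf0, fun i hi hik => ?_⟩
  · rw [hfp j (by omega)]
    rcases Nat.eq_zero_or_pos i with rfl | hi
    · rw [hf0]
      intro h
      exact hy (h ▸ hp.1 _ (by omega))
    · rw [hfp i hi]
      exact (hind _ _ (by omega) (by omega)).1
  · rw [hfp j (by omega)]
    rcases Nat.eq_zero_or_pos i with rfl | hi
    · rw [hf0]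
      constructor
      · intro h
        by_contra hcon
        exact hint (j - 1) (by omega) (by omega) h
      · rintro (rfl | ⟨_, h⟩)
        · exact h0
        · rw [show j - 1 = k by omega]; exact hk
    · rw [hfp i hi, (hind _ _ (by omega) (by omega)).2]
      omega
  · rw [hfp i hi]
    exact hp.1 _ (by omega)

/-- No hole inside `U` through `y` meets `J`. -/
def HolesAvoid (G : SimpleGraph V) (U : Set V) (y : V) (J : Set V) : Prop :=
  ∀ n f, Cyc G n f → f 0 = y → (∀ i < n, f i ∈ U) → ∀ i < n, f i ∉ J

/-- If holes through `y` avoid `J`, then `y` cannot have two non-adjacent neighbours in a connected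
set `W₁ ∪ J ∪ W₂` with `W₁`, `W₂` anticomplete, unless it has them in one of `W₁`, `W₂`. -/
lemma HolesAvoid.false_of_separated (hdiamond : DiamondFree G) {U J W₁ W₂ : Set V} {y : V}
    (h : HolesAvoid G U y J) (hyU : y ∈ U) (hyW : y ∉ W₁ ∪ J ∪ W₂) (hWU : W₁ ∪ J ∪ W₂ ⊆ U)
    (hW : ConnSet G (W₁ ∪ J ∪ W₂)) (hW12 : Anticomplete G W₁ W₂)
    (hW₁ : ∀ a ∈ W₁, ∀ b ∈ W₁, G.Adj y a → G.Adj y b → a ≠ b → G.Adj a b)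
    (hW₂ : ∀ a ∈ W₂, ∀ b ∈ W₂, G.Adj y a → G.Adj y b → a ≠ b → G.Adj a b)
    {a b : V} (ha : a ∈ W₁ ∪ J ∪ W₂) (hb : b ∈ W₁ ∪ J ∪ W₂) (hya : G.Adj y a)
    (hyb : G.Adj y b) (hab : a ≠ b) (hnab : ¬ G.Adj a b) : False := by
  obtain ⟨n, f, hf, hf0, hfW⟩ := exists_cyc hdiamond hW hyW ha hb hya hyb hab hnab
  have h4 := hf.four_le
  have hfU : ∀ i < n, f i ∈ U := fun i hi => by
    rcases Nat.eq_zero_or_pos i with rfl | hi0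
    · rwa [hf0]
    · exact hWU (hfW i hi0 hi)
  have hfJ := h n f hf hf0 hfU
  have hconn : ConnSet G (seg f 1 (n - 1)) := hf.connSet_seg (by omega) (by omega)
  have hsub : seg f 1 (n - 1) ⊆ W₁ ∪ W₂ := by
    rintro v ⟨q, h1, h2, rfl⟩
    rcases hfW q (by omega) (by omega) with (h | h) | h
    · exact Or.inl h
    · exact absurd h (hfJ q (by omega))
    · exact Or.inr h
  have hne := hf.ne 1 (n - 1) (by omega) (by omega)
  have hna : ¬ G.Adj (f 1) (f (n - 1)) := by
    rw [hf.adj 1 (n - 1) (by omega) (by omega)]; omega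
  have hy1 : G.Adj y (f 1) := hf0 ▸ hf.adj_zero_one
  have hy2 : G.Adj y (f (n - 1)) := hf0 ▸ hf.adj_zero_last
  have m1 : f 1 ∈ seg f 1 (n - 1) := mem_seg le_rfl (by omega)
  have m2 : f (n - 1) ∈ seg f 1 (n - 1) := mem_seg (by omega) le_rfl
  rcases hsub m1 with h1 | h1
  · have := hconn.subset_of_anticomplete hW12 hsub m1 h1
    exact hna (hW₁ _ (this m1) _ (this m2) hy1 hy2 hne)
  · have := hconn.subset_of_anticomplete hW12.symm (by rwa [Set.union_comm]) m1 h1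
    exact hna (hW₂ _ (this m1) _ (this m2) hy1 hy2 hne)

end Cycles

/-! ### Attachments of a connected set to the holes through a vertex -/

section Holes

variable {V : Type*} {G : SimpleGraph V}

lemma seg_subset_cycSet {f : ℕ → V} {n s r : ℕ} (hr : r < n) : seg f s r ⊆ cycSet n f := by
  rintro v ⟨q, h1, h2, rfl⟩
  exact ⟨q, by omega, rfl⟩

/-- `f 0, …, f (n - 1)` is a hole inside `U` that starts at `y`. -/
structure HoleAt (G : SimpleGraph V) (U : Set V) (y : V) (n : ℕ) (f : ℕ → V) : Prop where
  cyc : Cyc G n f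
  zero : f 0 = y
  mem : ∀ i < n, f i ∈ U

namespace HoleAt

variable {U : Set V} {y : V} {n : ℕ} {f : ℕ → V}

lemma exists_reverse (hf : HoleAt G U y n f) : ∃ f', HoleAt G U y n f' ∧
    cycSet n f' = cycSet n f ∧ ∀ q, 0 < q → f' q = f (n - q) := by
  have h4 := hf.cyc.four_le
  refine ⟨_, ⟨hf.cyc.reverse, by simpa using hf.zero, fun i hi => ?_⟩, ?_, fun q hq => ?_⟩
  · exact hf.mem _ (by split_ifs <;> omega)
  · ext v
    constructor
    · rintro ⟨q, hq, rfl⟩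
      exact ⟨_, by split_ifs <;> omega, rfl⟩
    · rintro ⟨q, hq, rfl⟩
      refine ⟨if q = 0 then 0 else n - q, by split_ifs <;> omega, ?_⟩
      dsimp only
      congr 1
      rcases Nat.eq_zero_or_pos q with rfl | h
      · rfl
      · rw [if_neg (by omega : q ≠ 0), if_neg (by omega)]; omega
  · exact congrArg f (if_neg (by omega))

lemma mem_cycSet (hf : HoleAt G U y n f) : y ∈ cycSet n f :=
  ⟨0, by have := hf.cyc.four_le; omega, hf.zero⟩

lemma cycSet_subset (hf : HoleAt G U y n f) : cycSet n f ⊆ U := by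
  rintro v ⟨q, hq, rfl⟩
  exact hf.mem q hq

lemma adj_one (hf : HoleAt G U y n f) : G.Adj y (f 1) := hf.zero ▸ hf.cyc.adj_zero_one

lemma adj_last (hf : HoleAt G U y n f) : G.Adj y (f (n - 1)) := hf.zero ▸ hf.cyc.adj_zero_last

lemma adj_iff (hf : HoleAt G U y n f) {q : ℕ} (hq : q < n) :
    G.Adj y (f q) ↔ q = 1 ∨ q + 1 = n := by
  have := hf.cyc.four_le
  rw [← hf.zero, hf.cyc.adj_iff (by omega) hq]
  omega

lemma ne_zero (hf : HoleAt G U y n f) {q : ℕ} (h : 0 < q) (hq : q < n) : f q ≠ y := by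
  rw [← hf.zero]
  exact (hf.cyc.ne 0 q h hq).symm

lemma not_adj_one_last (hf : HoleAt G U y n f) : ¬ G.Adj (f 1) (f (n - 1)) := by
  have := hf.cyc.four_le
  rw [hf.cyc.adj 1 (n - 1) (by omega) (by omega)]; omega

lemma one_ne_last (hf : HoleAt G U y n f) : f 1 ≠ f (n - 1) :=
  have := hf.cyc.four_le
  hf.cyc.ne 1 (n - 1) (by omega) (by omega)

lemma not_mem_seg (hf : HoleAt G U y n f) {s r : ℕ} (hs : 0 < s) (hr : r < n) :
    y ∉ seg f s r := by
  rintro ⟨q, h1, h2, h⟩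
  exact hf.ne_zero (by omega) (by omega) h

/-- The base vertex of the hole has at most one neighbour on an arc that misses it and one of its
two neighbours. -/
lemma seg_nbrs (hf : HoleAt G U y n f) {s r : ℕ} (hs : 0 < s) (hr : r < n)
    (hsr : 1 < s ∨ r + 1 < n) {a b : V} (ha : a ∈ seg f s r) (hb : b ∈ seg f s r)
    (hya : G.Adj y a) (hyb : G.Adj y b) : a = b := by
  obtain ⟨q, h1, h2, rfl⟩ := ha
  obtain ⟨q', h1', h2', rfl⟩ := hb
  rw [hf.adj_iff (by omega)] at hya hyb
  congr 1
  omega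

lemma anticomplete_seg (hf : HoleAt G U y n f) {s r s' r' : ℕ} (hs : 0 < s) (h : r + 1 < s')
    (hr : r' < n) : Anticomplete G (seg f s r) (seg f s' r') := by
  rintro a ⟨q, h1, h2, rfl⟩ b ⟨q', h1', h2', rfl⟩
  refine ⟨hf.cyc.ne _ _ (by omega) (by omega), ?_⟩
  rw [hf.cyc.adj _ _ (by omega) (by omega)]
  omega

end HoleAt

/-- A connected set attached to `J` through one of its vertices. -/
lemma ConnSet.union_sees {S J : Set V} (hS : ConnSet G S) (hJ : ConnSet G J) {v : V} (hv : v ∈ S)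
    (hvJ : Sees G v J) : ConnSet G (S ∪ J) :=
  let ⟨j, hj, hvj⟩ := hvJ
  hS.union hJ ⟨v, hv, j, hj, Or.inr hvj⟩

variable {U J : Set V} {y : V} {n m : ℕ} {f g : ℕ → V}

lemma HolesAvoid.not_mem (h : HolesAvoid G U y J) (hf : HoleAt G U y n f) {v : V}
    (hv : v ∈ cycSet n f) : v ∉ J := by
  obtain ⟨q, hq, rfl⟩ := hv
  exact h n f hf.cyc hf.zero hf.mem q hq

/-- If the base vertex sees `J`, then only it and its neighbours on a hole can see `J`. -/
lemma HolesAvoid.eq_or_adj_of_sees (hclock : ClockFree G) (hdiamond : DiamondFree G)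
    (h : HolesAvoid G U y J) (hJ : ConnSet G J) (hJU : J ⊆ U) (hyU : y ∈ U) (hyJ : Sees G y J)
    (hf : HoleAt G U y n f) {a : V} (ha : a ∈ cycSet n f) (haJ : Sees G a J) :
    a = y ∨ G.Adj y a := by
  obtain ⟨j, hj, hyj⟩ := hyJ
  by_contra hcon
  obtain ⟨i, hi, rfl⟩ := ha
  push Not at hcon
  have h4 := hf.cyc.four_le
  have hi0 : 0 < i := by
    by_contra h0
    exact hcon.1 (by rw [show i = 0 by omega, hf.zero])
  have hi1 := hcon.2
  rw [hf.adj_iff hi] at hi1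
  have hyJ' : y ∉ J := h.not_mem hf hf.mem_cycSet
  have hjH : ∀ q < n, f q ≠ j := fun q hq e => h.not_mem hf ⟨q, hq, rfl⟩ (e ▸ hj)
  -- `y` has two non-adjacent neighbours in the union of `J` and an arc of the hole
  have key : ∀ s r, 0 < s → r < n → (1 < s ∨ r + 1 < n) → s ≤ i → i ≤ r →
      ∀ v ∈ seg f s r, G.Adj y v → v ≠ j → ¬ G.Adj v j → False := by
    intro s r hs hr hsr hsi hir v hv hyv hvj hnvj
    refine h.false_of_separated hdiamond (W₁ := seg f s r) (W₂ := ∅) hyU ?_ ?_ ?_ ?_ ?_ ?_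
      (a := v) (b := j) (by simp [hv]) (by simp [hj]) hyv hyj hvj hnvj
    · rintro ((h1 | h1) | h1)
      exacts [hf.not_mem_seg hs hr h1, hyJ' h1, h1]
    · exact Set.union_subset (Set.union_subset ((seg_subset_cycSet hr).trans hf.cycSet_subset) hJU)
        (Set.empty_subset _)
    · rw [Set.union_empty]
      exact (hf.cyc.connSet_seg (by omega) hr).union_sees hJ (mem_seg hsi hir) haJ
    · intro _ _ _ ht; exact absurd ht (Set.notMem_empty _)
    · intro a ha b hb hya hyb hab
      exact absurd (hf.seg_nbrs hs hr hsr ha hb hya hyb) hab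
    · intro _ ht; exact absurd ht (Set.notMem_empty _)
  by_cases hj1 : G.Adj (f 1) j
  · by_cases hj2 : G.Adj (f (n - 1)) j
    · exact hf.cyc.no_clock hclock hjH ⟨1, by omega, rfl⟩ ⟨n - 1, by omega, rfl⟩ hf.one_ne_last
        hj1.symm hj2.symm hf.not_adj_one_last
    · exact key 2 (n - 1) (by omega) (by omega) (by omega) (by omega) (by omega) _
        (mem_seg (by omega) le_rfl) hf.adj_last (hjH _ (by omega)) hj2
  · exact key 1 (n - 2) (by omega) (by omega) (by omega) (by omega) (by omega) _
      (mem_seg le_rfl (by omega)) hf.adj_one (hjH _ (by omega)) hj1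

/-- The vertices of one hole that see `J` are consecutive. -/
lemma HolesAvoid.succ_of_sees (hdiamond : DiamondFree G)
    (h : HolesAvoid G U y J) (hJ : ConnSet G J) (hJU : J ⊆ U) (hyU : y ∈ U) (hyJ : ¬ Sees G y J)
    (hf : HoleAt G U y n f) {i j : ℕ} (hij : i < j) (hj : j < n) (hiJ : Sees G (f i) J)
    (hjJ : Sees G (f j) J) : j = i + 1 := by
  by_contra hne
  have h4 := hf.cyc.four_le
  have hi0 : 0 < i := by
    by_contra h0
    exact hyJ (by rwa [show i = 0 by omega, hf.zero] at hiJ)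
  refine h.false_of_separated hdiamond (W₁ := seg f 1 i) (W₂ := seg f j (n - 1)) hyU ?_ ?_ ?_
    (hf.anticomplete_seg (by omega) (by omega) (by omega)) ?_ ?_
    (a := f 1) (b := f (n - 1)) (Or.inl (Or.inl (mem_seg le_rfl (by omega))))
    (Or.inr (mem_seg (by omega) le_rfl)) hf.adj_one hf.adj_last hf.one_ne_last hf.not_adj_one_last
  · rintro ((h1 | h1) | h1)
    exacts [hf.not_mem_seg (by omega) (by omega) h1, h.not_mem hf hf.mem_cycSet h1,
      hf.not_mem_seg (by omega) (by omega) h1]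
  · exact Set.union_subset (Set.union_subset
      ((seg_subset_cycSet (by omega)).trans hf.cycSet_subset) hJU)
      ((seg_subset_cycSet (by omega)).trans hf.cycSet_subset)
  · obtain ⟨p, hp, hjp⟩ := hjJ
    exact ((hf.cyc.connSet_seg (by omega) (by omega)).union_sees hJ
      (mem_seg (by omega) le_rfl) hiJ).union (hf.cyc.connSet_seg (by omega) (by omega))
      ⟨p, Or.inr hp, f j, mem_seg le_rfl (by omega), Or.inr hjp.symm⟩
  · intro a ha b hb hya hyb hab
    exact absurd (hf.seg_nbrs (by omega) (by omega) (by omega) ha hb hya hyb) hab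
  · intro a ha b hb hya hyb hab
    exact absurd (hf.seg_nbrs (by omega) (by omega) (by omega) ha hb hya hyb) hab

lemma HolesAvoid.adj_of_sees (hdiamond : DiamondFree G)
    (h : HolesAvoid G U y J) (hJ : ConnSet G J) (hJU : J ⊆ U) (hyU : y ∈ U) (hyJ : ¬ Sees G y J)
    (hf : HoleAt G U y n f) {a b : V} (ha : a ∈ cycSet n f) (hb : b ∈ cycSet n f)
    (haJ : Sees G a J) (hbJ : Sees G b J) (hab : a ≠ b) : G.Adj a b := by
  obtain ⟨i, hi, rfl⟩ := ha
  obtain ⟨j, hj, rfl⟩ := hb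
  rcases Nat.lt_trichotomy i j with hij | rfl | hij
  · obtain rfl := h.succ_of_sees hdiamond hJ hJU hyU hyJ hf hij hj haJ hbJ
    exact hf.cyc.adj_succ hj
  · exact absurd rfl hab
  · obtain rfl := h.succ_of_sees hdiamond hJ hJU hyU hyJ hf hij hi hbJ haJ
    exact (hf.cyc.adj_succ hi).symm

/-- `Q` is a connected set in `U` disjoint from the hole `H`, that has a vertex seeing `J`, and `c`
is the only vertex of `Q` that can see `H`. -/
structure Tentacle (G : SimpleGraph V) (U J H Q : Set V) (c : V) : Prop where
  conn : ConnSet G Q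
  subset : Q ⊆ U
  disj : ∀ q ∈ Q, q ∉ H
  mem : c ∈ Q
  eq_of_sees : ∀ q ∈ Q, Sees G q H → q = c
  sees : ∃ b ∈ Q, Sees G b J

/-- If the contact vertex `c` of a tentacle is adjacent to the base vertex `y`, then it is adjacent
to every vertex of the hole that sees `J`. -/
lemma Tentacle.adj_of_adj_base (hclock : ClockFree G) (hdiamond : DiamondFree G)
    (h : HolesAvoid G U y J) (hJ : ConnSet G J) (hJU : J ⊆ U) (hyU : y ∈ U) (hyJ : ¬ Sees G y J)
    (hf : HoleAt G U y n f) {Q : Set V} {c : V} (hQ : Tentacle G U J (cycSet n f) Q c)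
    (hcy : G.Adj c y) {a : V} (ha : a ∈ cycSet n f) (haJ : Sees G a J) : G.Adj c a := by
  -- by symmetry, `c` is not adjacent to the last vertex of the hole
  have main : ∀ f, HoleAt G U y n f → Tentacle G U J (cycSet n f) Q c → a ∈ cycSet n f →
      ¬ G.Adj c (f (n - 1)) → G.Adj c a := by
    intro f hf hQ ha hcl
    have h4 := hf.cyc.four_le
    obtain ⟨i, hi, rfl⟩ := ha
    obtain ⟨b, hbQ, hbJ⟩ := hQ.sees
    obtain ⟨p, hp, hap⟩ := id haJ
    have hi0 : 0 < i := by
      by_contra h0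
      exact hyJ (by rwa [show i = 0 by omega, hf.zero] at haJ)
    have hyQ : y ∉ Q := fun hy => hQ.disj y hy hf.mem_cycSet
    have hQy : ∀ q ∈ Q, G.Adj y q → q = c := fun q hq hyq =>
      hQ.eq_of_sees q hq ⟨y, hf.mem_cycSet, hyq.symm⟩
    have hcne : ∀ q < n, c ≠ f q := fun q hq e => hQ.disj c hQ.mem ⟨q, hq, e.symm⟩
    have key : ∀ s r, 0 < s → r < n → (1 < s ∨ r + 1 < n) → s ≤ i → i ≤ r →
        (∀ q, s ≤ q → q ≤ r → ¬ G.Adj c (f q)) → ∀ v ∈ seg f s r, G.Adj y v → False := by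
      intro s r hs hr hsr hsi hir hcs v hv hyv
      have hcv : c ≠ v ∧ ¬ G.Adj c v := by
        obtain ⟨q, h1, h2, rfl⟩ := hv
        exact ⟨hcne q (by omega), hcs q h1 h2⟩
      refine h.false_of_separated hdiamond (W₁ := Q) (W₂ := seg f s r) hyU ?_ ?_ ?_ ?_ ?_ ?_
        (a := c) (b := v) (Or.inl (Or.inl hQ.mem)) (Or.inr hv) hcy.symm hyv hcv.1 hcv.2
      · rintro ((h1 | h1) | h1)
        exacts [hyQ h1, h.not_mem hf hf.mem_cycSet h1, hf.not_mem_seg hs hr h1]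
      · exact Set.union_subset (Set.union_subset hQ.subset hJU)
          ((seg_subset_cycSet hr).trans hf.cycSet_subset)
      · exact (hQ.conn.union_sees hJ hbQ hbJ).union (hf.cyc.connSet_seg (by omega) hr)
          ⟨p, Or.inr hp, _, mem_seg hsi hir, Or.inr hap.symm⟩
      · rintro q hq t ⟨q', h1, h2, rfl⟩
        refine ⟨fun e => hQ.disj q hq ⟨q', by omega, e.symm⟩, fun e => ?_⟩
        rw [hQ.eq_of_sees q hq ⟨_, ⟨q', by omega, rfl⟩, e⟩] at e
        exact hcs q' h1 h2 e
      · intro a ha b hb hya hyb hab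
        exact absurd ((hQy a ha hya).trans (hQy b hb hyb).symm) hab
      · intro a ha b hb hya hyb hab
        exact absurd (hf.seg_nbrs hs hr hsr ha hb hya hyb) hab
    have hi1 : i = 1 := by
      by_contra hi1
      refine key i (n - 1) hi0 (by omega) (by omega) le_rfl (by omega) (fun q h1 h2 hcq => ?_) _
        (mem_seg (by omega) le_rfl) hf.adj_last
      have hq : q ≠ n - 1 := by rintro rfl; exact hcl hcq
      refine hf.cyc.no_clock hclock (v := c) (fun q hq e => hcne q hq e.symm)
        ⟨0, by omega, hf.zero⟩ ⟨q, by omega, rfl⟩ (hf.ne_zero (by omega) (by omega)).symm hcy hcq ?_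
      rw [hf.adj_iff (by omega)]
      omega
    subst hi1
    by_contra hc1
    exact key 1 1 (by omega) (by omega) (by omega) le_rfl le_rfl (fun q h1 h2 hcq => hc1 (by
      rwa [show q = 1 by omega] at hcq)) _ (mem_seg le_rfl le_rfl) hf.adj_one
  have h4 := hf.cyc.four_le
  by_cases hcl : G.Adj c (f (n - 1))
  · obtain ⟨f', hf', hH, hrev⟩ := hf.exists_reverse
    refine main f' hf' (by rwa [hH]) (by rwa [hH]) fun hcl' => ?_
    rw [hrev _ (by omega), show n - (n - 1) = 1 by omega] at hcl'
    exact hf.cyc.no_clock hclock (fun q hq e => hQ.disj c hQ.mem ⟨q, hq, e⟩) ⟨1, by omega, rfl⟩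
      ⟨n - 1, by omega, rfl⟩ hf.one_ne_last hcl' hcl hf.not_adj_one_last
  · exact main f hf hQ ha hcl

/-- Every neighbour `u` on the hole of the contact vertex `c` of a tentacle is equal or adjacent to
every vertex `a` of the hole that sees `J`. -/
lemma Tentacle.eq_or_adj (hclock : ClockFree G) (hdiamond : DiamondFree G)
    (h : HolesAvoid G U y J) (hJ : ConnSet G J) (hJU : J ⊆ U) (hyU : y ∈ U) (hyJ : ¬ Sees G y J)
    (hf : HoleAt G U y n f) {Q : Set V} {c : V} (hQ : Tentacle G U J (cycSet n f) Q c)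
    {a u : V} (ha : a ∈ cycSet n f) (haJ : Sees G a J) (hu : u ∈ cycSet n f)
    (hcu : G.Adj c u) : u = a ∨ G.Adj u a := by
  by_contra hcon
  push Not at hcon
  obtain ⟨hua, hnua⟩ := hcon
  have hcH : ∀ q < n, f q ≠ c := fun q hq e => hQ.disj c hQ.mem ⟨q, hq, e⟩
  by_cases hcy : G.Adj c y
  · have hca := hQ.adj_of_adj_base hclock hdiamond h hJ hJU hyU hyJ hf hcy ha haJ
    exact hf.cyc.no_clock hclock hcH hu ha hua hcu hca hnua
  -- by symmetry, `u` comes before `a` on the hole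
  have main : ∀ f, HoleAt G U y n f → Tentacle G U J (cycSet n f) Q c → ∀ s i, s < i → i < n →
      f s = u → f i = a → False := by
    intro f hf hQ s i hsi hi hs hia
    subst hs hia
    have h4 := hf.cyc.four_le
    obtain ⟨b, hbQ, hbJ⟩ := hQ.sees
    obtain ⟨p, hp, hap⟩ := id haJ
    have hs0 : 0 < s := by
      by_contra h0
      exact hcy (by rwa [show s = 0 by omega, hf.zero] at hcu)
    have hsi2 : s + 1 < i := by
      by_contra h1
      have h2 : i = s + 1 := by omega
      subst h2
      exact hnua (hf.cyc.adj_succ hi)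
    have hyQ : y ∉ Q := fun hy => hQ.disj y hy hf.mem_cycSet
    have hQy : ∀ q ∈ Q, ¬ G.Adj y q := fun q hq hyq => by
      rw [hQ.eq_of_sees q hq ⟨y, hf.mem_cycSet, hyq.symm⟩] at hyq
      exact hcy hyq.symm
    have hcne : ∀ q < n, f q ≠ c := fun q hq e => hQ.disj c hQ.mem ⟨q, hq, e⟩
    refine h.false_of_separated hdiamond (W₁ := seg f 1 s ∪ Q) (W₂ := seg f i (n - 1)) hyU
      ?_ ?_ ?_ ?_ ?_ ?_ (a := f 1) (b := f (n - 1))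
      (Or.inl (Or.inl (Or.inl (mem_seg le_rfl (by omega)))))
      (Or.inr (mem_seg (by omega) le_rfl)) hf.adj_one hf.adj_last hf.one_ne_last
      hf.not_adj_one_last
    · rintro (((h1 | h1) | h1) | h1)
      exacts [hf.not_mem_seg (by omega) (by omega) h1, hyQ h1, h.not_mem hf hf.mem_cycSet h1,
        hf.not_mem_seg (by omega) (by omega) h1]
    · exact Set.union_subset (Set.union_subset (Set.union_subset
        ((seg_subset_cycSet (by omega)).trans hf.cycSet_subset) hQ.subset) hJU)
        ((seg_subset_cycSet (by omega)).trans hf.cycSet_subset)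
    · exact (((hf.cyc.connSet_seg (by omega) (by omega)).union hQ.conn
        ⟨_, mem_seg (by omega) le_rfl, c, hQ.mem, Or.inr hcu.symm⟩).union_sees hJ
        (Or.inr hbQ) hbJ).union (hf.cyc.connSet_seg (by omega) (by omega))
        ⟨p, Or.inr hp, _, mem_seg le_rfl (by omega), Or.inr hap.symm⟩
    · refine (hf.anticomplete_seg (by omega) (by omega) (by omega)).union_left ?_
      rintro q hq t ⟨q', h1, h2, rfl⟩
      refine ⟨fun e => hQ.disj q hq ⟨q', by omega, e.symm⟩, fun e => ?_⟩
      rw [hQ.eq_of_sees q hq ⟨_, ⟨q', by omega, rfl⟩, e⟩] at e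
      refine hf.cyc.no_clock hclock hcne ⟨s, by omega, rfl⟩ ⟨q', by omega, rfl⟩
        (hf.cyc.ne _ _ (by omega) (by omega)) hcu e ?_
      rw [hf.cyc.adj _ _ (by omega) (by omega)]
      omega
    · rintro a (ha | ha) b (hb | hb) hya hyb hab
      · exact absurd (hf.seg_nbrs (by omega) (by omega) (by omega) ha hb hya hyb) hab
      · exact absurd hyb (hQy b hb)
      · exact absurd hya (hQy a ha)
      · exact absurd hya (hQy a ha)
    · intro a ha b hb hya hyb hab
      exact absurd (hf.seg_nbrs (by omega) (by omega) (by omega) ha hb hya hyb) hab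
  have h4 := hf.cyc.four_le
  obtain ⟨s, hs, hsu⟩ := id hu
  obtain ⟨i, hi, hia⟩ := id ha
  rcases Nat.lt_trichotomy s i with hsi | hsi | hsi
  · exact main f hf hQ s i hsi hi hsu hia
  · subst hsi; exact hua (hsu.symm.trans hia)
  · obtain ⟨f', hf', hH, hrev⟩ := hf.exists_reverse
    have hi0 : 0 < i := by
      by_contra h0
      exact hyJ (by rwa [← hia, show i = 0 by omega, hf.zero] at haJ)
    refine main f' hf' (by rwa [hH]) (n - s) (n - i) (by omega) (by omega) ?_ ?_
    · rw [hrev _ (by omega), ← hsu]; congr 1; omega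
    · rw [hrev _ (by omega), ← hia]; congr 1; omega

end Holes

section Attachments

variable {V : Type*} {G : SimpleGraph V} {U J : Set V} {y : V} {n m : ℕ} {f g : ℕ → V}

/-- The first vertices, in both directions from `g k`, that see a set `H` containing `y`. -/
lemma HoleAt.exists_contacts (hg : HoleAt G U y m g) {H : Set V} (hyH : y ∈ H) {k : ℕ} (hk0 : 0 < k)
    (hkm : k < m) (hkH : g k ∉ H) : ∃ t t', 0 < t ∧ t ≤ k ∧ k ≤ t' ∧ t' < m ∧
      Sees G (g t) H ∧ Sees G (g t') H ∧ (∀ q, t ≤ q → q ≤ t' → g q ∉ H) ∧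
      (∀ q, t ≤ q → q ≤ k → Sees G (g q) H → q = t) ∧
      (∀ q, k ≤ q → q ≤ t' → Sees G (g q) H → q = t') := by
  classical
  have h1 : Sees G (g 1) H := ⟨y, hyH, hg.adj_one.symm⟩
  have h2 : ∃ q, k ≤ q ∧ Sees G (g q) H := ⟨m - 1, by omega, y, hyH, hg.adj_last.symm⟩
  set t := Nat.findGreatest (fun q => Sees G (g q) H) k with ht
  have ht1 : 1 ≤ t := Nat.le_findGreatest hk0 h1
  have htk : t ≤ k := Nat.findGreatest_le k
  have hts : Sees G (g t) H := Nat.findGreatest_spec (P := fun q => Sees G (g q) H) hk0 h1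
  have htmax : ∀ q, t ≤ q → q ≤ k → Sees G (g q) H → q = t := fun q h3 h4 h5 =>
    le_antisymm (Nat.le_findGreatest h4 h5) h3
  have htm : Nat.find h2 < m := lt_of_le_of_lt
    (Nat.find_min' h2 ⟨by omega, y, hyH, hg.adj_last.symm⟩) (by omega : m - 1 < m)
  have htmin : ∀ q, k ≤ q → q ≤ Nat.find h2 → Sees G (g q) H → q = Nat.find h2 :=
    fun q h3 h4 h5 => le_antisymm h4 (Nat.find_min' h2 ⟨h3, h5⟩)
  refine ⟨t, Nat.find h2, ht1, htk, (Nat.find_spec h2).1, htm, hts, (Nat.find_spec h2).2,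
    fun q h3 h4 hq => ?_, htmax, htmin⟩
  rcases Nat.lt_trichotomy q k with h | h | h
  · have := htmax (q + 1) (by omega) h ⟨g q, hq, (hg.cyc.adj_succ (by omega)).symm⟩
    omega
  · exact hkH (h ▸ hq)
  · have h5 := hg.cyc.adj_succ (q := q - 1) (by omega)
    rw [show q - 1 + 1 = q by omega] at h5
    have := htmin (q - 1) (by omega) (by omega) ⟨g q, hq, h5⟩
    omega

/-- The two contact vertices `g t` and `g t'` of an arc of a hole through `y` with another hole
through `y` cannot each have a single neighbour there, if these two neighbours `u`, `v` are adjacent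
and `v` is not on the first hole. -/
lemma HoleAt.false_of_contacts (hclock : ClockFree G) (hf : HoleAt G U y n f)
    (hg : HoleAt G U y m g) {t t' : ℕ} (ht : 0 < t) (htt' : t < t') (ht'm : t' < m)
    (hdisj : ∀ q, t ≤ q → q ≤ t' → g q ∉ cycSet n f)
    (hsees : ∀ q, t ≤ q → q < t' → Sees G (g q) (cycSet n f) → q = t) {u v : V}
    (hu : u ∈ cycSet n f) (hv : v ∈ cycSet n f) (huv : G.Adj u v) (htu : G.Adj (g t) u)
    (htu' : ∀ z ∈ cycSet n f, G.Adj (g t) z → z = u) (htv : G.Adj (g t') v)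
    (htv' : ∀ z ∈ cycSet n f, G.Adj (g t') z → z = v) (hyu : y ≠ u) (hyv : y ≠ v)
    (hvg : v ∉ cycSet m g) : False := by
  have hyt' : ¬ G.Adj y (g t') := fun h => hyv (htv' y hf.mem_cycSet h.symm)
  rw [hg.adj_iff ht'm] at hyt'
  have h4 := hg.cyc.four_le
  have hdiff := hf.cyc.connSet_diff_two hu hv huv
  have hconn : ConnSet G (cycSet n f \ {u, v} ∪ seg g (t' + 1) (m - 1)) := by
    refine hdiff.1.union (hg.cyc.connSet_seg (by omega) (by omega)) ⟨y, ⟨hf.mem_cycSet, ?_⟩,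
      g (m - 1), mem_seg (by omega) le_rfl, Or.inr hg.adj_last⟩
    rintro (h | h)
    exacts [hyu h, hyv h]
  refine no_clock_of_two_connSets hclock (hg.cyc.connSet_seg (s := t) (r := t' - 1) (by omega)
    (by omega)) hconn ?_ (u := u) (v := g t') (z := v)
    (fun h => hdisj t' (by omega) le_rfl (h ▸ hu))
    (fun h => huv.ne (htv' u hu h.symm)) ⟨g t, mem_seg le_rfl (by omega), htu.symm⟩
    ⟨g (t' - 1), mem_seg (by omega) le_rfl, ?_⟩ (hdiff.2.mono Set.subset_union_left)
    ⟨g (t' + 1), Or.inr (mem_seg le_rfl (by omega)), hg.cyc.adj_succ (by omega)⟩ huv.symm htv.symm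
    ?_ ?_
  · refine Anticomplete.union_right ?_ (hg.anticomplete_seg ht (by omega) (by omega))
    rintro a ⟨q, h1, h2, rfl⟩ b ⟨hb, hb'⟩
    refine ⟨fun e => hdisj q h1 (by omega) (e ▸ hb), fun e => hb' (Or.inl ?_)⟩
    rw [hsees q h1 (by omega) ⟨b, hb, e⟩] at e
    exact htu' b hb e
  · have := hg.cyc.adj_succ (q := t' - 1) (by omega)
    rw [show t' - 1 + 1 = t' by omega] at this
    exact this.symm
  · rintro ⟨q, h1, h2, rfl⟩
    exact hdisj q h1 (by omega) hv
  · rintro (h | h)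
    · exact h.2 (Or.inr rfl)
    · exact hvg (seg_subset_cycSet (by omega) h)

/-- Two neighbours on the hole of the contact vertex of a tentacle are equal or adjacent. -/
lemma Tentacle.eq_or_adj_of_adj (hclock : ClockFree G) (hf : HoleAt G U y n f) {Q : Set V} {c : V}
    (hQ : Tentacle G U J (cycSet n f) Q c) {u v : V} (hu : u ∈ cycSet n f) (hv : v ∈ cycSet n f)
    (hcu : G.Adj c u) (hcv : G.Adj c v) : u = v ∨ G.Adj u v := by
  by_contra hcon
  push Not at hcon
  exact hf.cyc.no_clock hclock (fun q hq e => hQ.disj c hQ.mem ⟨q, hq, e⟩) hu hv hcon.1 hcu hcv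
    hcon.2

/-- If two holes through `y` contain non-adjacent vertices `a` and `b` that see `J`, then they share
a common neighbour `z` of `a` and `b`, and `b` has a neighbour other than `z` on its hole that sees
`J`. -/
lemma HolesAvoid.exists_common (hclock : ClockFree G) (hdiamond : DiamondFree G)
    (h : HolesAvoid G U y J) (hJ : ConnSet G J) (hJU : J ⊆ U) (hyU : y ∈ U) (hyJ : ¬ Sees G y J)
    (hf : HoleAt G U y n f) (hg : HoleAt G U y m g) {a b : V} (ha : a ∈ cycSet n f)
    (hb : b ∈ cycSet m g) (haJ : Sees G a J) (hbJ : Sees G b J) (hab : a ≠ b)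
    (hnab : ¬ G.Adj a b) :
    ∃ z ∈ cycSet n f, z ∈ cycSet m g ∧ G.Adj a z ∧ G.Adj b z ∧
      ∃ b' ∈ cycSet m g, Sees G b' J ∧ G.Adj b b' ∧ b' ≠ z := by
  have hbH : b ∉ cycSet n f := fun hbH =>
    hnab (h.adj_of_sees hdiamond hJ hJU hyU hyJ hf ha hbH haJ hbJ hab)
  have haH : a ∉ cycSet m g := fun haH =>
    hnab (h.adj_of_sees hdiamond hJ hJU hyU hyJ hg haH hb haJ hbJ hab)
  have hya : y ≠ a := fun e => hyJ (e ▸ haJ)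
  have hyb : y ≠ b := fun e => hyJ (e ▸ hbJ)
  obtain ⟨k, hk, rfl⟩ := id hb
  have hk0 : 0 < k := by
    by_contra h0
    exact hyb (by rw [show k = 0 by omega, hg.zero])
  have h4 := hg.cyc.four_le
  obtain ⟨t, t', ht0, htk, hkt', ht'm, ⟨u, hu, htu⟩, ⟨v, hv, htv⟩, hdisj, hmax, hmin⟩ :=
    hg.exists_contacts hf.mem_cycSet hk0 hk hbH
  have hmid : ∀ q, t ≤ q → q ≤ t' → Sees G (g q) (cycSet n f) → q = t ∨ q = t' := by
    intro q h1 h2 h3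
    rcases Nat.le_total q k with h4 | h4
    · exact Or.inl (hmax q h1 h4 h3)
    · exact Or.inr (hmin q h4 h2 h3)
  have hQ : Tentacle G U J (cycSet n f) (seg g t k) (g t) := by
    refine ⟨hg.cyc.connSet_seg htk hk, (seg_subset_cycSet hk).trans hg.cycSet_subset, ?_,
      mem_seg le_rfl htk, ?_, g k, mem_seg htk le_rfl, hbJ⟩
    · rintro _ ⟨q, h1, h2, rfl⟩
      exact hdisj q h1 (by omega)
    · rintro _ ⟨q, h1, h2, rfl⟩ h3
      rw [hmax q h1 h2 h3]
  have hQ' : Tentacle G U J (cycSet n f) (seg g k t') (g t') := by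
    refine ⟨hg.cyc.connSet_seg hkt' ht'm, (seg_subset_cycSet ht'm).trans hg.cycSet_subset, ?_,
      mem_seg hkt' le_rfl, ?_, g k, mem_seg le_rfl hkt', hbJ⟩
    · rintro _ ⟨q, h1, h2, rfl⟩
      exact hdisj q (by omega) h2
    · rintro _ ⟨q, h1, h2, rfl⟩ h3
      rw [hmin q h1 h2 h3]
  have hD : ∀ a' ∈ cycSet n f, Sees G a' J → ∀ z ∈ cycSet n f, G.Adj (g t) z →
      z = a' ∨ G.Adj z a' := fun a' ha' ha'J z hz htz =>
    hQ.eq_or_adj hclock hdiamond h hJ hJU hyU hyJ hf ha' ha'J hz htz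
  have hD' : ∀ a' ∈ cycSet n f, Sees G a' J → ∀ z ∈ cycSet n f, G.Adj (g t') z →
      z = a' ∨ G.Adj z a' := fun a' ha' ha'J z hz htz =>
    hQ'.eq_or_adj hclock hdiamond h hJ hJU hyU hyJ hf ha' ha'J hz htz
  have hE : G.Adj (g t) y → G.Adj (g t) a := fun hty =>
    hQ.adj_of_adj_base hclock hdiamond h hJ hJU hyU hyJ hf hty ha haJ
  have hE' : G.Adj (g t') y → G.Adj (g t') a := fun hty =>
    hQ'.adj_of_adj_base hclock hdiamond h hJ hJU hyU hyJ hf hty ha haJ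
  have htt'1 : t < t' → g t ≠ g t' ∧ ¬ G.Adj (g t) (g t') := by
    intro hlt
    refine ⟨hg.cyc.ne _ _ hlt ht'm, fun hadj => ?_⟩
    rw [hg.cyc.adj _ _ hlt ht'm] at hadj
    have hk' : k = t ∨ k = t' := by omega
    rcases hk' with rfl | rfl
    · have := hmin k le_rfl hkt' ⟨u, hu, htu⟩
      omega
    · have := hmax k htk le_rfl ⟨v, hv, htv⟩
      omega
  have hnotboth : ¬ (G.Adj (g t) a ∧ G.Adj (g t') a) := by
    rintro ⟨h1, h2⟩
    rcases Nat.eq_or_lt_of_le (htk.trans hkt') with hlt | hlt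
    · have : k = t := by omega
      exact hnab (by rw [this]; exact h1.symm)
    · exact hg.cyc.no_clock hclock (fun q hq e => haH ⟨q, hq, e⟩) ⟨t, by omega, rfl⟩
        ⟨t', ht'm, rfl⟩ (htt'1 hlt).1 h1.symm h2.symm (htt'1 hlt).2
  -- neighbours of the two contact vertices are pairwise equal or adjacent
  have hcase1 : ∀ u ∈ cycSet n f, G.Adj (g t) u → ∀ v ∈ cycSet n f, G.Adj (g t') v →
      u = v ∨ G.Adj u v := by
    intro u hu htu v hv htv
    by_contra hcon
    push Not at hcon
    have hau : G.Adj a u := by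
      rcases hD a ha haJ u hu htu with rfl | h1
      · rcases hD' u ha haJ v hv htv with rfl | h2
        exacts [absurd rfl hcon.1, absurd h2.symm hcon.2]
      · exact h1.symm
    have hav : G.Adj a v := by
      rcases hD' a ha haJ v hv htv with rfl | h1
      exacts [absurd hau.symm hcon.2, h1.symm]
    obtain ⟨-, honly, hconn, hsu, hsv⟩ := hf.cyc.two_nbrs ha hu hv hau hav hcon.1
    refine no_clock_of_two_connSets hclock (hg.cyc.connSet_seg (htk.trans hkt') ht'm) hconn ?_
      hcon.1 hcon.2 ⟨g t, mem_seg le_rfl (htk.trans hkt'), htu.symm⟩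
      ⟨g t', mem_seg (htk.trans hkt') le_rfl, htv.symm⟩ hsu hsv hau hav ?_
      (fun hz => hz.2 (by simp))
    · rintro _ ⟨q, h1, h2, rfl⟩ z ⟨hz, hz'⟩
      refine ⟨fun e => hdisj q h1 h2 (e ▸ hz), fun e => hz' ?_⟩
      have hza : z = a ∨ G.Adj z a := by
        rcases hmid q h1 h2 ⟨z, hz, e⟩ with rfl | rfl
        exacts [hD a ha haJ z hz e, hD' a ha haJ z hz e]
      rcases hza with rfl | hza
      · simp
      · rcases honly z hz hza.symm with rfl | rfl <;> simp
    · rintro ⟨q, h1, h2, e⟩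
      exact hdisj q h1 h2 (e ▸ ha)
  by_cases hcom : ∃ z ∈ cycSet n f, G.Adj (g t) z ∧ G.Adj (g t') z
  · obtain ⟨z, hz, htz, ht'z⟩ := hcom
    have hza : z ≠ a := by rintro rfl; exact hnotboth ⟨htz, ht'z⟩
    have haz : G.Adj a z := by
      rcases hD a ha haJ z hz htz with h1 | h1
      exacts [absurd h1 hza, h1.symm]
    have hzy : y ≠ z := by rintro rfl; exact hnotboth ⟨hE htz, hE' ht'z⟩
    have htt' : t = t' := by
      by_contra hne
      have hlt : t < t' := by omega
      by_cases hzg : z ∈ cycSet m g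
      · obtain ⟨q, hq, rfl⟩ := hzg
        rw [hg.cyc.adj_iff (by omega) hq] at htz
        rw [hg.cyc.adj_iff (by omega) hq] at ht'z
        have hq0 : q ≠ 0 := by rintro rfl; exact hzy hg.zero.symm
        exact hdisj q (by omega) (by omega) hz
      · exact hg.cyc.no_clock hclock (fun q hq e => hzg ⟨q, hq, e⟩) ⟨t, by omega, rfl⟩
          ⟨t', ht'm, rfl⟩ (htt'1 hlt).1 htz.symm ht'z.symm (htt'1 hlt).2
    have htk' : t = k := by omega
    subst htk'
    by_contra hcon
    -- otherwise the part of the second hole that does not see `J` is connected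
    obtain ⟨R, hR, hyR, hbR, hzR, hRg, hRJ⟩ : ∃ R, ConnSet G R ∧ y ∈ R ∧ Sees G (g t) R ∧ z ∉ R ∧
        R ⊆ cycSet m g ∧ ∀ r ∈ R, ¬ Sees G r J := by
      have hyg := hg.mem_cycSet
      have hadj : ∀ c ∈ cycSet m g, Sees G c J → c = g t ∨ G.Adj (g t) c := fun c hc hcJ => by
        by_cases e : c = g t
        · exact Or.inl e
        · exact Or.inr (h.adj_of_sees hdiamond hJ hJU hyU hyJ hg hb hc hbJ hcJ (Ne.symm e))
      have hdel : ∀ c ∈ cycSet m g, G.Adj (g t) c → y ≠ c →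
          (∀ c' ∈ cycSet m g, G.Adj (g t) c' → Sees G c' J → c' = c) → z ∉ cycSet m g \ {g t, c} →
          ∃ R, ConnSet G R ∧ y ∈ R ∧ Sees G (g t) R ∧ z ∉ R ∧
            R ⊆ cycSet m g ∧ ∀ r ∈ R, ¬ Sees G r J := by
        intro c hc htc hyc hc' hzc
        obtain ⟨h1, h2⟩ := hg.cyc.connSet_diff_two hb hc htc
        refine ⟨_, h1, ⟨hyg, ?_⟩, h2, hzc, Set.sdiff_subset, fun r hr hrJ => hr.2 ?_⟩
        · rintro (e | e)
          exacts [hyb e, hyc e]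
        · rcases hadj r hr.1 hrJ with e | e
          · exact Or.inl e
          · exact Or.inr (hc' r hr.1 e hrJ)
      by_cases hzg : z ∈ cycSet m g
      · refine hdel z hzg htz hzy (fun c' hc' htc' hc'J => ?_) (by simp)
        by_contra hne
        exact hcon ⟨z, hz, hzg, haz, htz, c', hc', hc'J, htc', hne⟩
      · by_cases hb' : ∃ c ∈ cycSet m g, G.Adj (g t) c ∧ Sees G c J
        · obtain ⟨c, hc, htc, hcJ⟩ := hb'
          refine hdel c hc htc (fun e => hyJ (e ▸ hcJ)) (fun c' hc' htc' hc'J => ?_)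
            (fun h => hzg h.1)
          by_contra hne
          exact (hg.cyc.two_nbrs hb hc' hc htc' htc hne).1
            (h.adj_of_sees hdiamond hJ hJU hyU hyJ hg hc' hc hc'J hcJ hne)
        · push Not at hb'
          refine ⟨_, hg.cyc.connSet_diff_one hb, ⟨hyg, hyb⟩,
            ⟨g (t + 1 - if t + 1 < m then 0 else 2), ?_⟩, fun h => hzg h.1, Set.sdiff_subset,
            fun r hr hrJ => ?_⟩
          · split_ifs with h1
            · exact ⟨⟨⟨t + 1, h1, rfl⟩, hg.cyc.ne' h1 hk (by omega)⟩, hg.cyc.adj_succ h1⟩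
            · refine ⟨⟨⟨t + 1 - 2, by omega, rfl⟩, hg.cyc.ne' (by omega) hk (by omega)⟩, ?_⟩
              rw [hg.cyc.adj_iff hk (by omega)]
              omega
          · rcases hadj r hr.1 hrJ with e | e
            · exact hr.2 e
            · exact hb' r hr.1 e hrJ
    obtain ⟨h1, h2⟩ := hf.cyc.connSet_diff_two ha hz haz
    refine no_clock_of_two_connSets hclock hJ
      (h1.union_of_mem hR (v := y) ⟨hf.mem_cycSet, ?_⟩ hyR) ?_ hab hnab haJ hbJ
      (h2.mono Set.subset_union_left) (hbR.mono Set.subset_union_right) haz.symm htz.symm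
      (h.not_mem hf hz) ?_
    · rintro (e | e)
      exacts [hya e, hzy e]
    · refine Anticomplete.union_right ?_ ?_
      · rintro j hj c ⟨hc, hc'⟩
        refine ⟨fun e => h.not_mem hf hc (e ▸ hj), fun e => hc' ?_⟩
        have hcJ : Sees G c J := ⟨j, hj, e.symm⟩
        by_cases hca : c = a
        · exact Or.inl hca
        · have hac := h.adj_of_sees hdiamond hJ hJU hyU hyJ hf ha hc haJ hcJ (Ne.symm hca)
          rcases hD c hc hcJ z hz htz with rfl | hzc
          · exact Or.inr rfl
          · exact absurd hzc (hf.cyc.two_nbrs ha hz hc haz hac hzc.ne).1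
      · exact fun j hj c hc => ⟨fun e => h.not_mem hg (hRg hc) (e ▸ hj),
          fun e => hRJ c hc ⟨j, hj, e.symm⟩⟩
    · rintro (hz' | hz')
      exacts [hz'.2 (Or.inr rfl), hzR hz']
  · exfalso
    push Not at hcom
    have huv : G.Adj u v := by
      rcases hcase1 u hu htu v hv htv with rfl | h1
      exacts [absurd htv (hcom u hu htu), h1]
    have hlt : t < t' := by
      rcases Nat.eq_or_lt_of_le (htk.trans hkt') with e | e
      · subst e; exact absurd htu (hcom u hu htu)
      · exact e
    have htu' : ∀ z ∈ cycSet n f, G.Adj (g t) z → z = u := by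
      intro z hz htz
      by_contra hne
      have hzv : G.Adj z v := by
        rcases hcase1 z hz htz v hv htv with rfl | h1
        exacts [absurd htv (hcom z hz htz), h1]
      rcases hQ.eq_or_adj_of_adj hclock hf hz hu htz htu with h1 | h1
      · exact hne h1
      · exact (hf.cyc.two_nbrs hv hz hu hzv.symm huv.symm hne).1 h1
    have htv' : ∀ z ∈ cycSet n f, G.Adj (g t') z → z = v := by
      intro z hz htz
      by_contra hne
      have hzu : G.Adj u z := by
        rcases hcase1 u hu htu z hz htz with rfl | h1
        exacts [absurd htz (hcom u hu htu), h1]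
      rcases hQ'.eq_or_adj_of_adj hclock hf hz hv htz htv with h1 | h1
      · exact hne h1
      · exact (hf.cyc.two_nbrs hu hz hv hzu huv hne).1 h1
    have hyu : y ≠ u := by
      rintro rfl
      exact hya (htu' a ha (hE htu)).symm
    have hyv : y ≠ v := by
      rintro rfl
      exact hya (htv' a ha (hE' htv)).symm
    by_cases hvg : v ∈ cycSet m g
    · by_cases hug : u ∈ cycSet m g
      · obtain ⟨p, hp, rfl⟩ := hug
        obtain ⟨q, hq, rfl⟩ := hvg
        have hp0 : p ≠ 0 := by rintro rfl; exact hyu hg.zero.symm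
        have hq0 : q ≠ 0 := by rintro rfl; exact hyv hg.zero.symm
        rw [hg.cyc.adj_iff (by omega) hp] at htu
        rw [hg.cyc.adj_iff (by omega) hq] at htv
        rw [hg.cyc.adj_iff hp hq] at huv
        have hp' : ¬ (t ≤ p ∧ p ≤ t') := fun h => hdisj p h.1 h.2 hu
        have hq' : ¬ (t ≤ q ∧ q ≤ t') := fun h => hdisj q h.1 h.2 hv
        omega
      · -- the mirror image of the remaining case
        obtain ⟨g', hg', hH, hrev⟩ := hg.exists_reverse
        have e1 : g' (m - t') = g t' := by rw [hrev _ (by omega)]; congr 1; omega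
        have e2 : g' (m - t) = g t := by rw [hrev _ (by omega)]; congr 1; omega
        refine hf.false_of_contacts hclock hg' (t := m - t') (t' := m - t) (by omega) (by omega)
          (by omega) ?_ ?_ hv hu huv.symm (e1 ▸ htv) (e1 ▸ htv') (e2 ▸ htu) (e2 ▸ htu') hyv hyu
          (hH ▸ hug)
        · intro q h1 h2
          rw [hrev q (by omega)]
          exact hdisj _ (by omega) (by omega)
        · intro q h1 h2 h3
          rw [hrev q (by omega)] at h3
          have := hmid (m - q) (by omega) (by omega) h3
          omega
    · refine hf.false_of_contacts hclock hg ht0 hlt ht'm hdisj (fun q h1 h2 h3 => ?_) hu hv huv htu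
        htu' htv htv' hyu hyv hvg
      have := hmid q h1 (by omega) h3
      omega

/-- If the holes through `y` inside `U` avoid the connected set `J`, then the vertices of these
holes that see `J` form a clique. -/
theorem HolesAvoid.adj_of_sees_of_sees (hclock : ClockFree G) (hdiamond : DiamondFree G)
    (h : HolesAvoid G U y J) (hJ : ConnSet G J) (hJU : J ⊆ U) (hyU : y ∈ U)
    (hf : HoleAt G U y n f) (hg : HoleAt G U y m g) {a b : V} (ha : a ∈ cycSet n f)
    (hb : b ∈ cycSet m g) (haJ : Sees G a J) (hbJ : Sees G b J) (hab : a ≠ b) : G.Adj a b := by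
  by_contra hnab
  by_cases hyJ : Sees G y J
  · have h1 := h.eq_or_adj_of_sees hclock hdiamond hJ hJU hyU hyJ hf ha haJ
    have h2 := h.eq_or_adj_of_sees hclock hdiamond hJ hJU hyU hyJ hg hb hbJ
    rcases h1 with rfl | h1
    · rcases h2 with h2 | h2
      exacts [hab h2.symm, hnab h2]
    rcases h2 with rfl | h2
    · exact hnab h1.symm
    obtain ⟨j, hj, hbj⟩ := hbJ
    refine h.false_of_separated hdiamond (W₁ := {a}) (W₂ := {b}) hyU ?_ ?_ ?_ ?_ ?_ ?_
      (Or.inl (Or.inl rfl)) (Or.inr rfl) h1 h2 hab hnab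
    · rintro ((e | e) | e)
      exacts [h1.ne e, h.not_mem hf hf.mem_cycSet e, h2.ne e]
    · rintro v ((rfl | e) | rfl)
      exacts [hf.cycSet_subset ha, hJU e, hg.cycSet_subset hb]
    · exact ((ConnSet.singleton a).union_sees hJ rfl haJ).union_singleton ⟨j, Or.inr hj, hbj⟩
    · rintro _ rfl _ rfl
      exact ⟨hab, hnab⟩
    · rintro _ rfl _ rfl _ _ e
      exact absurd rfl e
    · rintro _ rfl _ rfl _ _ e
      exact absurd rfl e
  · obtain ⟨z, hz, hzg, haz, hbz, b', hb', hb'J, hbb', hne⟩ :=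
      h.exists_common hclock hdiamond hJ hJU hyU hyJ hf hg ha hb haJ hbJ hab hnab
    have haH : a ∉ cycSet m g := fun haH =>
      hnab (h.adj_of_sees hdiamond hJ hJU hyU hyJ hg haH hb haJ hbJ hab)
    have hzb' : ¬ G.Adj z b' := (hg.cyc.two_nbrs hb hzg hb' hbz hbb' hne.symm).1
    have hab' : ¬ G.Adj a b' := fun hab' =>
      hg.cyc.no_clock hclock (fun q hq e => haH ⟨q, hq, e⟩) hzg hb' hne.symm haz hab' hzb'
    have hab'n : a ≠ b' := fun e => haH (e ▸ hb')
    -- the same argument for `a` and `b'` gives a second neighbour of `a` on both holes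
    obtain ⟨z', hz', hz'g, haz', hbz', -⟩ :=
      h.exists_common hclock hdiamond hJ hJU hyU hyJ hf hg ha hb' haJ hb'J hab'n hab'
    have hzz' : z ≠ z' := by
      rintro rfl
      exact hzb' hbz'.symm
    exact hg.cyc.no_clock hclock (fun q hq e => haH ⟨q, hq, e⟩) hzg hz'g hzz' haz haz'
      (hf.cyc.two_nbrs ha hz hz' haz haz' hzz').1

end Attachments

/-! ### Canonical separations of closures of two cliques -/

section CliqueExt

variable {V : Type*} {G : SimpleGraph V}

/-- In a diamond-free graph, a vertex adjacent to two vertices of a clique is adjacent to all the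
others. -/
lemma DiamondFree.eq_or_adj (hd : DiamondFree G) {K : Set V} (hK : G.IsClique K) {p q r v : V}
    (hp : p ∈ K) (hq : q ∈ K) (hr : r ∈ K) (hpq : p ≠ q) (hvp : G.Adj v p) (hvq : G.Adj v q) :
    v = r ∨ G.Adj v r := by
  by_contra hcon
  push Not at hcon
  have hrp : r ≠ p := by rintro rfl; exact hcon.2 hvp
  have hrq : r ≠ q := by rintro rfl; exact hcon.2 hvq
  exact hd ⟨v, r, p, q, hcon.1, hcon.2, hK hp hq hpq, hvp, hvq, hK hr hp hrp, hK hr hq hrq⟩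

lemma isClique_cliqueExt (hd : DiamondFree G) {S K : Set V} (hK : G.IsClique K) :
    G.IsClique (cliqueExt G S K) := by
  have h1 : ∀ v ∈ cliqueExt G S K, ∀ r ∈ K, v = r ∨ G.Adj v r := by
    rintro v (hv | ⟨-, x, hx, y, hy, hxy, hxv, hyv⟩) r hr
    · by_cases h : v = r
      exacts [Or.inl h, Or.inr (hK hv hr h)]
    · exact hd.eq_or_adj hK hx hy hr hxy hxv.symm hyv.symm
  rintro v hv u (hu | ⟨hu1, x, hx, y, hy, hxy, hxu, hyu⟩) hvu
  · exact (h1 v hv u hu).resolve_left hvu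
  · by_contra hcon
    rcases h1 v hv x hx with rfl | hvx
    · exact hcon hxu
    rcases h1 v hv y hy with rfl | hvy
    · exact hcon hyu
    exact hd ⟨v, u, x, y, hvu, hcon, hK hx hy hxy, hvx, hvy, hxu.symm, hyu.symm⟩

/-- In a diamond-free graph, extending a clique a second time adds nothing new. -/
lemma cliqueExt_closed (hd : DiamondFree G) {B K N : Set V} (hK : G.IsClique K) {v : V}
    (hv : v ∉ B) {p q : V} (hp : p ∈ cliqueExt G Bᶜ (K ∩ N)) (hq : q ∈ cliqueExt G Bᶜ (K ∩ N))
    (hpq : p ≠ q) (hvp : G.Adj v p) (hvq : G.Adj v q) : v ∈ cliqueExt G Bᶜ (K ∩ N) := by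
  have hcl := isClique_cliqueExt (S := Bᶜ) hd (hK.subset (Set.inter_subset_left (t := N)))
  have h2 : ∃ x ∈ K ∩ N, ∃ y ∈ K ∩ N, x ≠ y := by
    rcases hp with hp | ⟨-, x, hx, y, hy, hxy, -⟩
    · rcases hq with hq | ⟨-, x, hx, y, hy, hxy, -⟩
      · exact ⟨p, hp, q, hq, hpq⟩
      · exact ⟨x, hx, y, hy, hxy⟩
    · exact ⟨x, hx, y, hy, hxy⟩
  obtain ⟨x, hx, y, hy, hxy⟩ := h2
  rcases hd.eq_or_adj hcl hp hq (Or.inl hx) hpq hvp hvq with rfl | hvx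
  · exact Or.inl hx
  rcases hd.eq_or_adj hcl hp hq (Or.inl hy) hpq hvp hvq with rfl | hvy
  · exact Or.inl hy
  exact Or.inr ⟨hv, x, hx, y, hy, hxy, hvx.symm, hvy.symm⟩

end CliqueExt

section Separations

variable {V : Type*} [Fintype V] {G : SimpleGraph V} {w : V → ℝ}

/-- The standing assumptions on `G` and `w`. -/
structure Setting (G : SimpleGraph V) (w : V → ℝ) : Prop where
  clock : ClockFree G
  diamond : DiamondFree G
  star : ¬ ∃ X : Set V, IsStarCutset G X
  isWeight : IsWeight w
  sep : ¬ ∃ X : Set V, X.ncard ≤ 4 * G.cliqueNum ∧ IsBalancedSep G w (1 / 2) X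

lemma ncard_le_cliqueNum {K : Set V} (hK : G.IsClique K) : K.ncard ≤ G.cliqueNum := by
  classical
  have h : G.IsClique (K.toFinset : Set V) := by rwa [Set.coe_toFinset]
  rw [Set.ncard_eq_toFinset_card']
  exact h.card_le_cliqueNum

lemma ncard_union_le_cliqueNum {K L : Set V} (hK : G.IsClique K) (hL : G.IsClique L) :
    (K ∪ L).ncard ≤ 2 * G.cliqueNum := by
  have h1 := Set.ncard_union_le K L
  have h2 := ncard_le_cliqueNum hK
  have h3 := ncard_le_cliqueNum hL
  omega

/-- Two sets of weight more than one half intersect. -/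
lemma exists_mem_inter_of_weight (hw : IsWeight w) {X Y : Set V} (hX : 1 / 2 < weight w X)
    (hY : 1 / 2 < weight w Y) : ∃ v ∈ X, v ∈ Y := by
  by_contra hcon
  have h : weight w X + weight w Y ≤ 1 := by
    rw [← hw.2, weight, weight, ← Finset.sum_add_distrib]
    refine Finset.sum_le_sum fun v _ => ?_
    by_cases hv : v ∈ X
    · rw [Set.indicator_of_mem hv, Set.indicator_of_notMem (fun h => hcon ⟨v, hv, h⟩), add_zero]
    · rw [Set.indicator_of_notMem hv, zero_add]
      exact Set.indicator_le_self' (fun v _ => (hw.1 v).1) v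
  linarith

lemma sideB_eq (hw : IsWeight w) {X D : Set V} (hD : IsComp G Xᶜ D) (hDw : 1 / 2 < weight w D) :
    sideB G w X = D := by
  ext v
  constructor
  · rintro ⟨D', hD', hw', hv⟩
    obtain ⟨u, hu, hu'⟩ := exists_mem_inter_of_weight hw hDw hw'
    rwa [hD.eq_of_mem (isComponent_iff.1 hD') hu hu']
  · exact fun hv => ⟨D, isComponent_iff.2 hD, hDw, hv⟩

namespace Setting

lemma sideB_spec (S : Setting G w) {X : Set V} (hX : X.ncard ≤ 4 * G.cliqueNum) :
    IsComp G Xᶜ (sideB G w X) ∧ 1 / 2 < weight w (sideB G w X) := by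
  have h : ¬ IsBalancedSep G w (1 / 2) X := fun h => S.sep ⟨X, hX, h⟩
  unfold IsBalancedSep at h
  push Not at h
  obtain ⟨D, hD, hDw⟩ := h
  rw [isComponent_iff] at hD
  rw [sideB_eq S.isWeight hD hDw]
  exact ⟨hD, hDw⟩

end Setting

lemma subset_of_isComp_of_weight (hw : IsWeight w) {X D C : Set V} (hD : IsComp G Xᶜ D)
    (hDw : 1 / 2 < weight w D) (hC : ConnSet G C) (hCX : ∀ v ∈ C, v ∉ X)
    (hCw : 1 / 2 < weight w C) : C ⊆ D := by
  obtain ⟨v, hv, hv'⟩ := exists_mem_inter_of_weight hw hCw hDw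
  exact hD.subset_of_mem hC hCX hv hv'

/-- `X = L₁ ∪ L₂` is a union of two cliques, with `B = sideB G w X` a component of `G \ X` of weight
more than `1/2`, such that `L₁`, `L₂` are closed under adding vertices outside `B` with two
neighbours in them, and a vertex of `Lᵢ` outside `N(B)` is there only because of two vertices of
`Lᵢ ∩ N(B)`. All members of `𝒳` have this form. -/
structure ClosedPair (G : SimpleGraph V) (w : V → ℝ) (X L₁ L₂ : Set V) : Prop where
  eq : X = L₁ ∪ L₂
  clique₁ : G.IsClique L₁
  clique₂ : G.IsClique L₂
  isComp : IsComp G Xᶜ (sideB G w X)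
  big : 1 / 2 < weight w (sideB G w X)
  closed₁ : ∀ v, v ∉ sideB G w X → ∀ p ∈ L₁, ∀ q ∈ L₁, p ≠ q → G.Adj v p → G.Adj v q → v ∈ L₁
  closed₂ : ∀ v, v ∉ sideB G w X → ∀ p ∈ L₂, ∀ q ∈ L₂, p ≠ q → G.Adj v p → G.Adj v q → v ∈ L₂
  ext₁ : ∀ v ∈ L₁, v ∉ setNbhd G (sideB G w X) → ∃ p ∈ L₁, ∃ q ∈ L₁, p ≠ q ∧
    p ∈ setNbhd G (sideB G w X) ∧ q ∈ setNbhd G (sideB G w X)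
  ext₂ : ∀ v ∈ L₂, v ∉ setNbhd G (sideB G w X) → ∃ p ∈ L₂, ∃ q ∈ L₂, p ≠ q ∧
    p ∈ setNbhd G (sideB G w X) ∧ q ∈ setNbhd G (sideB G w X)

lemma ClosedPair.symm {X L₁ L₂ : Set V} (h : ClosedPair G w X L₁ L₂) : ClosedPair G w X L₂ L₁ :=
  ⟨by rw [h.eq, Set.union_comm], h.clique₂, h.clique₁, h.isComp, h.big, h.closed₂, h.closed₁,
    h.ext₂, h.ext₁⟩

/-- The closure of two cliques has the same side `B` as their union and contains `N(B)`; its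
vertices outside the cliques come from two vertices of one of the cliques. -/
lemma Setting.cl_spec (S : Setting G w) {K₁ K₂ : Set V} (h₁ : G.IsClique K₁) (h₂ : G.IsClique K₂) :
    sideB G w (cl G w K₁ K₂) = sideB G w (K₁ ∪ K₂) ∧
    (∀ v ∈ cl G w K₁ K₂, v ∉ K₁ ∪ K₂ → ∃ x y, x ≠ y ∧ G.Adj v x ∧ G.Adj v y ∧
      x ∈ setNbhd G (sideB G w (K₁ ∪ K₂)) ∧ y ∈ setNbhd G (sideB G w (K₁ ∪ K₂)) ∧
      ((x ∈ K₁ ∧ y ∈ K₁) ∨ (x ∈ K₂ ∧ y ∈ K₂))) ∧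
    ∃ L₁ L₂, ClosedPair G w (cl G w K₁ K₂) L₁ L₂ := by
  obtain ⟨hB, hBw⟩ := S.sideB_spec (X := K₁ ∪ K₂)
    (by have := ncard_union_le_cliqueNum h₁ h₂; omega)
  have hcl : cl G w K₁ K₂ = cliqueExt G (sideB G w (K₁ ∪ K₂))ᶜ
      (K₁ ∩ setNbhd G (sideB G w (K₁ ∪ K₂))) ∪ cliqueExt G (sideB G w (K₁ ∪ K₂))ᶜ
      (K₂ ∩ setNbhd G (sideB G w (K₁ ∪ K₂))) := by
    have : sideA G w (K₁ ∪ K₂) ∪ (K₁ ∪ K₂) = (sideB G w (K₁ ∪ K₂))ᶜ := by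
      ext v
      have h3 : v ∈ sideB G w (K₁ ∪ K₂) → v ∉ K₁ ∪ K₂ := fun h => hB.not_mem h
      have h4 : v ∈ sideA G w (K₁ ∪ K₂) ↔ ¬ (v ∈ sideB G w (K₁ ∪ K₂) ∨ v ∈ K₁ ∪ K₂) := Iff.rfl
      rw [Set.mem_union, Set.mem_compl_iff, h4]
      tauto
    dsimp only [cl]
    rw [this]
  set B := sideB G w (K₁ ∪ K₂) with hBdef
  set L₁ := cliqueExt G Bᶜ (K₁ ∩ setNbhd G B) with hL₁
  set L₂ := cliqueExt G Bᶜ (K₂ ∩ setNbhd G B) with hL₂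
  have hdisj : ∀ K, ∀ v ∈ cliqueExt G Bᶜ (K ∩ setNbhd G B), v ∉ B := by
    rintro K v (hv | hv)
    exacts [hv.2.1, hv.1]
  have hNB : setNbhd G B ⊆ L₁ ∪ L₂ := by
    intro v hv
    rcases hB.setNbhd_subset hv with h | h
    exacts [Or.inl (Or.inl ⟨h, hv⟩), Or.inr (Or.inl ⟨h, hv⟩)]
  have hcomp : IsComp G (L₁ ∪ L₂)ᶜ B := by
    refine isComp_of_setNbhd_subset hB.1 ?_ hNB
    rintro v hv (h | h)
    exacts [hdisj _ v h hv, hdisj _ v h hv]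
  have hside : sideB G w (cl G w K₁ K₂) = B := by
    rw [hcl]; exact sideB_eq S.isWeight hcomp hBw
  have hext : ∀ K, ∀ v ∈ cliqueExt G Bᶜ (K ∩ setNbhd G B), v ∉ setNbhd G B →
      ∃ p ∈ cliqueExt G Bᶜ (K ∩ setNbhd G B), ∃ q ∈ cliqueExt G Bᶜ (K ∩ setNbhd G B),
      p ≠ q ∧ p ∈ setNbhd G B ∧ q ∈ setNbhd G B := by
    rintro K v (hv | ⟨-, x, hx, y, hy, hxy, -⟩) hvB
    · exact absurd hv.2 hvB
    · exact ⟨x, Or.inl hx, y, Or.inl hy, hxy, hx.2, hy.2⟩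
  refine ⟨hside, fun v hv hvK => ?_, L₁, L₂, ⟨hcl,
    isClique_cliqueExt S.diamond (h₁.subset Set.inter_subset_left),
    isClique_cliqueExt S.diamond (h₂.subset Set.inter_subset_left), ?_, ?_, ?_, ?_, ?_, ?_⟩⟩
  · rw [hcl] at hv
    rcases hv with (hv | ⟨-, x, hx, y, hy, hxy, h3, h4⟩) | (hv | ⟨-, x, hx, y, hy, hxy, h3, h4⟩)
    · exact absurd (Or.inl hv.1) hvK
    · exact ⟨x, y, hxy, h3.symm, h4.symm, hx.2, hy.2, Or.inl ⟨hx.1, hy.1⟩⟩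
    · exact absurd (Or.inr hv.1) hvK
    · exact ⟨x, y, hxy, h3.symm, h4.symm, hx.2, hy.2, Or.inr ⟨hx.1, hy.1⟩⟩
  · rw [hside, hcl]; exact hcomp
  · rw [hside]; exact hBw
  · rw [hside]
    exact fun v hv p hp q hq hpq => cliqueExt_closed S.diamond h₁ hv hp hq hpq
  · rw [hside]
    exact fun v hv p hp q hq hpq => cliqueExt_closed S.diamond h₂ hv hp hq hpq
  · rw [hside]; exact hext _
  · rw [hside]; exact hext _

lemma Setting.exists_closedPair (S : Setting G w) {X : Set V} (hX : X ∈ cliquePairs G w) :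
    ∃ L₁ L₂, ClosedPair G w X L₁ L₂ := by
  obtain ⟨K₁, K₂, h₁, h₂, rfl⟩ := hX
  exact (S.cl_spec h₁ h₂).2.2

namespace ClosedPair

variable {X L₁ L₂ : Set V}

lemma ncard_le (h : ClosedPair G w X L₁ L₂) : X.ncard ≤ 2 * G.cliqueNum := by
  rw [h.eq]
  exact ncard_union_le_cliqueNum h.clique₁ h.clique₂

lemma setNbhd_subset (h : ClosedPair G w X L₁ L₂) : setNbhd G (sideB G w X) ⊆ X :=
  h.isComp.setNbhd_subset

lemma subset₁ (h : ClosedPair G w X L₁ L₂) : L₁ ⊆ X := h.eq ▸ Set.subset_union_left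

lemma not_mem_sideB (h : ClosedPair G w X L₁ L₂) {v : V} (hv : v ∈ X) : v ∉ sideB G w X :=
  fun hB => h.isComp.not_mem hB hv

lemma mem_of_adj (h : ClosedPair G w X L₁ L₂) {u v : V} (hu : u ∈ sideB G w X) (huv : G.Adj u v) :
    v ∈ sideB G w X ∪ X := by
  by_cases hv : v ∈ X
  · exact Or.inr hv
  · exact Or.inl (h.isComp.2.2 u hu v hv huv)

/-- If two neighbours in `X` of a vertex outside `B ∪ X` are distinct, then they are in different
cliques. -/
lemma not_mem₁ (h : ClosedPair G w X L₁ L₂) {v p q : V} (hv : v ∉ sideB G w X ∪ X) (hpq : p ≠ q)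
    (hvp : G.Adj v p) (hvq : G.Adj v q) (hp : p ∈ L₁) : q ∉ L₁ := fun hq =>
  hv (Or.inr (h.subset₁ (h.closed₁ v (fun hB => hv (Or.inl hB)) p hp q hq hpq hvp hvq)))

end ClosedPair

/-- If `B'' ⊆ B` for two members `X''`, `X` of `𝒳`, then `X''` does not meet the side `A` of `X`. -/
lemma ClosedPair.subset_of_sideB_subset (S : Setting G w) {X L₁ L₂ X'' M₁ M₂ : Set V}
    (h : ClosedPair G w X L₁ L₂) (h'' : ClosedPair G w X'' M₁ M₂)
    (hB : sideB G w X'' ⊆ sideB G w X) : X'' ⊆ sideB G w X ∪ X := by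
  intro v hv
  by_contra hvA
  have hvN : v ∉ setNbhd G (sideB G w X'') := by
    rintro ⟨-, b, hb, hvb⟩
    exact hvA (h.mem_of_adj (hB hb) hvb.symm)
  obtain ⟨p, q, hpq, hp, hq, hvp, hvq, hadj⟩ : ∃ p q, p ≠ q ∧ p ∈ setNbhd G (sideB G w X'') ∧
      q ∈ setNbhd G (sideB G w X'') ∧ G.Adj v p ∧ G.Adj v q ∧ G.Adj p q := by
    rw [h''.eq] at hv
    rcases hv with hv | hv
    · obtain ⟨p, hp, q, hq, hpq, hpN, hqN⟩ := h''.ext₁ v hv hvN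
      exact ⟨p, q, hpq, hpN, hqN, h''.clique₁ hv hp (fun e => hvN (e ▸ hpN)),
        h''.clique₁ hv hq (fun e => hvN (e ▸ hqN)), h''.clique₁ hp hq hpq⟩
    · obtain ⟨p, hp, q, hq, hpq, hpN, hqN⟩ := h''.ext₂ v hv hvN
      exact ⟨p, q, hpq, hpN, hqN, h''.clique₂ hv hp (fun e => hvN (e ▸ hpN)),
        h''.clique₂ hv hq (fun e => hvN (e ▸ hqN)), h''.clique₂ hp hq hpq⟩
  have hNB : ∀ p, p ∈ setNbhd G (sideB G w X'') → G.Adj v p → p ∈ setNbhd G (sideB G w X) := by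
    rintro p ⟨-, b, hb, hpb⟩ hvp
    exact ⟨fun hpB => hvA (h.mem_of_adj hpB hvp.symm), b, hB hb, hpb⟩
  have hp' := hNB p hp hvp
  have hq' := hNB q hq hvq
  -- the component `E` of `G \ N[B]` that contains `v`
  set B := sideB G w X with hBdef
  set E := comp G (B ∪ setNbhd G B)ᶜ v with hEdef
  have hvE : v ∈ (B ∪ setNbhd G B)ᶜ := by
    rintro (h1 | h1)
    exacts [hvA (Or.inl h1), hvA (Or.inr (h.setNbhd_subset h1))]
  have hE : IsComp G (B ∪ setNbhd G B)ᶜ E := isComp_comp hvE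
  have hEB : Anticomplete G E B := fun e he b hb =>
    ⟨fun eq => hE.not_mem he (Or.inl (eq ▸ hb)), fun hadj => hE.not_mem he
      (Or.inr ⟨fun heB => hE.not_mem he (Or.inl heB), b, hb, hadj⟩)⟩
  have hNE : setNbhd G E ⊆ setNbhd G B := by
    intro c hc
    rcases hE.setNbhd_subset hc with hcB | hcB
    · obtain ⟨-, e, he, hce⟩ := hc
      exact absurd hce.symm (hEB e he c hcB).2
    · exact hcB
  have main : ∀ L₁ L₂, ClosedPair G w X L₁ L₂ → ∀ a b, a ∈ setNbhd G B → b ∈ setNbhd G B →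
      G.Adj v a → G.Adj v b → G.Adj a b → a ∈ L₁ → b ∈ L₂ → False := by
    intro L₁ L₂ h a b haN hbN hva hvb hab ha hb
    obtain ⟨b0, hb0⟩ := h.isComp.1.1
    have haE : a ∈ setNbhd G E :=
      ⟨fun haE => hE.not_mem haE (Or.inr haN), v, mem_comp _ _, hva.symm⟩
    obtain ⟨c, hc, hca, hnac⟩ := exists_nonadj_mem_setNbhd S.star hE.1 haE (b := b0)
      (fun hbE => (hEB b0 hbE b0 hb0).1 rfl) (fun hbN => (hNE hbN).1 hb0)
    have hcB := hNE hc
    have hcL : c ∈ L₂ := by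
      have := h.setNbhd_subset hcB
      rw [h.eq] at this
      rcases this with h1 | h1
      · exact absurd (h.clique₁ ha h1 hca.symm) hnac
      · exact h1
    have hbc : b ≠ c := by rintro rfl; exact hnac hab
    exact no_clock_of_two_connSets S.clock hE.1 h.isComp.1 hEB hca.symm hnac haE.2 hc.2 haN.2
      hcB.2 hab.symm (h.clique₂ hb hcL hbc) (fun hbE => hE.not_mem hbE (Or.inr hbN)) hbN.1
  have hpX := h.setNbhd_subset hp'
  have hqX := h.setNbhd_subset hq'
  rw [h.eq] at hpX hqX
  rcases hpX with hpL | hpL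
  · exact main L₁ L₂ h p q hp' hq' hvp hvq hadj hpL
      (hqX.resolve_left (h.not_mem₁ hvA hpq hvp hvq hpL))
  · exact main L₂ L₁ h.symm p q hp' hq' hvp hvq hadj hpL
      (hqX.resolve_right (h.symm.not_mem₁ hvA hpq hvp hvq hpL))

/-- Below every member of `𝒳` there is a member of the core. -/
lemma exists_mem_coreX {X : Set V} (hX : X ∈ cliquePairs G w) :
    ∃ Z ∈ coreX G w, sideB G w Z ∪ Z ⊆ sideB G w X ∪ X := by
  -- minimise first `|B ∪ C|`, then `-|B|`
  set N := Fintype.card V with hN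
  have hle : ∀ Z : Set V, Z.ncard ≤ N := fun Z => by
    rw [hN, ← Nat.card_eq_fintype_card]; exact Set.ncard_le_card Z
  obtain ⟨Z, ⟨hZ, hZX⟩, hmin⟩ := Set.exists_min_image
    {Z | Z ∈ cliquePairs G w ∧ sideB G w Z ∪ Z ⊆ sideB G w X ∪ X}
    (fun Z => (sideB G w Z ∪ Z).ncard * (N + 1) + (N - (sideB G w Z).ncard))
    (Set.toFinite _) ⟨X, hX, subset_rfl⟩
  refine ⟨Z, ⟨hZ, ?_⟩, hZX⟩
  rintro ⟨Y, hY, hshield⟩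
  have h1 := hle (sideB G w Z)
  have h2 := hle (sideB G w Y)
  rcases hshield with h | ⟨h, h'⟩
  · have := hmin Y ⟨hY, h.subset.trans hZX⟩
    have hlt := Set.ncard_lt_ncard h (Set.toFinite _)
    have : ((sideB G w Y ∪ Y).ncard + 1) * (N + 1) ≤ (sideB G w Z ∪ Z).ncard * (N + 1) :=
      Nat.mul_le_mul_right _ hlt
    rw [Nat.add_mul] at this
    omega
  · have := hmin Y ⟨hY, h.subset.trans hZX⟩
    have hlt := Set.ncard_lt_ncard h' (Set.toFinite _)
    rw [h] at this
    omega

lemma beta_subset {X : Set V} (hX : X ∈ cliquePairs G w) : beta G w ⊆ sideB G w X ∪ X := by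
  obtain ⟨Z, hZ, hZX⟩ := exists_mem_coreX hX
  exact fun v hv => hZX (hv Z hZ)

end Separations

/-! ### Components on the light side: two crossing components can be cut off together -/

section Crossing

variable {V : Type*} [Fintype V] {G : SimpleGraph V} {w : V → ℝ}

namespace ClosedPair

variable {X L₁ L₂ D : Set V}

lemma not_mem_comp (hD : IsComp G (sideA G w X) D) {v : V} (hv : v ∈ X) : v ∉ D :=
  fun h => hD.2.1 h (Or.inr hv)

lemma not_mem_sides (hD : IsComp G (sideA G w X) D) {v : V} (hv : v ∈ D) :
    v ∉ sideB G w X ∪ X := hD.2.1 hv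

lemma setNbhd_comp_subset (h : ClosedPair G w X L₁ L₂) (hD : IsComp G (sideA G w X) D) :
    setNbhd G D ⊆ X := by
  intro v hv
  have hD' : IsComp G (sideB G w X ∪ X)ᶜ D := hD
  rcases hD'.setNbhd_subset hv with hB | hX
  · obtain ⟨-, d, hd, hvd⟩ := hv
    exact absurd (h.mem_of_adj hB hvd) (hD'.not_mem hd)
  · exact hX

lemma anticomplete_comp (h : ClosedPair G w X L₁ L₂) (hD : IsComp G (sideA G w X) D) :
    Anticomplete G D (sideB G w X) := fun _ hd _ hb =>
  ⟨fun e => not_mem_sides hD hd (Or.inl (e ▸ hb)), fun e =>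
    not_mem_sides hD hd (h.mem_of_adj hb e.symm)⟩

/-- A vertex adjacent to a vertex of a component on the side `A` lies in it or in `X`. -/
lemma mem_comp_or (h : ClosedPair G w X L₁ L₂) (hD : IsComp G (sideA G w X) D) {d v : V}
    (hd : d ∈ D) (hdv : G.Adj d v) : v ∈ D ∨ v ∈ setNbhd G D ∧ v ∈ X := by
  by_cases hv : v ∈ D
  · exact Or.inl hv
  · have : v ∈ setNbhd G D := ⟨hv, d, hd, hdv.symm⟩
    exact Or.inr ⟨this, h.setNbhd_comp_subset hD this⟩

/-- Next to `v ∈ L₁` there is a vertex of `L₁` other than `z` that sees `F`, and a connected set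
containing `B` that it sees, away from `F` and `z`. -/
lemma exists_anchor (h : ClosedPair G w X L₁ L₂) {F : Set V} (hF : Anticomplete G F (sideB G w X))
    (hFX : ∀ v ∈ F, v ∉ X) {v z : V} (hv : v ∈ L₁) (hz : z ∈ L₁) (hvz : v ≠ z) (hvF : Sees G v F) :
    ∃ u ∈ L₁, u ≠ z ∧ Sees G u F ∧ ∃ B', ConnSet G B' ∧ sideB G w X ⊆ B' ∧ z ∉ B' ∧
      Anticomplete G F B' ∧ Sees G u B' := by
  have hzB : z ∉ sideB G w X := h.not_mem_sideB (h.subset₁ hz)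
  by_cases hvN : v ∈ setNbhd G (sideB G w X)
  · exact ⟨v, hv, hvz, hvF, _, h.isComp.1, subset_rfl, hzB, hF, hvN.2⟩
  · obtain ⟨m, hm, hmz, hmN⟩ : ∃ m ∈ L₁, m ≠ z ∧ m ∈ setNbhd G (sideB G w X) := by
      obtain ⟨p, hp, q, hq, hpq, hpN, hqN⟩ := h.ext₁ v hv hvN
      by_cases hpz : p = z
      · exact ⟨q, hq, fun e => hpq (hpz.trans e.symm), hqN⟩
      · exact ⟨p, hp, hpz, hpN⟩
    by_cases hmF : Sees G m F
    · exact ⟨m, hm, hmz, hmF, _, h.isComp.1, subset_rfl, hzB, hF, hmN.2⟩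
    · refine ⟨v, hv, hvz, hvF, sideB G w X ∪ {m}, h.isComp.1.union_singleton hmN.2,
        Set.subset_union_left, ?_, hF.union_right ?_, m, Or.inr rfl,
        h.clique₁ hv hm (fun e => hvN (e ▸ hmN))⟩
      · rintro (e | e)
        exacts [hzB e, hmz e.symm]
      · rintro f hf _ rfl
        exact ⟨fun e => hFX f hf (e ▸ h.subset₁ hm), fun e => hmF ⟨f, hf, e.symm⟩⟩

end ClosedPair

/-- Components `D`, `D'` on the light sides of two members `X`, `X'` of `𝒳` that cross: each of them
contains a neighbour of the other, in the first cliques of `X` and `X'`. -/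
structure Crossing (G : SimpleGraph V) (w : V → ℝ) (X L₁ L₂ D X' L₁' L₂' D' : Set V) (v v' : V) :
    Prop where
  pair : ClosedPair G w X L₁ L₂
  pair' : ClosedPair G w X' L₁' L₂'
  comp : IsComp G (sideA G w X) D
  comp' : IsComp G (sideA G w X') D'
  mem : v ∈ L₁
  mem' : v' ∈ L₁'
  memD' : v ∈ D'
  memD : v' ∈ D
  nbhd : v ∈ setNbhd G D
  nbhd' : v' ∈ setNbhd G D'

namespace Crossing

variable {X L₁ L₂ D X' L₁' L₂' D' : Set V} {v v' : V}

lemma symm (h : Crossing G w X L₁ L₂ D X' L₁' L₂' D' v v') :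
    Crossing G w X' L₁' L₂' D' X L₁ L₂ D v' v :=
  ⟨h.pair', h.pair, h.comp', h.comp, h.mem', h.mem, h.memD, h.memD', h.nbhd', h.nbhd⟩

lemma not_mem₂ (S : Setting G w) (h : Crossing G w X L₁ L₂ D X' L₁' L₂' D' v v') {u : V}
    (hu : u ∈ L₂) : u ∉ D' := by
  intro huD
  -- all of `X` lies in `D'` and its neighbourhood, so `B'` avoids `X`
  have hnot : ∀ x ∈ sideB G w X', x ∉ X := by
    intro x hx hxX
    have hadj : ∀ c ∈ D', x ≠ c ∧ ¬ G.Adj c x := fun c hc =>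
      ⟨(h.pair'.anticomplete_comp h.comp' c hc x hx).1.symm,
        (h.pair'.anticomplete_comp h.comp' c hc x hx).2⟩
    rw [h.pair.eq] at hxX
    rcases hxX with hx1 | hx1
    · exact (hadj v h.memD').2 (h.pair.clique₁ h.mem hx1 (hadj v h.memD').1.symm)
    · exact (hadj u huD).2 (h.pair.clique₂ hu hx1 (hadj u huD).1.symm)
  have hsub := subset_of_isComp_of_weight S.isWeight h.pair.isComp h.pair.big h.pair'.isComp.1 hnot
    h.pair'.big
  exact ClosedPair.not_mem_sides h.comp h.memD
    (ClosedPair.subset_of_sideB_subset S h.pair h.pair' hsub (h.pair'.subset₁ h.mem'))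

/-- The first cliques of `X` and `X'` are disjoint. A common vertex `z` would be adjacent to a
vertex of `L₁` and to a vertex of `L₁'` that are not adjacent to each other, and that both see a
part of `D ∩ D'` and a connected set around the heavy sides. -/
lemma disjoint₁ (S : Setting G w) (h : Crossing G w X L₁ L₂ D X' L₁' L₂' D' v v') {z : V}
    (hz : z ∈ L₁) (hz' : z ∈ L₁') : False := by
  have hvX' : v ∉ X' := fun e => ClosedPair.not_mem_comp h.comp' e h.memD'
  have hvB' : v ∉ sideB G w X' := fun e => ClosedPair.not_mem_sides h.comp' h.memD' (Or.inl e)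
  have hv'X : v' ∉ X := fun e => ClosedPair.not_mem_comp h.comp e h.memD
  have hvz : v ≠ z := fun e => hvX' (h.pair'.subset₁ (e ▸ hz'))
  have hdisj : ∀ p ∈ L₁, p ≠ z → p ∉ L₁' := by
    intro p hp hpz hp'
    have hvp : v ≠ p := fun e => hvX' (h.pair'.subset₁ (e ▸ hp'))
    exact hvX' (h.pair'.subset₁ (h.pair'.closed₁ v hvB' p hp' z hz' hpz
      (h.pair.clique₁ h.mem hp hvp) (h.pair.clique₁ h.mem hz hvz)))
  have hanti : ∀ p ∈ L₁, p ≠ z → ∀ q ∈ L₁', q ≠ z → ¬ G.Adj p q := by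
    intro p hp hpz q hq hqz hpq
    by_cases hpB : p ∈ sideB G w X'
    · have := h.pair'.anticomplete_comp h.comp' v h.memD' p hpB
      exact this.2 (h.pair.clique₁ h.mem hp this.1)
    · exact hdisj p hp hpz (h.pair'.closed₁ p hpB q hq z hz' hqz hpq (h.pair.clique₁ hp hz hpz))
  -- a component `F` of `D ∩ D'` seen by both `L₁ \ {z}` and `L₁' \ {z}`
  obtain ⟨-, d, hd, hvd⟩ := h.nbhd
  have hdz : d ≠ z := fun e => ClosedPair.not_mem_comp h.comp (e ▸ h.pair.subset₁ hz) hd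
  have hdD' : d ∈ D' := by
    rcases h.pair'.mem_comp_or h.comp' h.memD' hvd with h1 | h1
    · exact h1
    · have h2 := h1.2
      rw [h.pair'.eq] at h2
      rcases h2 with h2 | h2
      · exact absurd hvd (hanti v h.mem hvz d h2 hdz)
      · exact absurd hd (h.symm.not_mem₂ S h2)
  have hF : IsComp G (D ∩ D') (CentralBag.comp G (D ∩ D') d) := isComp_comp ⟨hd, hdD'⟩
  set F := CentralBag.comp G (D ∩ D') d with hFdef
  have hv'F : v' ∉ F := fun e => h.nbhd'.1 (hF.2.1 e).2
  obtain ⟨p, hpD, hpF, e, heD, heF, hpe⟩ := h.comp.1.exists_adj hd (mem_comp _ _) h.memD hv'F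
  have heL : e ∈ L₁' := by
    rcases h.pair'.mem_comp_or h.comp' (hF.2.1 hpF).2 hpe with h1 | h1
    · exact absurd (hF.2.2 p hpF e ⟨heD, h1⟩ hpe) heF
    · have h2 := h1.2
      rw [h.pair'.eq] at h2
      exact h2.resolve_right fun h3 => h.symm.not_mem₂ S h3 heD
  have hez : e ≠ z := fun e' => ClosedPair.not_mem_comp h.comp (e' ▸ h.pair.subset₁ hz) heD
  have hFB := (h.pair.anticomplete_comp h.comp).mono (hF.2.1.trans Set.inter_subset_left) subset_rfl
  have hFB' := (h.pair'.anticomplete_comp h.comp').mono (hF.2.1.trans Set.inter_subset_right)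
    subset_rfl
  have hFX : ∀ v ∈ F, v ∉ X := fun v hv hX => ClosedPair.not_mem_comp h.comp hX (hF.2.1 hv).1
  have hFX' : ∀ v ∈ F, v ∉ X' := fun v hv hX => ClosedPair.not_mem_comp h.comp' hX (hF.2.1 hv).2
  obtain ⟨u, hu, huz, huF, C, hC, hBC, hzC, hFC, huC⟩ :=
    h.pair.exists_anchor hFB hFX h.mem hz hvz ⟨d, mem_comp _ _, hvd⟩
  obtain ⟨u', hu', hu'z, hu'F, C', hC', hBC', hzC', hFC', hu'C'⟩ :=
    h.pair'.exists_anchor hFB' hFX' heL hz' hez ⟨p, hpF, hpe.symm⟩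
  obtain ⟨b, hb, hb'⟩ := exists_mem_inter_of_weight S.isWeight h.pair.big h.pair'.big
  exact no_clock_of_two_connSets S.clock hF.1 (hC.union_of_mem hC' (hBC hb) (hBC' hb'))
    (hFC.union_right hFC') (fun h1 : u = u' => hdisj u hu huz (h1 ▸ hu'))
    (hanti u hu huz u' hu' hu'z) huF hu'F
    (huC.mono Set.subset_union_left) (hu'C'.mono Set.subset_union_right)
    (h.pair.clique₁ hz hu huz.symm) (h.pair'.clique₁ hz' hu' hu'z.symm)
    (fun e => hFX z e (h.pair.subset₁ hz)) (fun e => e.elim hzC hzC')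

/-- The second cliques of `X` and `X'` cover the neighbourhood of `D ∪ D'`. -/
lemma setNbhd_union_subset (S : Setting G w) (h : Crossing G w X L₁ L₂ D X' L₁' L₂' D' v v') :
    setNbhd G (D ∪ D') ⊆ L₂ ∪ L₂' := by
  -- by symmetry, for a neighbour of `D`
  have main : ∀ {X L₁ L₂ D X' L₁' L₂' D' : Set V} {v v' : V},
      Crossing G w X L₁ L₂ D X' L₁' L₂' D' v v' → ∀ p, p ∉ D → p ∉ D' → (∃ d ∈ D, G.Adj p d) →
      p ∈ L₂ ∪ L₂' := by
    intro X L₁ L₂ D X' L₁' L₂' D' v v' h p hpD hpD' hp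
    have hpX := h.pair.setNbhd_comp_subset h.comp ⟨hpD, hp⟩
    rw [h.pair.eq] at hpX
    rcases hpX with hp1 | hp2
    · have hvp : v ≠ p := fun e => hpD' (e ▸ h.memD')
      rcases h.pair'.mem_comp_or h.comp' h.memD' (h.pair.clique₁ h.mem hp1 hvp) with h1 | h1
      · exact absurd h1 hpD'
      · have h2 := h1.2
        rw [h.pair'.eq] at h2
        rcases h2 with h2 | h2
        · exact (h.disjoint₁ S hp1 h2).elim
        · exact Or.inr h2
    · exact Or.inl hp2
  rintro p ⟨hp, d, hd, hpd⟩
  rcases hd with hd | hd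
  · exact main h p (fun e => hp (Or.inl e)) (fun e => hp (Or.inr e)) ⟨d, hd, hpd⟩
  · exact (main h.symm p (fun e => hp (Or.inr e)) (fun e => hp (Or.inl e)) ⟨d, hd, hpd⟩).symm

/-- The closure of the two cliques that cover `N(D ∪ D')` adds no vertex of `D ∪ D'`. -/
lemma false_of_ext (S : Setting G w) (h : Crossing G w X L₁ L₂ D X' L₁' L₂' D' v v')
    (hconn : ConnSet G (D ∪ D')) {B : Set V}
    (hB : IsComp G (setNbhd G (D ∪ D'))ᶜ B) (hBS : ∀ b ∈ B, b ∉ D ∪ D') {e p q : V}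
    (he : e ∈ D ∪ D') (hpq : p ≠ q) (hep : G.Adj e p) (heq : G.Adj e q) (hp : p ∈ setNbhd G B)
    (hq : q ∈ setNbhd G B) (hp2 : p ∈ L₂) (hq2 : q ∈ L₂) : False := by
  have hpS := hB.setNbhd_subset hp
  have hqS := hB.setNbhd_subset hq
  have heX : e ∉ X := by
    intro heX
    rcases he with he | he
    · exact ClosedPair.not_mem_comp h.comp heX he
    · exact h.not_mem₂ S (h.pair.closed₂ e (h.pair.not_mem_sideB heX) p hp2 q hq2 hpq hep heq) he
  have heB : e ∈ sideB G w X := by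
    by_contra heB
    exact heX (h.pair.symm.subset₁ (h.pair.closed₂ e heB p hp2 q hq2 hpq hep heq))
  have heD' : e ∈ D' := he.resolve_left fun h1 => ClosedPair.not_mem_sides h.comp h1 (Or.inl heB)
  have hmemX' : ∀ p, p ∉ D ∪ D' → G.Adj e p → p ∈ X' := fun p hp hep =>
    ((h.pair'.mem_comp_or h.comp' heD' hep).resolve_left fun h1 => hp (Or.inr h1)).2
  have heA' := ClosedPair.not_mem_sides h.comp' heD'
  have main : ∀ p q, p ≠ q → G.Adj e p → G.Adj e q → p ∈ setNbhd G B → q ∈ setNbhd G B → p ∈ L₂ →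
      q ∈ L₂ → p ∉ L₂' → q ∈ L₂' → False := by
    intro p q hpq hep heq hp hq hp2 hq2 hp' hq'
    obtain ⟨s, hs⟩ := hconn.1
    obtain ⟨c, hc, hcp, hnpc⟩ := exists_nonadj_mem_setNbhd S.star hB.1 hp (b := s)
      (fun hsB => hBS s hsB hs) (fun hsB => (hB.setNbhd_subset hsB).1 hs)
    have hcS := hB.setNbhd_subset hc
    have hcL : c ∈ L₂' := (h.setNbhd_union_subset S hcS).resolve_left fun h1 =>
      hnpc (h.pair.clique₂ hp2 h1 hcp.symm)
    have hqc : q ≠ c := by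
      rintro rfl
      exact hnpc (h.pair.clique₂ hp2 hq2 hpq)
    exact no_clock_of_two_connSets S.clock hconn hB.1 (fun s hs b hb =>
      ⟨fun e => hBS b hb (e ▸ hs), fun e => hB.not_mem hb ⟨hBS b hb, s, hs, e.symm⟩⟩) hcp.symm hnpc
      (hB.setNbhd_subset hp).2 hcS.2 hp.2 hc.2 (h.pair.clique₂ hq2 hp2 hpq.symm)
      (h.pair'.clique₂ hq' hcL hqc) (hB.setNbhd_subset hq).1 hq.1
  have hpX' := hmemX' p hpS.1 hep
  have hqX' := hmemX' q hqS.1 heq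
  by_cases hp' : p ∈ L₂'
  · exact main q p hpq.symm heq hep hq hp hq2 hp2
      (h.pair'.symm.not_mem₁ heA' hpq hep heq hp') hp'
  · rw [h.pair'.eq] at hpX' hqX'
    have hp1 := hpX'.resolve_right hp'
    exact main p q hpq hep heq hp hq hp2 hq2 hp'
      (hqX'.resolve_left (h.pair'.not_mem₁ heA' hpq hep heq hp1))

end Crossing

/-- Two components on the light sides of members of `𝒳`, one of which contains a neighbour of the
other, lie together on the light side of a member of `𝒳`. -/
theorem exists_union_subset_sideA (S : Setting G w) {X X' D D' : Set V} (hX : X ∈ cliquePairs G w)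
    (hX' : X' ∈ cliquePairs G w) (hD : IsComp G (sideA G w X) D) (hD' : IsComp G (sideA G w X') D')
    {v : V} (hv : v ∈ setNbhd G D) (hvD' : v ∈ D') :
    ∃ Y ∈ cliquePairs G w, D ∪ D' ⊆ sideA G w Y := by
  obtain ⟨L₁, L₂, h⟩ := S.exists_closedPair hX
  obtain ⟨L₁', L₂', h'⟩ := S.exists_closedPair hX'
  have hconn : ConnSet G (D ∪ D') := by
    obtain ⟨-, d, hd, hvd⟩ := hv
    exact hD.1.union hD'.1 ⟨d, hd, v, hvD', Or.inr hvd.symm⟩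
  by_cases hcross : ∃ v' ∈ D, v' ∈ setNbhd G D'
  swap
  · -- without a neighbour of `D'` in it, `D` is contained in `D'`
    push Not at hcross
    have h1 : D ∪ {v} ⊆ D' := by
      refine (isComp_setNbhd hD'.1).subset_of_mem (hD.1.union_singleton hv.2) ?_ (Or.inr rfl) hvD'
      rintro u (hu | rfl)
      exacts [hcross u hu, fun e => e.1 hvD']
    exact ⟨X', hX', Set.union_subset ((Set.subset_union_left.trans h1).trans hD'.2.1) hD'.2.1⟩
  obtain ⟨v', hv'D, hv'⟩ := hcross
  -- name the cliques so that `v ∈ L₁` and `v' ∈ L₁'`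
  obtain ⟨L₁, L₂, L₁', L₂', hC⟩ :
      ∃ L₁ L₂ L₁' L₂', Crossing G w X L₁ L₂ D X' L₁' L₂' D' v v' := by
    have hvX := h.setNbhd_comp_subset hD hv
    have hv'X := h'.setNbhd_comp_subset hD' hv'
    rw [h.eq] at hvX
    rw [h'.eq] at hv'X
    rcases hvX with h1 | h1 <;> rcases hv'X with h2 | h2
    · exact ⟨L₁, L₂, L₁', L₂', h, h', hD, hD', h1, h2, hvD', hv'D, hv, hv'⟩
    · exact ⟨L₁, L₂, L₂', L₁', h, h'.symm, hD, hD', h1, h2, hvD', hv'D, hv, hv'⟩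
    · exact ⟨L₂, L₁, L₁', L₂', h.symm, h', hD, hD', h1, h2, hvD', hv'D, hv, hv'⟩
    · exact ⟨L₂, L₁, L₂', L₁', h.symm, h'.symm, hD, hD', h1, h2, hvD', hv'D, hv, hv'⟩
  have hK₁ : G.IsClique (setNbhd G (D ∪ D') ∩ L₂) := hC.pair.clique₂.subset Set.inter_subset_right
  have hK₂ : G.IsClique (setNbhd G (D ∪ D') ∩ L₂') := hC.pair'.clique₂.subset Set.inter_subset_right
  have hKeq : (setNbhd G (D ∪ D') ∩ L₂) ∪ (setNbhd G (D ∪ D') ∩ L₂') = setNbhd G (D ∪ D') := by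
    rw [← Set.inter_union_distrib_left]
    exact Set.inter_eq_left.2 (hC.setNbhd_union_subset S)
  obtain ⟨hside, hext, -⟩ := S.cl_spec hK₁ hK₂
  rw [hKeq] at hside hext
  obtain ⟨hB, hBw⟩ := S.sideB_spec (X := setNbhd G (D ∪ D')) (by
    have := ncard_union_le_cliqueNum hK₁ hK₂
    rw [hKeq] at this
    omega)
  have hS := isComp_setNbhd hconn
  -- `X ∪ X'` has at most `4 ω(G)` vertices, so `G \ (X ∪ X')` has a heavy component; it lies in the
  -- heavy component of `G \ N(D ∪ D')`, which therefore avoids both `D` and `D'`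
  have hBS : ∀ b ∈ sideB G w (setNbhd G (D ∪ D')), b ∉ D ∪ D' := by
    intro b hb hbS
    obtain ⟨hB0, hB0w⟩ := S.sideB_spec (X := X ∪ X') (by
      have h1 := Set.ncard_union_le X X'
      have h2 := h.ncard_le
      have h3 := h'.ncard_le
      omega)
    have hsub : setNbhd G (D ∪ D') ⊆ X ∪ X' := (hC.setNbhd_union_subset S).trans
      (Set.union_subset_union hC.pair.symm.subset₁ hC.pair'.symm.subset₁)
    have h1 := subset_of_isComp_of_weight S.isWeight h.isComp h.big hB0.1
      (fun v hv hvX => hB0.not_mem hv (Or.inl hvX)) hB0w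
    have h2 := subset_of_isComp_of_weight S.isWeight h'.isComp h'.big hB0.1
      (fun v hv hvX => hB0.not_mem hv (Or.inr hvX)) hB0w
    have h3 := subset_of_isComp_of_weight S.isWeight hB hBw hB0.1
      (fun v hv hvX => hB0.not_mem hv (hsub hvX)) hB0w
    obtain ⟨c, hc⟩ := hB0.1.1
    have h4 := h3 hc
    rw [hB.eq_of_mem hS hb hbS] at h4
    rcases h4 with h4 | h4
    · exact ClosedPair.not_mem_sides hD h4 (Or.inl (h1 hc))
    · exact ClosedPair.not_mem_sides hD' h4 (Or.inl (h2 hc))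
  refine ⟨_, ⟨_, _, hK₁, hK₂, rfl⟩, fun e he => ?_⟩
  rintro (heB | heX)
  · rw [hside] at heB
    exact hBS e heB he
  · obtain ⟨p, q, hpq, hep, heq, hp, hq, hpq2⟩ := hext e heX (fun h1 => h1.1 he)
    rcases hpq2 with ⟨hp2, hq2⟩ | ⟨hp2, hq2⟩
    · exact hC.false_of_ext S hconn hB hBS he hpq hep heq hp hq hp2.2 hq2.2
    · rw [Set.union_comm] at hconn hB hBS he
      exact hC.symm.false_of_ext S hconn hB hBS he hpq hep heq
        (by rwa [Set.union_comm D' D]) (by rwa [Set.union_comm D' D]) hp2.2 hq2.2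

/-- Every component of `G \ β` lies on the light side of a member of the core. -/
theorem exists_mem_coreX_subset_sideA (S : Setting G w) {D : Set V}
    (hD : IsComp G (beta G w)ᶜ D) : ∃ X ∈ coreX G w, D ⊆ sideA G w X := by
  have hcore : ∀ v ∈ D, ∃ X ∈ coreX G w, v ∈ sideA G w X := by
    intro v hv
    have h1 := hD.not_mem hv
    unfold beta centralBag at h1
    rw [Set.mem_ofPred_eq] at h1
    push Not at h1
    exact h1
  obtain ⟨v₀, hv₀⟩ := hD.1.1
  obtain ⟨X₀, hX₀, hv₀A⟩ := hcore v₀ hv₀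
  -- a largest component of a light side that meets `D`
  obtain ⟨E, ⟨⟨X, hX, hE⟩, e, heE, heD⟩, hmax⟩ := Set.exists_max_image
    {E | (∃ X ∈ cliquePairs G w, IsComp G (sideA G w X) E) ∧ ∃ e ∈ E, e ∈ D} Set.ncard
    (Set.toFinite _) ⟨_, ⟨X₀, hX₀.1, isComp_comp hv₀A⟩, v₀, mem_comp _ _, hv₀⟩
  have hDE : D ⊆ E := by
    intro u hu
    by_contra huE
    obtain ⟨p, hp, hpE, q, hq, hqE, hpq⟩ := hD.1.exists_adj heD heE hu huE
    obtain ⟨X₁, hX₁, hqA⟩ := hcore q hq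
    have hD' := isComp_comp (G := G) hqA
    have hqN : q ∈ setNbhd G E := ⟨hqE, p, hpE, hpq.symm⟩
    obtain ⟨Y, hY, hsub⟩ := exists_union_subset_sideA S hX hX₁.1 hE hD' hqN (mem_comp _ _)
    have hconn : ConnSet G (E ∪ comp G (sideA G w X₁) q) :=
      hE.1.union hD'.1 ⟨p, hpE, q, mem_comp _ _, Or.inr hpq⟩
    have hqS : q ∈ E ∪ comp G (sideA G w X₁) q := Or.inr (mem_comp _ _)
    have hE' := isComp_comp (G := G) (hsub hqS)
    have hsub' := hE'.subset_of_mem hconn hsub hqS (mem_comp _ _)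
    have h1 := hmax _ ⟨⟨Y, hY, hE'⟩, e, hsub' (Or.inl heE), heD⟩
    have h2 : E ⊂ comp G (sideA G w Y) q :=
      ⟨fun x hx => hsub' (Or.inl hx), fun h3 => hqE (h3 (mem_comp _ _))⟩
    have := Set.ncard_lt_ncard h2 (Set.toFinite _)
    omega
  obtain ⟨Z, hZ, hZX⟩ := exists_mem_coreX hX
  exact ⟨Z, hZ, fun u hu h1 => hE.2.1 (hDE hu) (hZX h1)⟩

lemma isComp_sideA_of_isComp_beta {X D : Set V} (hX : X ∈ coreX G w)
    (hD : IsComp G (beta G w)ᶜ D) (h : D ⊆ sideA G w X) : IsComp G (sideA G w X) D :=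
  ⟨hD.1, h, fun a ha b hb hab => hD.2.2 a ha b (fun hbeta => hb (hbeta X hX)) hab⟩

end Crossing

/-! ### Marker paths -/

section Markers

variable {V : Type*} [Fintype V] {G : SimpleGraph V} {w : V → ℝ}

/-- Adjacent vertices `t ∈ L₁`, `y ∈ L₂` of `N(D)` away from `N(B)`, such that all vertices of
`N(B)` see `D`. There is no such edge, by `TightEdge.not_exists`. -/
structure TightEdge (G : SimpleGraph V) (w : V → ℝ) (X L₁ L₂ D : Set V) (t y : V) : Prop where
  pair : ClosedPair G w X L₁ L₂
  comp : IsComp G (sideA G w X) D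
  mem₁ : t ∈ L₁
  mem₂ : y ∈ L₂
  not_mem₂ : t ∉ L₂
  not_mem₁ : y ∉ L₁
  adj : G.Adj t y
  sees₁ : Sees G t D
  sees₂ : Sees G y D
  not_nbhd₁ : t ∉ setNbhd G (sideB G w X)
  not_nbhd₂ : y ∉ setNbhd G (sideB G w X)
  attached₁ : ∀ m ∈ L₁, m ∈ setNbhd G (sideB G w X) → Sees G m D
  attached₂ : ∀ m ∈ L₂, m ∈ setNbhd G (sideB G w X) → Sees G m D

namespace TightEdge

variable {X L₁ L₂ D : Set V} {t y : V}

lemma symm (h : TightEdge G w X L₁ L₂ D t y) : TightEdge G w X L₂ L₁ D y t :=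
  ⟨h.pair.symm, h.comp, h.mem₂, h.mem₁, h.not_mem₁, h.not_mem₂, h.adj.symm, h.sees₂, h.sees₁,
    h.not_nbhd₂, h.not_nbhd₁, h.attached₂, h.attached₁⟩

/-- A vertex of `D` does not see two distinct vertices of a clique of `X`. -/
lemma eq_of_adj (h : TightEdge G w X L₁ L₂ D t y) {d p q : V} (hd : d ∈ D) (hp : p ∈ L₁)
    (hq : q ∈ L₁) (hdp : G.Adj d p) (hdq : G.Adj d q) : p = q := by
  by_contra hpq
  exact h.pair.not_mem₁ (ClosedPair.not_mem_sides h.comp hd) hpq hdp hdq hp hq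

/-- A connected part of `D` seen by `y` and by a vertex of `L₁ ∩ N(B)` is seen by all vertices of
`L₂ ∩ N(B)`. -/
lemma sees_of_sees (S : Setting G w) (h : TightEdge G w X L₁ L₂ D t y) {C : Set V}
    (hC : ConnSet G C) (hCD : C ⊆ D) (hyC : Sees G y C) {a g : V} (ha : a ∈ L₁)
    (haN : a ∈ setNbhd G (sideB G w X)) (haC : Sees G a C) (hg : g ∈ L₂)
    (hgN : g ∈ setNbhd G (sideB G w X)) : Sees G g C := by
  by_contra hgC
  have hta : t ≠ a := fun e => h.not_nbhd₁ (e ▸ haN)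
  have hyg : y ≠ g := fun e => h.not_nbhd₂ (e ▸ hgN)
  have hyB := h.pair.not_mem_sideB (h.pair.symm.subset₁ h.mem₂)
  refine no_clock_of_two_connSets S.clock hC (h.pair.isComp.1.union_singleton hgN.2) ?_
    (u := a) (v := y) (z := t) (fun e => h.not_nbhd₂ (e ▸ haN)) (fun hay => h.not_mem₁
      (h.pair.closed₁ y hyB a ha t h.mem₁ hta.symm hay.symm h.adj.symm)) haC hyC
    (Sees.mono haN.2 Set.subset_union_left) ⟨g, Or.inr rfl, h.pair.clique₂ h.mem₂ hg hyg⟩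
    (h.pair.clique₁ h.mem₁ ha hta) h.adj
    (fun htC => ClosedPair.not_mem_comp h.comp (h.pair.subset₁ h.mem₁) (hCD htC)) ?_
  · refine ((h.pair.anticomplete_comp h.comp).mono hCD subset_rfl).union_right ?_
    rintro c hc _ rfl
    exact ⟨fun e => ClosedPair.not_mem_comp h.comp (h.pair.symm.subset₁ hg) (hCD (e ▸ hc)),
      fun e => hgC ⟨c, hc, e.symm⟩⟩
  · rintro (e | e)
    · exact h.pair.not_mem_sideB (h.pair.subset₁ h.mem₁) e
    · exact h.not_mem₂ (by rw [Set.mem_singleton_iff.1 e]; exact hg)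

lemma exists_two (h : TightEdge G w X L₁ L₂ D t y) : ∃ p ∈ L₂, ∃ q ∈ L₂, p ≠ q ∧
    p ∈ setNbhd G (sideB G w X) ∧ q ∈ setNbhd G (sideB G w X) :=
  h.pair.ext₂ y h.mem₂ h.not_nbhd₂

/-- A neighbour of `y` in `D` has no neighbour in `N(B)`. -/
lemma not_sees (S : Setting G w) (h : TightEdge G w X L₁ L₂ D t y) {d m : V} (hd : d ∈ D)
    (hyd : G.Adj y d) (hm : m ∈ setNbhd G (sideB G w X)) : ¬ G.Adj d m := by
  intro hdm
  have hL2 : ∀ g ∈ L₂, g ∈ setNbhd G (sideB G w X) → ¬ G.Adj d g := fun g hg hgN hdg =>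
    h.not_nbhd₂ (h.symm.eq_of_adj hd hg h.mem₂ hdg hyd.symm ▸ hgN)
  have hmX := h.pair.setNbhd_subset hm
  rw [h.pair.eq] at hmX
  rcases hmX with hmL | hmL
  · obtain ⟨g, hg, -, -, -, hgN, -⟩ := h.exists_two
    obtain ⟨_, rfl, hgd⟩ := h.sees_of_sees S (ConnSet.singleton d) (by rintro _ rfl; exact hd)
      ⟨d, rfl, hyd⟩ hmL hm ⟨d, rfl, hdm.symm⟩ hg hgN
    exact hL2 g hg hgN hgd.symm
  · exact hL2 m hmL hm hdm

/-- A vertex of `D` that sees a connected part of `D` seen by `y` but not by `N(B)` has no neighbour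
in `L₁ ∩ N(B)`. -/
lemma not_adj_of_sees (S : Setting G w) (h : TightEdge G w X L₁ L₂ D t y) {C : Set V}
    (hC : ConnSet G C) (hCD : C ⊆ D) (hyC : Sees G y C)
    (hCN : ∀ m ∈ setNbhd G (sideB G w X), ¬ Sees G m C) {s a : V} (hs : s ∈ D) (hsC : Sees G s C)
    (ha : a ∈ L₁) (haN : a ∈ setNbhd G (sideB G w X)) : ¬ G.Adj s a := by
  intro hsa
  obtain ⟨p, hp, q, hq, hpq, hpN, hqN⟩ := h.exists_two
  have hsee : ∀ g ∈ L₂, g ∈ setNbhd G (sideB G w X) → G.Adj s g := by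
    intro g hg hgN
    obtain ⟨c, hc, hgc⟩ := h.sees_of_sees S (hC.union_singleton hsC)
      (by rintro c (hc | rfl); exacts [hCD hc, hs]) (hyC.mono Set.subset_union_left) ha haN
      ⟨s, Or.inr rfl, hsa.symm⟩ hg hgN
    rcases hc with hc | rfl
    · exact absurd ⟨c, hc, hgc⟩ (hCN g hgN)
    · exact hgc.symm
  exact hpq (h.symm.eq_of_adj hs hp hq (hsee p hp hpN) (hsee q hq hqN))

/-- Tight edges do not exist. Let `U` be the component containing a neighbour of `y` in the part of
`D` that has no neighbour in `N(B)`. The vertices of `D` around `U` have neighbours in `N(B) ∩ L₂`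
only. If `t` sees `U`, the same holds with `L₁`, a contradiction; if not, then `y` and a vertex of
`D` between `U` and a neighbour of `t` lie on a hole through `U` and `t`, and have a common
neighbour in `N(B) ∩ L₂`. -/
theorem not_exists (S : Setting G w) (h : TightEdge G w X L₁ L₂ D t y) : False := by
  obtain ⟨d, hd, hyd⟩ := h.sees₂
  set R := {u | u ∈ D ∧ ∀ m ∈ setNbhd G (sideB G w X), ¬ G.Adj u m} with hR
  have hdR : d ∈ R := ⟨hd, fun m hm => h.not_sees S hd hyd hm⟩
  have hU := isComp_comp (G := G) hdR
  set U := CentralBag.comp G R d with hUdef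
  have hUD : U ⊆ D := fun u hu => (hU.2.1 hu).1
  have hdU : d ∈ U := mem_comp _ _
  have hUN : ∀ m ∈ setNbhd G (sideB G w X), ¬ Sees G m U := fun m hm ⟨u, hu, hmu⟩ =>
    (hU.2.1 hu).2 m hm hmu.symm
  have hyU : Sees G y U := ⟨d, hdU, hyd⟩
  have hbound : ∀ s ∈ D, s ∉ U → Sees G s U → ∃ m ∈ setNbhd G (sideB G w X), G.Adj s m := by
    rintro s hs hsU ⟨u, hu, hsu⟩
    by_contra hcon
    push Not at hcon
    exact hsU (hU.2.2 u hu s ⟨hs, hcon⟩ hsu.symm)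
  have hbound2 : ∀ s ∈ D, s ∉ U → Sees G s U →
      ∃ m ∈ L₂, m ∈ setNbhd G (sideB G w X) ∧ G.Adj s m := by
    intro s hs hsU hsee
    obtain ⟨m, hm, hsm⟩ := hbound s hs hsU hsee
    have hmX := h.pair.setNbhd_subset hm
    rw [h.pair.eq] at hmX
    rcases hmX with hm1 | hm2
    · exact absurd hsm (h.not_adj_of_sees S hU.1 hUD hyU hUN hs hsee hm1 hm)
    · exact ⟨m, hm2, hm, hsm⟩
  obtain ⟨g₀, hg₀, -, -, -, hg₀N, -⟩ := h.exists_two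
  obtain ⟨e, he, hg₀e⟩ := h.attached₂ g₀ hg₀ hg₀N
  have heU : e ∉ U := fun heU => hUN g₀ hg₀N ⟨e, heU, hg₀e⟩
  by_cases htU : Sees G t U
  · obtain ⟨p, hp, hpU, s, hs, hsU, hps⟩ := h.comp.1.exists_adj hd hdU he heU
    obtain ⟨m, hm2, hm, hsm⟩ := hbound2 s hs hsU ⟨p, hpU, hps.symm⟩
    exact h.symm.not_adj_of_sees S hU.1 hUD htU hUN hs ⟨p, hpU, hps.symm⟩ hm2 hm hsm
  · obtain ⟨d', hd', htd'⟩ := h.sees₁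
    have hd'U : d' ∉ U := fun e => htU ⟨d', e, htd'⟩
    have hd'N : ¬ Sees G d' U := fun e => by
      obtain ⟨m, hm, hm'⟩ := hbound d' hd' hd'U e
      exact h.symm.not_sees S hd' htd' hm hm'
    -- the component `Z` of `D \ N[U]` seen by `t`, and a vertex `s` between `U` and `Z`
    have hd'R : d' ∈ {u | u ∈ D ∧ u ∉ U ∧ ¬ Sees G u U} := ⟨hd', hd'U, hd'N⟩
    have hZ := isComp_comp (G := G) hd'R
    set Z := CentralBag.comp G {u | u ∈ D ∧ u ∉ U ∧ ¬ Sees G u U} d' with hZdef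
    obtain ⟨p, hp, hpZ, s, hs, hsZ, hps⟩ :=
      h.comp.1.exists_adj hd' (mem_comp _ _ : d' ∈ Z) hd (fun e => (hZ.2.1 e).2.1 hdU)
    have hsU : s ∉ U := fun e => (hZ.2.1 hpZ).2.2 ⟨s, e, hps⟩
    have hsee : Sees G s U := by
      by_contra hcon
      exact hsZ (hZ.2.2 p hpZ s ⟨hs, hsU, hcon⟩ hps)
    obtain ⟨m, hm2, hm, hsm⟩ := hbound2 s hs hsU hsee
    have hym : y ≠ m := fun e => h.not_nbhd₂ (e ▸ hm)
    have htX := h.pair.subset₁ h.mem₁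
    refine no_clock_of_two_connSets S.clock hU.1 (hZ.1.union_singleton ⟨d', mem_comp _ _, htd'⟩) ?_
      (u := y) (v := s) (z := m)
      (fun e => ClosedPair.not_mem_comp h.comp (h.pair.symm.subset₁ h.mem₂) (e ▸ hs))
      (fun hys => hym (h.symm.eq_of_adj hs h.mem₂ hm2 hys.symm hsm)) hyU hsee
      ⟨t, Or.inr rfl, h.adj.symm⟩ (Sees.mono ⟨p, hpZ, hps.symm⟩ Set.subset_union_left)
      (h.pair.clique₂ hm2 h.mem₂ hym.symm) hsm.symm
      (fun e => ClosedPair.not_mem_comp h.comp (h.pair.symm.subset₁ hm2) (hUD e)) ?_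
    · refine Anticomplete.union_right (fun u hu z hz => ⟨fun e => (hZ.2.1 hz).2.1 (e ▸ hu),
        fun e => (hZ.2.1 hz).2.2 ⟨u, hu, e.symm⟩⟩) ?_
      rintro u hu _ rfl
      exact ⟨fun e => ClosedPair.not_mem_comp h.comp htX (hUD (e ▸ hu)),
        fun e => htU ⟨u, hu, e.symm⟩⟩
    · rintro (e | e)
      · exact ClosedPair.not_mem_comp h.comp (h.pair.symm.subset₁ hm2) (hZ.2.1 e).1
      · exact h.not_mem₂ (by rw [← Set.mem_singleton_iff.1 e]; exact hm2)

end TightEdge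

/-- For non-adjacent `x ∈ L₁`, `y ∈ L₂` in the neighbourhood of a component `D` on the light side,
no other vertex of `L₁` that sees `D` is adjacent to `y`. This is what keeps the interior of a
shortest path through `D` between non-adjacent vertices of `X` away from the rest of `X`. -/
theorem ClosedPair.not_adj_of_sees (S : Setting G w) {X L₁ L₂ D : Set V}
    (h : ClosedPair G w X L₁ L₂) (hD : IsComp G (sideA G w X) D) {x y t : V} (hx : x ∈ L₁)
    (hy : y ∈ L₂) (ht : t ∈ L₁) (hxD : Sees G x D) (hyD : Sees G y D) (htD : Sees G t D)
    (hxy : x ≠ y) (hnxy : ¬ G.Adj x y) (htx : t ≠ x) : ¬ G.Adj t y := by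
  intro hty
  have hX₁ : ∀ v ∈ L₁, v ∈ X := fun v hv => h.subset₁ hv
  have hX₂ : ∀ v ∈ L₂, v ∈ X := fun v hv => h.symm.subset₁ hv
  have hnD : ∀ v ∈ X, v ∉ D := fun v hv => ClosedPair.not_mem_comp hD hv
  have hnB : ∀ v ∈ X, v ∉ sideB G w X := fun v hv => h.not_mem_sideB hv
  have hyL : y ∉ L₁ := fun e => hnxy (h.clique₁ hx e hxy)
  -- the part `B⁺` of `G \ N[D]` around `B`
  obtain ⟨b, hb⟩ := h.isComp.1.1
  set W := (D ∪ setNbhd G D)ᶜ with hW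
  have hBW : sideB G w X ⊆ W := by
    rintro v hv (e | e)
    · exact (h.anticomplete_comp hD v e v hv).1 rfl
    · exact hnB v (h.setNbhd_comp_subset hD e) hv
  have hP := isComp_comp (G := G) (hBW hb)
  set P := comp G W b with hPdef
  have hBP : sideB G w X ⊆ P := hP.subset_of_mem h.isComp.1 hBW hb (mem_comp _ _)
  have hDP : Anticomplete G D P := fun d hd p hp =>
    ⟨fun e => hP.2.1 hp (Or.inl (e ▸ hd)), fun e => hP.2.1 hp
      (Or.inr ⟨fun hpD => hP.2.1 hp (Or.inl hpD), d, hd, e.symm⟩)⟩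
  have hnP : ∀ v ∈ X, Sees G v D → v ∉ P := fun v hv hvD hvP =>
    hP.2.1 hvP (Or.inr ⟨hnD v hv, hvD⟩)
  have hNP : ∀ v, v ∈ setNbhd G (sideB G w X) → Sees G v P := fun v hv => Sees.mono hv.2 hBP
  -- a vertex of `N(B)` either sees `D` or lies in `B⁺`
  have hNBP : ∀ m, m ∈ setNbhd G (sideB G w X) → ¬ Sees G m D → m ∈ P := by
    rintro m hm hmD
    obtain ⟨-, c, hc, hmc⟩ := id hm
    refine hP.2.2 c (hBP hc) m ?_ hmc.symm
    rintro (e | e)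
    exacts [hnD m (h.setNbhd_subset hm) e, hmD e.2]
  -- a vertex of `L₁` or `L₂` not seeing `B⁺` forces its clique's part of `N(B)` to see `D`
  have hforce₁ : ∀ v ∈ L₁, ¬ Sees G v P → ∀ m ∈ L₁, m ∈ setNbhd G (sideB G w X) → Sees G m D := by
    intro v hv hvP m hm hmN
    by_contra hmD
    exact hvP ⟨m, hNBP m hmN hmD, h.clique₁ hv hm (fun e => hvP (hNP v (e ▸ hmN)))⟩
  have hforce₂ : ∀ v ∈ L₂, ¬ Sees G v P → ∀ m ∈ L₂, m ∈ setNbhd G (sideB G w X) → Sees G m D := by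
    intro v hv hvP m hm hmN
    by_contra hmD
    exact hvP ⟨m, hNBP m hmN hmD, h.clique₂ hv hm (fun e => hvP (hNP v (e ▸ hmN)))⟩
  have hHL : ∀ u v z, u ≠ v → ¬ G.Adj u v → Sees G u D → Sees G v D → Sees G u P → Sees G v P →
      G.Adj z u → G.Adj z v → z ∈ X → Sees G z D → False :=
    fun u v z huv hnuv huD hvD huP hvP hzu hzv hz hzD =>
      no_clock_of_two_connSets S.clock hD.1 hP.1 hDP huv hnuv huD hvD huP hvP hzu hzv (hnD z hz)
        (hnP z hz hzD)
  -- a vertex of `L₁` seeing both `D` and `B⁺`, other than `t`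
  have hn : ∃ n ∈ L₁, n ≠ t ∧ Sees G n D ∧ Sees G n P := by
    by_cases hxP : Sees G x P
    · exact ⟨x, hx, htx.symm, hxD, hxP⟩
    · obtain ⟨p, hp, q, hq, hpq, hpN, hqN⟩ := h.ext₁ x hx (fun e => hxP (hNP x e))
      by_cases hpt : p = t
      · exact ⟨q, hq, fun e => hpq (hpt.trans e.symm), hforce₁ x hx hxP q hq hqN, hNP q hqN⟩
      · exact ⟨p, hp, hpt, hforce₁ x hx hxP p hp hpN, hNP p hpN⟩
  obtain ⟨n, hnL, hnt, hnD', hnP'⟩ := hn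
  have hyadj : ∀ r ∈ L₁, r ≠ t → ¬ G.Adj y r := fun r hr hrt hyr =>
    hyL (h.closed₁ y (hnB y (hX₂ y hy)) r hr t ht hrt hyr hty.symm)
  by_cases hyP : Sees G y P
  · exact hHL n y t (fun e => hyL (e ▸ hnL)) (fun e => hyadj n hnL hnt e.symm) hnD' hyD hnP' hyP
      (h.clique₁ ht hnL hnt.symm) hty (hX₁ t ht) htD
  have hyN : y ∉ setNbhd G (sideB G w X) := fun e => hyP (hNP y e)
  obtain ⟨p, hp, q, hq, hpq, hpN, hqN⟩ := h.ext₂ y hy hyN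
  have hM₂ := hforce₂ y hy hyP
  by_cases htL : t ∈ L₂
  · obtain ⟨m, hm, hmt, hmN⟩ : ∃ m ∈ L₂, m ≠ t ∧ m ∈ setNbhd G (sideB G w X) := by
      by_cases hpt : p = t
      · exact ⟨q, hq, fun e => hpq (hpt.trans e.symm), hqN⟩
      · exact ⟨p, hp, hpt, hpN⟩
    have hnL₂ : n ∉ L₂ := fun e => hyadj n hnL hnt (h.clique₂ hy e (fun e => hyL (e ▸ hnL)))
    refine hHL n m t (fun e => hnL₂ (e ▸ hm)) (fun e => hnL₂ (h.closed₂ n (hnB n (hX₁ n hnL)) m hm t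
      htL hmt e (h.clique₁ hnL ht hnt))) hnD' (hM₂ m hm hmN) hnP' (hNP m hmN)
      (h.clique₁ ht hnL hnt.symm) (h.clique₂ htL hm hmt.symm) (hX₁ t ht) htD
  by_cases htP : Sees G t P
  · obtain ⟨m, hm, hmN, htm⟩ : ∃ m ∈ L₂, m ∈ setNbhd G (sideB G w X) ∧ ¬ G.Adj t m := by
      by_contra hcon
      push Not at hcon
      exact htL (h.closed₂ t (hnB t (hX₁ t ht)) p hp q hq hpq (hcon p hp hpN) (hcon q hq hqN))
    exact hHL t m y (fun e => htL (e ▸ hm)) htm htD (hM₂ m hm hmN) htP (hNP m hmN) hty.symm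
      (h.clique₂ hy hm (fun e => hyN (e ▸ hmN))) (hX₂ y hy) hyD
  · exact TightEdge.not_exists S ⟨h, hD, ht, hy, htL, hyL, hty, htD, hyD,
      fun e => htP (hNP t e), hyN, hforce₁ t ht htP, hM₂⟩

/-- A sequence of distinct, consecutively adjacent vertices is a path. -/
lemma exists_isPath {V : Type*} {G : SimpleGraph V} (k : ℕ) : ∀ q : ℕ → V,
    (∀ i < k, G.Adj (q i) (q (i + 1))) → (∀ i j, i < j → j ≤ k → q i ≠ q j) →
    ∃ p : G.Walk (q 0) (q k), p.IsPath ∧ ∀ v, v ∈ p.support ↔ ∃ i ≤ k, q i = v := by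
  induction k with
  | zero =>
    intro q _ _
    refine ⟨SimpleGraph.Walk.nil, SimpleGraph.Walk.IsPath.nil, fun v => ?_⟩
    simp [eq_comm]
  | succ k ih =>
    intro q hadj hne
    obtain ⟨p, hp, hsupp⟩ := ih (fun i => q (i + 1)) (fun i hi => hadj (i + 1) (by omega))
      (fun i j hij hj => hne (i + 1) (j + 1) (by omega) (by omega))
    refine ⟨SimpleGraph.Walk.cons (hadj 0 (by omega)) p, ?_, fun v => ?_⟩
    · rw [SimpleGraph.Walk.cons_isPath_iff]
      refine ⟨hp, fun h => ?_⟩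
      obtain ⟨i, hi, h⟩ := (hsupp _).1 h
      exact hne 0 (i + 1) (by omega) (by omega) h.symm
    · rw [SimpleGraph.Walk.support_cons, List.mem_cons, hsupp]
      constructor
      · rintro (rfl | ⟨i, hi, rfl⟩)
        exacts [⟨0, by omega, rfl⟩, ⟨i + 1, by omega, rfl⟩]
      · rintro ⟨i, hi, rfl⟩
        rcases Nat.eq_zero_or_pos i with rfl | h
        · exact Or.inl rfl
        · exact Or.inr ⟨i - 1, by omega, by congr 1; omega⟩

/-- The whole vertex set is a balanced separator, so it is too large for the bound. -/
lemma Setting.four_lt_card (S : Setting G w) : 4 < Fintype.card V := by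
  have h1 : 4 * G.cliqueNum < (Set.univ : Set V).ncard := by
    by_contra hcon
    refine S.sep ⟨Set.univ, by omega, fun D hD => ?_⟩
    rw [isComponent_iff] at hD
    obtain ⟨v, hv⟩ := hD.1.1
    exact absurd (Set.mem_univ v) (hD.not_mem hv)
  have hV : ∃ v : V, True := by
    by_contra hcon
    push Not at hcon
    have := S.isWeight.2
    rw [Finset.sum_eq_zero (fun v _ => (hcon v).elim)] at this
    exact zero_ne_one this
  obtain ⟨v, -⟩ := hV
  have h2 := ncard_le_cliqueNum (G := G) (K := {v}) (SimpleGraph.isClique_singleton v)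
  rw [Set.ncard_singleton] at h2
  rw [Set.ncard_univ, Nat.card_eq_fintype_card] at h1
  omega

/-- `G` is connected: a proper connected set has a neighbour outside. -/
lemma Setting.setNbhd_nonempty (S : Setting G w) {D : Set V} (hD : ConnSet G D) {b : V}
    (hb : b ∉ D) : (setNbhd G D).Nonempty := by
  by_contra hcon
  have hno : ∀ a ∈ D, ∀ c, G.Adj a c → c ∈ D := by
    intro a ha c hac
    by_contra hc
    exact hcon ⟨c, hc, a, ha, hac.symm⟩
  obtain ⟨d, hd⟩ := hD.1
  -- remove a vertex on a side that has another one
  by_cases h : ∃ d' ∈ D, d' ≠ d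
  · obtain ⟨d', hd', hne⟩ := h
    refine no_star S.star (X := {d}) (E := D \ {d}) (x := d) (b := b) rfl (fun y hy => Or.inl hy)
      ⟨d', hd', hne⟩ (fun e he => he.2) (fun a ha c hc hac => ⟨hno a ha.1 c hac, hc⟩)
      (fun e => hb ?_) (fun e => hb e.1)
    rw [Set.mem_singleton_iff.1 e]
    exact hd
  · push Not at h
    obtain ⟨b', hb'⟩ : ∃ b', b' ∉ ({d, b} : Set V) := by
      by_contra hall
      push Not at hall
      have h1 : (Set.univ : Set V).ncard ≤ ({d, b} : Set V).ncard :=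
        Set.ncard_le_ncard (fun v _ => hall v) (Set.toFinite _)
      have h2 := Set.ncard_insert_le d ({b} : Set V)
      rw [Set.ncard_singleton] at h2
      rw [Set.ncard_univ, Nat.card_eq_fintype_card] at h1
      have := S.four_lt_card
      omega
    have hb'D : b' ∉ D := fun e => hb' (Or.inl (h b' e))
    refine no_star S.star (X := {b}) (E := D) (x := b) (b := b') rfl (fun y hy => Or.inl hy)
      ⟨d, hd⟩ (fun e he h1 => hb ?_) (fun a ha c _ hac => hno a ha c hac) (fun e => hb' (Or.inr e))
      hb'D
    rw [← Set.mem_singleton_iff.1 h1]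
    exact he

/-- Through every component on the light side of a member of `𝒳` there is a marker path. -/
theorem exists_isMarkerPath (S : Setting G w) {X D : Set V} (hX : X ∈ cliquePairs G w)
    (hD : IsComp G (sideA G w X) D) : ∃ P, IsMarkerPath G X D P := by
  obtain ⟨L₁, L₂, h⟩ := S.exists_closedPair hX
  obtain ⟨b, hb⟩ := h.isComp.1.1
  have hbD : b ∉ D := fun e => (h.anticomplete_comp hD b e b hb).1 rfl
  obtain ⟨x, hx⟩ := S.setNbhd_nonempty hD.1 hbD
  obtain ⟨y, hy, hyx, hnxy⟩ := exists_nonadj_mem_setNbhd S.star hD.1 hx hbD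
    (fun e => h.not_mem_sideB (h.setNbhd_comp_subset hD e) hb)
  obtain ⟨-, d, hd, hxd⟩ := id hx
  obtain ⟨-, e, he, hye⟩ := id hy
  obtain ⟨k, p, hp, h0, hk⟩ := hD.1.exists_walkIn hd he
  -- a shortest walk in `D` between neighbours of two non-adjacent vertices of `X`
  obtain ⟨k, p, hp, hQ, hind, hmin⟩ :=
    exists_indPath_of_walkIn (G := G) (W := D)
      (fun a c => ∃ u ∈ X, ∃ v ∈ X, u ≠ v ∧ ¬ G.Adj u v ∧ G.Adj u a ∧ G.Adj v c)
      ⟨k, p, hp, x, h.setNbhd_comp_subset hD hx, y, h.setNbhd_comp_subset hD hy, hyx.symm, hnxy,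
        h0 ▸ hxd, hk ▸ hye⟩
  clear hx hy hyx hnxy hxd hye x y
  obtain ⟨x, hx, y, hy, hxy, hnxy, hx0, hyk⟩ := hQ
  have hnD : ∀ v ∈ X, v ∉ D := fun v hv => ClosedPair.not_mem_comp hD hv
  have hpre : ∀ i ≤ k, ∀ t ∈ X, G.Adj t (p i) → t ≠ x → ¬ G.Adj t x → i = k := by
    intro i hi t ht hti htx hntx
    by_contra hik
    exact hmin i p (by omega) ⟨fun q hq => hp.1 q (by omega), fun q hq => hp.2 q (by omega)⟩
      ⟨x, hx, t, ht, htx.symm, fun e => hntx e.symm, hx0, hti⟩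
  have hpost : ∀ i ≤ k, ∀ t ∈ X, G.Adj t (p i) → t ≠ y → ¬ G.Adj t y → i = 0 := by
    intro i hi t ht hti hty hnty
    by_contra hi0
    refine hmin (k - i) (fun q => p (q + i)) (by omega)
      ⟨fun q hq => hp.1 (q + i) (by omega), fun q hq => ?_⟩ ⟨t, ht, y, hy, hty, hnty, ?_, ?_⟩
    · have := hp.2 (q + i) (by omega)
      rwa [show q + i + 1 = q + 1 + i by omega] at this
    · rwa [Nat.zero_add]
    · rwa [Nat.sub_add_cancel hi]
  -- no third vertex of `X` sees the path
  have hthird : ∀ L₁ L₂, ClosedPair G w X L₁ L₂ → x ∈ L₁ → y ∈ L₂ → ∀ i ≤ k, ∀ t ∈ X,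
      G.Adj t (p i) → t = x ∨ t = y := by
    intro L₁ L₂ h hx₁ hy₂ i hi t ht hti
    by_contra hcon
    push Not at hcon
    have hxD : Sees G x D := ⟨p 0, hp.1 0 (by omega), hx0⟩
    have hyD : Sees G y D := ⟨p k, hp.1 k le_rfl, hyk⟩
    have htD : Sees G t D := ⟨p i, hp.1 i hi, hti⟩
    have ht' := ht
    rw [h.eq] at ht'
    rcases ht' with ht₁ | ht₂
    · have hi0 := hpost i hi t ht hti hcon.2
        (h.not_adj_of_sees S hD hx₁ hy₂ ht₁ hxD hyD htD hxy hnxy hcon.1)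
      subst hi0
      exact h.not_mem₁ (ClosedPair.not_mem_sides hD (hp.1 0 hi)) hcon.1 hti.symm hx0.symm ht₁ hx₁
    · have hik := hpre i hi t ht hti hcon.1 (h.symm.not_adj_of_sees S hD hy₂ hx₁ ht₂ hyD hxD htD
        hxy.symm (fun e => hnxy e.symm) hcon.2)
      subst hik
      exact h.symm.not_mem₁ (ClosedPair.not_mem_sides hD (hp.1 i hi)) hcon.2 hti.symm hyk.symm ht₂
        hy₂
  have hnbrs : ∀ i ≤ k, ∀ t ∈ X, G.Adj t (p i) → (t = x ∧ i = 0) ∨ (t = y ∧ i = k) := by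
    intro i hi t ht hti
    have : t = x ∨ t = y := by
      have hx' := hx
      have hy' := hy
      rw [h.eq] at hx' hy'
      rcases hx' with hx' | hx'
      · exact hthird L₁ L₂ h hx' (hy'.resolve_left fun e => hnxy (h.clique₁ hx' e hxy)) i hi t
          ht hti
      · exact hthird L₂ L₁ h.symm hx' (hy'.resolve_right fun e => hnxy (h.clique₂ hx' e hxy)) i hi t
          ht hti
    rcases this with rfl | rfl
    · exact Or.inl ⟨rfl, hpost i hi t ht hti hxy hnxy⟩
    · exact Or.inr ⟨rfl, hpre i hi t ht hti hxy.symm fun e => hnxy e.symm⟩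
  -- the sequence `x, p 0, …, p k, y`
  set q : ℕ → V := fun i => if i = 0 then x else if i ≤ k + 1 then p (i - 1) else y with hq
  have hq0 : q 0 = x := if_pos rfl
  have hqp : ∀ i ≤ k, q (i + 1) = p i := fun i hi => by
    simp only [hq]
    rw [if_neg (by omega), if_pos (by omega), Nat.add_sub_cancel]
  have hqk : q (k + 2) = y := by
    simp only [hq]
    rw [if_neg (by omega), if_neg (by omega)]
  have hcase : ∀ i ≤ k + 2, i = 0 ∨ i = k + 2 ∨ ∃ j ≤ k, i = j + 1 := by
    intro i hi
    by_cases h1 : i = 0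
    · exact Or.inl h1
    · by_cases h2 : i = k + 2
      · exact Or.inr (Or.inl h2)
      · exact Or.inr (Or.inr ⟨i - 1, by omega, by omega⟩)
  have hadj : ∀ i < k + 2, G.Adj (q i) (q (i + 1)) := by
    intro i hi
    rcases hcase i (by omega) with rfl | rfl | ⟨j, hj, rfl⟩
    · rw [hq0, hqp 0 (by omega)]; exact hx0
    · omega
    · rw [hqp j hj]
      rcases Nat.lt_or_ge j k with h1 | h1
      · rw [hqp (j + 1) h1]; exact hp.2 j h1
      · have : j = k := by omega
        subst this
        rw [hqk]; exact hyk.symm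
  have hne : ∀ i j, i < j → j ≤ k + 2 → q i ≠ q j := by
    intro i j hij hj
    rcases hcase j hj with rfl | rfl | ⟨j, hj', rfl⟩
    · omega
    · rcases hcase i (by omega) with rfl | rfl | ⟨i, hi, rfl⟩
      · rw [hq0, hqk]; exact hxy
      · omega
      · rw [hqp i hi, hqk]
        exact fun e => hnD y hy (e ▸ hp.1 i hi)
    · rw [hqp j hj']
      rcases hcase i (by omega) with rfl | rfl | ⟨i, hi, rfl⟩
      · rw [hq0]
        exact fun e => hnD x hx (e ▸ hp.1 j hj')
      · omega
      · rw [hqp i hi]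
        exact (hind i j (by omega) hj').1
  obtain ⟨P, hP, hsupp⟩ : ∃ P : G.Walk x y, P.IsPath ∧
      ∀ v, v ∈ P.support ↔ ∃ i ≤ k + 2, q i = v := by
    have := exists_isPath (k + 2) q hadj hne
    rwa [hq0, hqk] at this
  have hmem : ∀ i ≤ k + 2, q i ∈ {v | v ∈ P.support} := fun i hi => (hsupp _).2 ⟨i, hi, rfl⟩
  refine ⟨_, x, y, P, hP, rfl, ?_, hx, hy, hnxy, ?_⟩
  · have h1 : ({q 0, q 1, q 2} : Set V) ⊆ {v | v ∈ P.support} := by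
      rintro v (rfl | rfl | rfl)
      exacts [hmem 0 (by omega), hmem 1 (by omega), hmem 2 (by omega)]
    have h2 : ({q 0, q 1, q 2} : Set V).ncard = 3 :=
      Set.ncard_eq_three.2 ⟨q 0, q 1, q 2, hne 0 1 (by omega) (by omega),
        hne 0 2 (by omega) (by omega), hne 1 2 (by omega) (by omega), rfl⟩
    rw [← h2]
    exact Set.ncard_le_ncard h1 (Set.toFinite _)
  · intro v hv hvx hvy
    obtain ⟨i, hi, rfl⟩ := (hsupp v).1 hv
    rcases hcase i hi with rfl | rfl | ⟨i, hi', rfl⟩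
    · exact absurd hq0 hvx
    · exact absurd hqk hvy
    refine ⟨(hqp i hi').symm ▸ hp.1 i hi', ?_⟩
    have hset : nbrs G ({v | v ∈ P.support} ∪ X) (q (i + 1)) = {q i, q (i + 2)} := by
      ext t
      constructor
      · rintro ⟨hadjt, ht⟩
        change G.Adj (q (i + 1)) t at hadjt
        have hX' : ∀ t ∈ X, G.Adj (q (i + 1)) t → t ∈ ({q i, q (i + 2)} : Set V) := by
          intro t ht hadjt
          rw [hqp i hi'] at hadjt
          rcases hnbrs i hi' t ht hadjt.symm with ⟨rfl, rfl⟩ | ⟨rfl, rfl⟩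
          · exact Or.inl hq0.symm
          · exact Or.inr hqk.symm
        rcases ht with ht | ht
        · obtain ⟨j, hj, rfl⟩ := (hsupp t).1 ht
          rcases hcase j hj with rfl | rfl | ⟨j, hj', rfl⟩
          · exact hX' _ (hq0.symm ▸ hx) hadjt
          · exact hX' _ (hqk.symm ▸ hy) hadjt
          · rw [hqp i hi', hqp j hj'] at hadjt
            rcases Nat.lt_trichotomy i j with h1 | h1 | h1
            · rw [(hind i j h1 hj').2] at hadjt
              subst hadjt
              exact Or.inr rfl
            · subst h1; exact absurd rfl hadjt.ne
            · rw [SimpleGraph.adj_comm, (hind j i h1 hi').2] at hadjt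
              subst hadjt
              exact Or.inl rfl
        · exact hX' t ht hadjt
      · rintro (rfl | rfl)
        · exact ⟨(hadj i (by omega)).symm, Or.inl (hmem i (by omega))⟩
        · exact ⟨hadj (i + 1) (by omega), Or.inl (hmem (i + 2) (by omega))⟩
    rw [degIn, hset, Set.ncard_pair (hne i (i + 2) (by omega) (by omega))]

/-- The choices in the construction of `β*` can be made. -/
theorem Setting.nonempty_choices (S : Setting G w) : Nonempty (Choices G w) := by
  classical
  have h1 : ∀ D, IsComponent G (beta G w)ᶜ D → ∃ X ∈ coreX G w, D ⊆ sideA G w X := fun D hD =>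
    exists_mem_coreX_subset_sideA S (isComponent_iff.1 hD)
  set sep : Set V → Set V := fun D =>
    if h : IsComponent G (beta G w)ᶜ D then (h1 D h).choose else ∅ with hsep
  have hsep_spec : ∀ D, IsComponent G (beta G w)ᶜ D →
      sep D ∈ coreX G w ∧ D ⊆ sideA G w (sep D) := by
    intro D hD
    simp only [hsep, dif_pos hD]
    exact (h1 D hD).choose_spec
  have h2 : ∀ X, X ∈ coreX G w ∧ (∃ D, IsComponent G (beta G w)ᶜ D ∧ sep D = X) →
      ∃ P, ∃ D, IsComponent G (beta G w)ᶜ D ∧ sep D = X ∧ IsMarkerPath G X D P := by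
    rintro X ⟨hX, D, hD, rfl⟩
    obtain ⟨P, hP⟩ := exists_isMarkerPath S hX.1
      (isComp_sideA_of_isComp_beta hX (isComponent_iff.1 hD) (hsep_spec D hD).2)
    exact ⟨P, D, hD, rfl, hP⟩
  refine ⟨⟨sep, fun X => if h : X ∈ coreX G w ∧ (∃ D, IsComponent G (beta G w)ᶜ D ∧ sep D = X)
    then (h2 X h).choose else ∅, hsep_spec, fun X _ hX => ?_, fun X hX hD => ?_⟩⟩
  · exact dif_neg fun h => hX h.2
  · rw [dif_pos ⟨hX, hD⟩]
    exact (h2 X ⟨hX, hD⟩).choose_spec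

end Markers

/-! ### Neighbourhoods in the central bag -/

section CentralNeighbourhoods

variable {V : Type*} {G : SimpleGraph V}

/-- The union of the holes through `y` inside `U`. -/
def holesVia (G : SimpleGraph V) (U : Set V) (y : V) : Set V :=
  {v | ∃ n f, HoleAt G U y n f ∧ v ∈ cycSet n f}

/-- Without star cutsets, any two non-adjacent neighbours `a`, `b` of `y` lie on a hole through
`y`: `N[y] \ {a, b}` does not separate them. -/
lemma exists_holeAt (hdiamond : DiamondFree G) (hstar : ¬ ∃ X : Set V, IsStarCutset G X)
    {y a b : V} (ha : G.Adj y a) (hb : G.Adj y b) (hab : a ≠ b) (hnab : ¬ G.Adj a b) :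
    ∃ n f, Cyc G n f ∧ f 0 = y ∧ y ∈ cycSet n f ∧ a ∈ cycSet n f ∧ b ∈ cycSet n f ∧
      ∀ v ∈ cycSet n f, G.Adj y v → v = a ∨ v = b := by
  set W : Set V := {v | v ≠ y ∧ (G.Adj y v → v = a ∨ v = b)} with hW
  have haW : a ∈ W := ⟨ha.ne', fun _ => Or.inl rfl⟩
  have hbW : b ∈ W := ⟨hb.ne', fun _ => Or.inr rfl⟩
  have hyW : y ∉ W := fun h => h.1 rfl
  have hconn : ConnSet G W := by
    rw [connSet_iff_connected]
    by_contra hcon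
    refine hstar ⟨Wᶜ, ⟨?_, ?_⟩, y, hyW, fun v hv => ?_⟩
    · rw [compl_compl]; exact ⟨a, haW⟩
    · rwa [compl_compl]
    · by_contra h
      push Not at h
      exact hv ⟨h.1, fun h' => absurd h' h.2⟩
  obtain ⟨n, f, hf, hf0, hfW⟩ := exists_cyc hdiamond hconn hyW haW hbW ha hb hab hnab
  have h4 := hf.four_le
  have hy : y ∈ cycSet n f := ⟨0, by omega, hf0⟩
  have honly : ∀ v ∈ cycSet n f, G.Adj y v → v = a ∨ v = b := by
    rintro v ⟨q, hq, rfl⟩ hv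
    rcases Nat.eq_zero_or_pos q with rfl | h
    · exact absurd hf0.symm hv.ne
    · exact (hfW q h hq).2 hv
  have m1 : f 1 ∈ cycSet n f := ⟨1, by omega, rfl⟩
  have m2 : f (n - 1) ∈ cycSet n f := ⟨n - 1, by omega, rfl⟩
  have hne := hf.ne 1 (n - 1) (by omega) (by omega)
  rcases honly _ m1 (hf0 ▸ hf.adj_zero_one) with h1 | h1 <;>
    rcases honly _ m2 (hf0 ▸ hf.adj_zero_last) with h2 | h2
  · exact absurd (h1.trans h2.symm) hne
  · exact ⟨n, f, hf, hf0, hy, h1 ▸ m1, h2 ▸ m2, honly⟩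
  · exact ⟨n, f, hf, hf0, hy, h2 ▸ m2, h1 ▸ m1, honly⟩
  · exact absurd (h1.trans h2.symm) hne

/-- The attachments, other than `e`, of a component of the graph without `e` and the holes through
`y` avoiding `e` form a clique. -/
lemma isClique_setNbhd_diff (hclock : ClockFree G) (hdiamond : DiamondFree G) {y e : V}
    (hye : y ≠ e) {J : Set V} (hJ : IsComp G (holesVia G {e}ᶜ y ∪ {e})ᶜ J) :
    G.IsClique (setNbhd G J \ {e}) ∧ setNbhd G J \ {e} ⊆ holesVia G {e}ᶜ y := by
  have hsub : setNbhd G J \ {e} ⊆ holesVia G {e}ᶜ y := fun v hv =>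
    (hJ.setNbhd_subset hv.1).resolve_right hv.2
  refine ⟨fun a ha b hb hab => ?_, hsub⟩
  obtain ⟨n, f, hf, haf⟩ := hsub ha
  obtain ⟨m, g, hg, hbg⟩ := hsub hb
  have havoid : HolesAvoid G {e}ᶜ y J := fun n f hf hf0 hfU i hi hiJ =>
    hJ.not_mem hiJ (Or.inl ⟨n, f, ⟨hf, hf0, hfU⟩, i, hi, rfl⟩)
  exact havoid.adj_of_sees_of_sees hclock hdiamond hJ.1
    (fun j hj h => hJ.not_mem hj (Or.inr h)) hye hf hg haf hbg ha.1.2 hb.1.2 hab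

/-- In a cut `{x} ∪ R` with `R` a clique, a neighbour `y` of `x` outside the cut whose other
neighbours do not form a clique cannot have two neighbours in `R`, if `x` and one of them are
attached to another component. -/
lemma false_of_two_nbrs (hclock : ClockFree G) (hdiamond : DiamondFree G)
    (hstar : ¬ ∃ X : Set V, IsStarCutset G X) {x y p q : V} {R D D' : Set V} (hR : G.IsClique R)
    (hxR : x ∉ R) (hD : IsComp G ({x} ∪ R)ᶜ D) (hD' : IsComp G ({x} ∪ R)ᶜ D') (hne : D ≠ D')
    (hyD : y ∈ D) (hxy : G.Adj x y) (hy : ¬ G.IsClique (G.neighborSet y \ {x})) (hp : p ∈ R)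
    (hq : q ∈ R) (hpq : p ≠ q) (hyp : G.Adj y p) (hyq : G.Adj y q) (hxD' : Sees G x D')
    (hpD' : Sees G p D') : False := by
  have hDD' := hD.anticomplete hD' hne
  have hxp' : x ≠ p := fun e => hxR (e ▸ hp)
  have hxp : ¬ G.Adj x p := by
    intro hxp
    have hxq : G.Adj x q := by
      by_contra hxq
      exact hdiamond ⟨x, q, y, p, fun e => hxR (e ▸ hq), hxq, hyp, hxy, hxp, hyq.symm,
        hR hq hp hpq.symm⟩
    obtain ⟨b, hb⟩ := hD'.1.1
    refine no_star hstar (X := {x} ∪ R) (E := D) (x := x) (b := b) (Or.inl rfl) ?_ hD.1.1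
      (fun e he => hD.not_mem he) (fun a ha c hc hac => hD.2.2 a ha c hc hac) (hD'.not_mem hb)
      (fun hbD => (hDD' b hbD b hb).1 rfl)
    rintro r (hr | hr)
    · exact Or.inl hr
    · exact (hdiamond.eq_or_adj hR hp hq hr hpq hxp hxq).imp_left Eq.symm
  -- a neighbour `c` of `y` away from `p`
  obtain ⟨c, hyc, hcx, hcp, hnpc⟩ : ∃ c, G.Adj y c ∧ c ≠ x ∧ p ≠ c ∧ ¬ G.Adj p c := by
    by_contra hcon
    push Not at hcon
    refine hy fun u hu v hv huv => ?_
    by_contra hnuv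
    by_cases hup : p = u
    · subst hup
      exact hnuv (hcon v hv.1 hv.2 huv)
    · by_cases hvp : p = v
      · subst hvp
        exact hnuv (hcon u hu.1 hu.2 hup).symm
      · exact hdiamond ⟨u, v, y, p, huv, hnuv, hyp,
          SimpleGraph.Adj.symm hu.1, (hcon u hu.1 hu.2 hup).symm,
          SimpleGraph.Adj.symm hv.1, (hcon v hv.1 hv.2 hvp).symm⟩
  obtain ⟨n, f, hf, hf0, hyH, hpH, hcH, honly⟩ := exists_holeAt hdiamond hstar hyp hyc hcp hnpc
  have hxH : x ∉ cycSet n f := fun hxH => by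
    rcases honly x hxH hxy.symm with h | h
    exacts [hxp' h, hcx h.symm]
  have hqH : q ∉ cycSet n f := fun hqH => by
    rcases honly q hqH hyq with h | h
    · exact hpq h.symm
    · exact hnpc (h ▸ hR hp hq hpq)
  obtain ⟨hZ, hpZ⟩ := hf.connSet_diff_two hpH hyH hyp.symm
  set Z := cycSet n f \ {p, y} with hZdef
  have hcZ : c ∈ Z := by
    refine ⟨hcH, ?_⟩
    rintro (h | h)
    exacts [hcp h.symm, hyc.ne h.symm]
  have hZR : ∀ z ∈ Z, z ∉ {x} ∪ R := by
    rintro z ⟨hz, hz'⟩ (h | h)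
    · rw [Set.mem_singleton_iff.1 h] at hz
      exact hxH hz
    · have hzp : z ≠ p := fun e => hz' (Or.inl e)
      have hzy : z ≠ y := fun e => hz' (Or.inr e)
      exact hf.no_clock hclock (v := q) (fun i hi e => hqH ⟨i, hi, e⟩) hz hyH hzy
        (hR hq h (fun e => hqH (e ▸ hz))) hyq.symm
        (hf.two_nbrs hpH hz hyH (hR hp h hzp.symm) hyp.symm hzy).1
  have hcD : c ∈ D := hD.2.2 y hyD c (hZR c hcZ) hyc
  have hZD : Z ⊆ D := hD.subset_of_mem hZ hZR hcZ hcD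
  -- the part of `D \ {y}` around `c` sees both `p` and `x`
  have hcy : c ∈ D \ {y} := ⟨hcD, hyc.ne'⟩
  have hU := isComp_comp (G := G) hcy
  set U := comp G (D \ {y}) c with hUdef
  have hZU : Z ⊆ U := hU.subset_of_mem hZ (fun z hz => ⟨hZD hz, fun e => hz.2 (Or.inr e)⟩) hcZ
    (mem_comp _ _)
  have hxU : Sees G x U := by
    by_contra hxU
    refine no_star hstar (X := {y} ∪ R) (E := U) (x := p) (b := x) (Or.inr hp) ?_ hU.1.1 ?_ ?_ ?_
      (fun h => hD.not_mem (hU.2.1 h).1 (Or.inl rfl))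
    · rintro r (rfl | hr)
      · exact Or.inr hyp.symm
      · by_cases h : r = p
        exacts [Or.inl h, Or.inr (hR hp hr (Ne.symm h))]
    · rintro u hu (h | h)
      exacts [(hU.2.1 hu).2 h, hD.not_mem (hU.2.1 hu).1 (Or.inr h)]
    · intro a ha b hb hab
      refine hU.2.2 a ha b ⟨hD.2.2 a (hU.2.1 ha).1 b ?_ hab, fun e => hb (Or.inl e)⟩ hab
      rintro (e | e)
      · rw [Set.mem_singleton_iff.1 e] at hab
        exact hxU ⟨a, ha, hab.symm⟩
      · exact hb (Or.inr e)
    · rintro (h | h)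
      exacts [hxy.ne h, hxR h]
  exact no_clock_of_two_connSets hclock hD'.1 hU.1
    (hDD'.symm.mono subset_rfl (hU.2.1.trans Set.sdiff_subset)) hxp' hxp hxD' hpD' hxU
    (hpZ.mono hZU) hxy.symm hyp (fun h => (hDD' y hyD y h).1 rfl) (fun h => (hU.2.1 h).2 rfl)

end CentralNeighbourhoods

section CentralBagNeighbours

variable {V : Type*} [Fintype V] {G : SimpleGraph V} {w : V → ℝ}

/-- Of two non-adjacent neighbours of `x` in `β`, at least one has all its other neighbours in a
clique. -/
theorem isClique_or_isClique_of_mem_beta (S : Setting G w) {x y z : V} (hy : y ∈ beta G w)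
    (hz : z ∈ beta G w) (hxy : G.Adj x y) (hxz : G.Adj x z) (hyz : y ≠ z) (hnyz : ¬ G.Adj y z) :
    G.IsClique (G.neighborSet y \ {x}) ∨ G.IsClique (G.neighborSet z \ {x}) := by
  by_contra hcon
  push Not at hcon
  obtain ⟨hyI, hzI⟩ := hcon
  -- a hole through `y` that avoids `x`
  obtain ⟨n, f, hfH, hfn⟩ : ∃ n f, HoleAt G {x}ᶜ y n f ∧ ¬ G.IsClique (cycSet n f) := by
    have h1 := hyI
    unfold SimpleGraph.IsClique Set.Pairwise at h1
    push Not at h1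
    obtain ⟨a, ha, b, hb, hab, hnab⟩ := h1
    obtain ⟨n, f, hf, hf0, hyH, haH, hbH, honly⟩ :=
      exists_holeAt S.diamond S.star ha.1 hb.1 hab hnab
    refine ⟨n, f, ⟨hf, hf0, fun i hi e => ?_⟩, fun h => hnab (h haH hbH hab)⟩
    rcases honly (f i) ⟨i, hi, rfl⟩ (by rw [Set.mem_singleton_iff.1 e]; exact hxy.symm) with h | h
    · exact ha.2 (h.symm.trans e)
    · exact hb.2 (h.symm.trans e)
  -- no such hole contains `z`
  have hzW : z ∉ holesVia G {x}ᶜ y ∪ {x} := by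
    rintro (⟨m, g, hg, hzg⟩ | h)
    · exact hg.cyc.no_clock S.clock (fun q hq e => hg.mem q hq e) hg.mem_cycSet hzg hyz hxy hxz hnyz
    · exact hxz.ne h.symm
  have hJ := isComp_comp (G := G) (S := (holesVia G {x}ᶜ y ∪ {x})ᶜ) hzW
  set J := comp G (holesVia G {x}ᶜ y ∪ {x})ᶜ z with hJdef
  have hzJ : z ∈ J := mem_comp _ _
  obtain ⟨hR, hRW⟩ := isClique_setNbhd_diff S.clock S.diamond hxy.ne' hJ
  set R := setNbhd G J \ {x} with hRdef
  have hxR : x ∉ R := fun h => h.2 rfl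
  have hJR : IsComp G ({x} ∪ R)ᶜ J := by
    refine isComp_of_setNbhd_subset hJ.1 ?_ fun v hv => ?_
    · rintro v hv (h | h)
      exacts [hJ.not_mem hv (Or.inr h), h.1.1 hv]
    · by_cases h : v = x
      exacts [Or.inl h, Or.inr ⟨hv, h⟩]
  have hyJ : y ∉ J := fun h => hJ.not_mem h (Or.inl ⟨n, f, hfH, hfH.mem_cycSet⟩)
  obtain ⟨u, huH, huR⟩ : ∃ u ∈ cycSet n f, u ∉ R := by
    by_contra hall
    push Not at hall
    exact hfn (hR.subset hall)
  have hux : u ≠ x := fun e => hfH.cycSet_subset huH e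
  have huJ : u ∉ J := fun h => hJ.not_mem h (Or.inl ⟨n, f, hfH, huH⟩)
  have huXR : u ∉ {x} ∪ R := by
    rintro (h | h)
    exacts [hux h, huR h]
  have hx1 : G.IsClique {x} := SimpleGraph.isClique_singleton x
  obtain ⟨hside, hext, -⟩ := S.cl_spec hx1 hR
  have hbeta := beta_subset (G := G) (w := w) ⟨{x}, R, hx1, hR, rfl⟩
  rw [hside] at hbeta
  obtain ⟨hB, hBw⟩ := S.sideB_spec (X := {x} ∪ R)
    (by have := ncard_union_le_cliqueNum hx1 hR; omega)
  set B := sideB G w ({x} ∪ R) with hBdef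
  have hmem : ∀ v, v ∈ beta G w → v ∉ B → v ∉ {x} ∪ R →
      ∃ p ∈ R, ∃ q ∈ R, p ≠ q ∧ G.Adj v p ∧ G.Adj v q ∧ p ∈ setNbhd G B := by
    intro v hv hvB hvX
    obtain ⟨p, q, hpq, hvp, hvq, hpB, -, h⟩ := hext v ((hbeta hv).resolve_left hvB) hvX
    rcases h with ⟨h1, h2⟩ | ⟨h1, h2⟩
    · exact absurd (h1.trans h2.symm) hpq
    · exact ⟨p, h1, q, h2, hpq, hvp, hvq, hpB⟩
  by_cases hBJ : B = J
  · by_cases hyR : y ∈ R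
    · -- then `{x} ∪ R` is a star with center `y`
      refine no_star S.star (X := {x} ∪ R) (E := J) (x := y) (b := u) (Or.inr hyR) ?_ hJ.1.1
        (fun e he => hJR.not_mem he) (fun a ha c hc hac => hJR.2.2 a ha c hc hac) huXR huJ
      rintro r (hr | hr)
      · rw [Set.mem_singleton_iff.1 hr]; exact Or.inr hxy.symm
      · by_cases h : r = y
        exacts [Or.inl h, Or.inr (hR hyR hr (Ne.symm h))]
    · have hyX : y ∉ {x} ∪ R := by
        rintro (h | h)
        exacts [hxy.ne h.symm, hyR h]
      obtain ⟨p, hp, q, hq, hpq, hyp, hyq, -⟩ := hmem y hy (hBJ ▸ hyJ) hyX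
      exact false_of_two_nbrs S.clock S.diamond S.star hR hxR (isComp_comp (G := G) hyX) hJR
        (fun e => hyJ (e ▸ mem_comp _ _)) (mem_comp _ _) hxy hyI hp hq hpq hyp hyq ⟨z, hzJ, hxz⟩
        hp.1.2
  · have hzB : z ∉ B := fun h => hBJ (hB.eq_of_mem hJR h hzJ)
    obtain ⟨p, hp, q, hq, hpq, hzp, hzq, hpB⟩ := hmem z hz hzB (hJR.not_mem hzJ)
    have hxB : Sees G x B := by
      by_contra hxB
      refine no_star S.star (X := R) (E := B) (x := p) (b := z) hp (fun r hr => ?_) hB.1.1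
        (fun e he h => hB.not_mem he (Or.inr h)) (fun a ha c hc hac => hB.2.2 a ha c ?_ hac)
        (fun h => hJR.not_mem hzJ (Or.inr h)) hzB
      · by_cases h : r = p
        exacts [Or.inl h, Or.inr (hR hp hr (Ne.symm h))]
      · rintro (h | h)
        · rw [Set.mem_singleton_iff.1 h] at hac
          exact hxB ⟨a, ha, hac.symm⟩
        · exact hc h
    exact false_of_two_nbrs S.clock S.diamond S.star hR hxR hJR hB (fun e => hBJ e.symm) hzJ hxz hzI
      hp hq hpq hzp hzq hxB hpB.2

/-- If a neighbour `y ∈ β` of `x ∈ β` has all its other neighbours in a clique, then so does `x`. -/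
theorem isClique_of_isClique_of_mem_beta (S : Setting G w) {x y : V} (hx : x ∈ beta G w)
    (hy : y ∈ beta G w) (hxy : G.Adj x y) (hyII : G.IsClique (G.neighborSet y \ {x})) :
    G.IsClique (G.neighborSet x \ {y}) := by
  intro a ha b hb hab
  by_contra hnab
  obtain ⟨n, f, hf, hf0, hxH, haH, hbH, honly⟩ :=
    exists_holeAt S.diamond S.star ha.1 hb.1 hab hnab
  have hyH : y ∉ cycSet n f := fun h => by
    rcases honly y h hxy with h | h
    exacts [ha.2 h.symm, hb.2 h.symm]
  have hfH : HoleAt G {y}ᶜ x n f := ⟨hf, hf0, fun i hi e =>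
    hyH (by rw [← Set.mem_singleton_iff.1 e]; exact ⟨i, hi, rfl⟩)⟩
  -- no neighbour of `y` is adjacent to `x`
  obtain ⟨q₀, hyq₀, hq₀x, hxq₀⟩ : ∃ q, G.Adj y q ∧ q ≠ x ∧ ¬ G.Adj x q := by
    by_contra hall
    push Not at hall
    obtain ⟨c, hc, hcy⟩ : ∃ c, ¬ G.Adj y c ∧ c ≠ y := by
      by_contra hcon
      push Not at hcon
      have hya : G.Adj y a := by
        by_contra h
        exact ha.2 (hcon a h)
      have hyb : G.Adj y b := by
        by_contra h
        exact hb.2 (hcon b h)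
      exact hnab (hyII ⟨hya, ha.1.ne'⟩ ⟨hyb, hb.1.ne'⟩ hab)
    refine no_star S.star (X := G.neighborSet y) (E := {y}) (x := x) (b := c) hxy.symm
      (fun v hv => ?_) ⟨y, rfl⟩ ?_ ?_ hc hcy
    · by_cases h : v = x
      exacts [Or.inl h, Or.inr (hall v hv h)]
    · rintro _ rfl h
      exact h.ne rfl
    · rintro _ rfl d hd hyd
      exact absurd hyd hd
  have hQx : ∀ q, G.Adj y q → q ≠ x → ¬ G.Adj x q := by
    intro q hyq hqx hxq
    have hne : q₀ ≠ q := by rintro rfl; exact hxq₀ hxq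
    exact S.diamond ⟨x, q₀, q, y, hq₀x.symm, hxq₀, hyq.symm, hxq, hxy,
      hyII ⟨hyq₀, hq₀x⟩ ⟨hyq, hqx⟩ hne, hyq₀.symm⟩
  have hQW : ∀ q, G.Adj y q → q ≠ x → q ∉ holesVia G {y}ᶜ x ∪ {y} := by
    rintro q hyq hqx (⟨m, g, hg, hqg⟩ | h)
    · exact hg.cyc.no_clock S.clock (fun i hi e => hg.mem i hi e) hg.mem_cycSet hqg hqx.symm
        hxy.symm hyq (hQx q hyq hqx)
    · exact hyq.ne h.symm
  have hJ := isComp_comp (G := G) (S := (holesVia G {y}ᶜ x ∪ {y})ᶜ) (hQW q₀ hyq₀ hq₀x)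
  set J := comp G (holesVia G {y}ᶜ x ∪ {y})ᶜ q₀ with hJdef
  have hQJ : ∀ q, G.Adj y q → q ≠ x → q ∈ J := by
    intro q hyq hqx
    by_cases h : q = q₀
    · rw [h]; exact mem_comp _ _
    · exact comp_closed (mem_comp _ _) (hQW q hyq hqx)
        (hyII ⟨hyq₀, hq₀x⟩ ⟨hyq, hqx⟩ (Ne.symm h))
  obtain ⟨hR, -⟩ := isClique_setNbhd_diff S.clock S.diamond hxy.ne hJ
  set R := setNbhd G J \ {y} with hRdef
  have hHJ : ∀ v ∈ cycSet n f, v ∉ J := fun v hv h => hJ.not_mem h (Or.inl ⟨n, f, hfH, hv⟩)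
  have hyJ : y ∉ J := fun h => hJ.not_mem h (Or.inr rfl)
  have hxJ := hHJ x hxH
  have hyR : y ∉ R := fun h => h.2 rfl
  have hRJ : ∀ v ∈ R, v ∉ J := fun v hv => hv.1.1
  have hJR : IsComp G ({y} ∪ R)ᶜ J := by
    refine isComp_of_setNbhd_subset hJ.1 ?_ fun v hv => ?_
    · rintro v hv (h | h)
      exacts [hyJ (h ▸ hv), hRJ v h hv]
    · by_cases h : v = y
      exacts [Or.inl h, Or.inr ⟨hv, h⟩]
  have hJyR : IsComp G ({x} ∪ R)ᶜ (J ∪ {y}) := by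
    refine isComp_of_setNbhd_subset (hJ.1.union_singleton ⟨q₀, mem_comp _ _, hyq₀⟩) ?_ ?_
    · rintro v (hv | rfl) (h | h)
      exacts [hxJ (h ▸ hv), hRJ v h hv, hxy.ne h.symm, hyR h]
    · rintro v ⟨hv, j, hj | rfl, hvj⟩
      · exact Or.inr ⟨⟨fun h => hv (Or.inl h), j, hj, hvj⟩, fun h => hv (Or.inr h)⟩
      · by_cases h : v = x
        · exact Or.inl h
        · exact absurd (Or.inl (hQJ v hvj.symm h)) hv
  have hx1 : G.IsClique {x} := SimpleGraph.isClique_singleton x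
  have hy1 : G.IsClique {y} := SimpleGraph.isClique_singleton y
  obtain ⟨hB, hBw⟩ := S.sideB_spec (X := {x} ∪ R)
    (by have := ncard_union_le_cliqueNum hx1 hR; omega)
  obtain ⟨hB', hB'w⟩ := S.sideB_spec (X := {y} ∪ R)
    (by have := ncard_union_le_cliqueNum hy1 hR; omega)
  -- the side `B` of `{x} ∪ R` is `J ∪ {y}`, since `y ∈ β` has no neighbour in `R \ {x}`
  have hyB : y ∈ sideB G w ({x} ∪ R) := by
    by_contra hyB
    obtain ⟨hside, hext, -⟩ := S.cl_spec hx1 hR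
    have hbeta := beta_subset (G := G) (w := w) ⟨{x}, R, hx1, hR, rfl⟩ hy
    rw [hside] at hbeta
    obtain ⟨p, q, hpq, hyp, hyq, -, -, h⟩ := hext y (hbeta.resolve_left hyB)
      (fun h => h.elim (fun e => hxy.ne e.symm) hyR)
    rcases h with ⟨h1, h2⟩ | ⟨h1, h2⟩
    · exact hpq (h1.trans h2.symm)
    · by_cases hpx : p = x
      · exact hRJ q h2 (hQJ q hyq fun e => hpq (hpx.trans e.symm))
      · exact hRJ p h1 (hQJ p hyp hpx)
  have hBeq : sideB G w ({x} ∪ R) = J ∪ {y} := hB.eq_of_mem hJyR hyB (Or.inr rfl)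
  -- hence the side `B` of `{y} ∪ R` is `J`, and `x` lies in the closure
  have hB'eq : sideB G w ({y} ∪ R) = J := by
    obtain ⟨v, hv, hv'⟩ := exists_mem_inter_of_weight S.isWeight hB'w hBw
    rw [hBeq] at hv'
    rcases hv' with hv' | hv'
    · exact hB'.eq_of_mem hJR hv hv'
    · exact absurd (Or.inl hv') (hB'.not_mem hv)
  have hxR : ∀ r ∈ R, r = x ∨ G.Adj x r := by
    by_cases hxR : x ∈ R
    · intro r hr
      by_cases h : r = x
      exacts [Or.inl h, Or.inr (hR hxR hr (Ne.symm h))]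
    · obtain ⟨hside, hext, -⟩ := S.cl_spec hy1 hR
      have hbeta := beta_subset (G := G) (w := w) ⟨{y}, R, hy1, hR, rfl⟩ hx
      rw [hside, hB'eq] at hbeta
      obtain ⟨p, q, hpq, hxp, hxq, -, -, h⟩ := hext x (hbeta.resolve_left hxJ)
        (fun h => h.elim (fun e => hxy.ne e) hxR)
      rcases h with ⟨h1, h2⟩ | ⟨h1, h2⟩
      · exact absurd (h1.trans h2.symm) hpq
      · exact fun r hr => (S.diamond.eq_or_adj hR h1 h2 hr hpq hxp hxq).imp_left Eq.symm
  -- so `{x} ∪ R` is a clique that separates `J ∪ {y}` from the hole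
  obtain ⟨c, hcH, hc⟩ : ∃ c ∈ cycSet n f, c ∉ {x} ∪ R := by
    by_contra hall
    push Not at hall
    have h1 : ∀ c ∈ cycSet n f, G.Adj x c → c ∈ R := fun c hc hxc =>
      (hall c hc).resolve_left fun e => hxc.ne e.symm
    exact hnab (hR (h1 a haH ha.1) (h1 b hbH hb.1) hab)
  refine no_star S.star (X := {x} ∪ R) (E := J ∪ {y}) (x := x) (b := c) (Or.inl rfl) ?_ hJyR.1.1
    (fun e he => hJyR.not_mem he) (fun a ha d hd had => hJyR.2.2 a ha d hd had) hc ?_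
  · rintro r (hr | hr)
    exacts [Or.inl hr, hxR r hr]
  · rintro (h | h)
    exacts [hHJ c hcH h, hyH (by rw [← Set.mem_singleton_iff.1 h]; exact hcH)]

/-- The neighbourhood of a vertex `x` of `β` in `β` is a clique up to one vertex. -/
theorem exists_isClique_diff (S : Setting G w) {x : V} (hx : x ∈ beta G w)
    (hne : (nbrs G (beta G w) x).Nonempty) :
    ∃ x' ∈ nbrs G (beta G w) x, G.IsClique (nbrs G (beta G w) x \ {x'}) := by
  by_cases h : G.IsClique (nbrs G (beta G w) x)
  · obtain ⟨x', hx'⟩ := hne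
    exact ⟨x', hx', h.subset Set.sdiff_subset⟩
  · unfold SimpleGraph.IsClique Set.Pairwise at h
    push Not at h
    obtain ⟨y, hy, z, hz, hyz, hnyz⟩ := h
    have hsub : ∀ y, nbrs G (beta G w) x \ {y} ⊆ G.neighborSet x \ {y} := fun y v hv =>
      ⟨hv.1.1, hv.2⟩
    rcases isClique_or_isClique_of_mem_beta S hy.2 hz.2 hy.1 hz.1 hyz hnyz with h | h
    · exact ⟨y, hy, (isClique_of_isClique_of_mem_beta S hx hy.2 hy.1 h).subset (hsub y)⟩
    · exact ⟨z, hz, (isClique_of_isClique_of_mem_beta S hx hz.2 hz.1 h).subset (hsub z)⟩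

end CentralBagNeighbours

/-! ### Degrees in `β*` -/

section BetaStar

lemma IsMarkerPath.connSet {V : Type*} {G : SimpleGraph V} {X D P : Set V}
    (h : IsMarkerPath G X D P) : ConnSet G P := by
  obtain ⟨x, y, p, -, rfl, -⟩ := h
  exact connSet_iff_connected.2 p.connected_induce_support

variable {V : Type*} [Fintype V] {G : SimpleGraph V} {w : V → ℝ}

/-- Every vertex of a marker path has a neighbour on it. -/
lemma IsMarkerPath.exists_adj {X D P : Set V} (h : IsMarkerPath G X D P) {v : V} (hv : v ∈ P) :
    ∃ u ∈ P, G.Adj v u := by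
  have hP := h.connSet
  obtain ⟨x, y, p, -, -, h3, -⟩ := h
  obtain ⟨u, hu, huv⟩ : ∃ u ∈ P, u ∉ ({v} : Set V) := by
    by_contra hall
    push Not at hall
    have := Set.ncard_le_ncard (fun u hu => hall u hu : P ⊆ {v}) (Set.toFinite _)
    rw [Set.ncard_singleton] at this
    omega
  obtain ⟨_, -, rfl, q, hq, -, hpq⟩ := hP.exists_adj (T := {v}) hv rfl hu huv
  exact ⟨q, hq, hpq⟩

lemma IsMarkerPath.exists_ends {V : Type*} {G : SimpleGraph V} {X D P : Set V}
    (h : IsMarkerPath G X D P) :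
    ∃ s ∈ P, ∃ t ∈ P, s ∈ X ∧ t ∈ X ∧ s ≠ t ∧ ¬ G.Adj s t := by
  obtain ⟨s, t, p, hp, rfl, h3, hs, ht, hnst, -⟩ := h
  refine ⟨s, p.start_mem_support, t, p.end_mem_support, hs, ht, ?_, hnst⟩
  rintro rfl
  obtain rfl := SimpleGraph.Walk.eq_nil_iff_nil.2 (SimpleGraph.Walk.isPath_iff_nil.1 hp)
  have : {v | v ∈ (SimpleGraph.Walk.nil : G.Walk s s).support} = {s} := by
    ext v
    simp
  rw [this, Set.ncard_singleton] at h3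
  omega

/-- A vertex of a marker path is an interior vertex, lying in `D` and of degree two in `G[P ∪ X]`,
or an end, lying in `X` and with a neighbour in `D`. -/
lemma IsMarkerPath.mem_cases {X D P : Set V} (h : IsMarkerPath G X D P) {v : V} (hv : v ∈ P) :
    (v ∈ D ∧ degIn G (P ∪ X) v = 2) ∨ (v ∈ X ∧ Sees G v D) := by
  obtain ⟨u, hu, hvu⟩ := h.exists_adj hv
  obtain ⟨x, y, p, -, -, -, hx, hy, hnxy, hint⟩ := h
  by_cases hvx : v = x
  · subst hvx
    have huy : u ≠ y := by rintro rfl; exact hnxy hvu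
    exact Or.inr ⟨hx, u, (hint u hu hvu.ne' huy).1, hvu⟩
  · by_cases hvy : v = y
    · subst hvy
      have hux : u ≠ x := by rintro rfl; exact hnxy hvu.symm
      exact Or.inr ⟨hy, u, (hint u hu hux hvu.ne').1, hvu⟩
    · exact Or.inl (hint v hv hvx hvy)

namespace Choices

variable (M : Choices G w)

lemma isComp {D : Set V} (hD : IsComp G (beta G w)ᶜ D) :
    M.sep D ∈ coreX G w ∧ IsComp G (sideA G w (M.sep D)) D := by
  obtain ⟨h1, h2⟩ := M.sep_spec D (isComponent_iff.2 hD)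
  exact ⟨h1, isComp_sideA_of_isComp_beta h1 hD h2⟩

lemma exists_isMarkerPath {X : Set V} (hX : X ∈ coreX G w)
    (h : ∃ D, IsComp G (beta G w)ᶜ D ∧ M.sep D = X) :
    ∃ D, IsComp G (beta G w)ᶜ D ∧ M.sep D = X ∧ IsMarkerPath G X D (M.path X) := by
  obtain ⟨D, hD, hDX⟩ := h
  obtain ⟨D', hD', h1⟩ := M.path_marker X hX ⟨D, isComponent_iff.2 hD, hDX⟩
  exact ⟨D', isComponent_iff.1 hD', h1⟩

lemma path_subset {X : Set V} (hX : X ∈ coreX G w) : M.path X ⊆ M.betaStar :=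
  fun _ hv => Or.inr ⟨X, hX, hv⟩

/-- A vertex of `β*` outside `β` is an interior vertex of a marker path. -/
lemma exists_of_not_mem_beta {v : V} (hv : v ∈ M.betaStar) (hvb : v ∉ beta G w) :
    ∃ D, IsComp G (beta G w)ᶜ D ∧ v ∈ D ∧ v ∈ M.path (M.sep D) ∧
      degIn G (M.path (M.sep D) ∪ M.sep D) v = 2 := by
  obtain ⟨X, hX, hvP⟩ := hv.resolve_left hvb
  have hne : ∃ D, IsComp G (beta G w)ᶜ D ∧ M.sep D = X := by
    by_contra hcon
    rw [M.path_empty X hX fun ⟨D, hD, h⟩ => hcon ⟨D, isComponent_iff.1 hD, h⟩] at hvP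
    exact hvP
  obtain ⟨D, hD, rfl, hP⟩ := M.exists_isMarkerPath hX hne
  rcases hP.mem_cases hvP with ⟨h1, h2⟩ | ⟨h1, d, hd, hvd⟩
  · exact ⟨D, hD, h1, hvP, h2⟩
  · exact absurd (hD.2.2 d hd v hvb hvd.symm) (ClosedPair.not_mem_comp (M.isComp hD).2 h1)

lemma nbrs_subset {v : V} {D : Set V} (S : Setting G w) (hD : IsComp G (beta G w)ᶜ D)
    (hvD : v ∈ D) : nbrs G M.betaStar v ⊆ nbrs G (M.path (M.sep D) ∪ M.sep D) v := by
  rintro u ⟨hvu, hu⟩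
  refine ⟨hvu, ?_⟩
  change G.Adj v u at hvu
  obtain ⟨hX, hDA⟩ := M.isComp hD
  by_cases hub : u ∈ beta G w
  · obtain ⟨L₁, L₂, h⟩ := S.exists_closedPair hX.1
    exact Or.inr (h.setNbhd_comp_subset hDA ⟨fun h => hD.not_mem h hub, v, hvD, hvu.symm⟩)
  · obtain ⟨D', hD', huD', huP, -⟩ := M.exists_of_not_mem_beta hu hub
    obtain rfl := hD.eq_of_mem hD' (hD.2.2 v hvD u hub hvu) huD'
    exact Or.inl huP

lemma degIn_le_two (S : Setting G w) {v : V} (hv : v ∈ M.betaStar) (hvb : v ∉ beta G w) :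
    degIn G M.betaStar v ≤ 2 := by
  obtain ⟨D, hD, hvD, -, h2⟩ := M.exists_of_not_mem_beta hv hvb
  rw [← h2]
  exact Set.ncard_le_ncard (M.nbrs_subset S hD hvD) (Set.toFinite _)

/-- Every vertex of `β*` has a neighbour in `β*`. -/
lemma nbrs_nonempty (S : Setting G w) {x : V} (hx : x ∈ M.betaStar) :
    (nbrs G M.betaStar x).Nonempty := by
  -- a marker path with a vertex `s` that is equal or adjacent to `x` provides a neighbour
  have key : ∀ X ∈ coreX G w, (∃ D, IsComp G (beta G w)ᶜ D ∧ M.sep D = X) → ∀ s ∈ M.path X,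
      s = x ∨ G.Adj x s → (nbrs G M.betaStar x).Nonempty := by
    rintro X hX hne s hs (rfl | hxs)
    · obtain ⟨D, -, -, hP⟩ := M.exists_isMarkerPath hX hne
      obtain ⟨u, hu, hsu⟩ := hP.exists_adj hs
      exact ⟨u, hsu, M.path_subset hX hu⟩
    · exact ⟨s, hxs, M.path_subset hX hs⟩
  by_cases hxb : x ∈ beta G w
  · obtain ⟨b, hb⟩ : ∃ b, b ∉ ({x} : Set V) := by
      by_contra hall
      push Not at hall
      have h1 := Set.ncard_le_ncard (fun v _ => hall v : (Set.univ : Set V) ⊆ {x}) (Set.toFinite _)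
      rw [Set.ncard_singleton, Set.ncard_univ, Nat.card_eq_fintype_card] at h1
      have := S.four_lt_card
      omega
    obtain ⟨u, -, x', hx', hux⟩ := S.setNbhd_nonempty (ConnSet.singleton x) hb
    rw [Set.mem_singleton_iff.1 hx'] at hux
    by_cases hub : u ∈ beta G w
    · exact ⟨u, hux.symm, Or.inl hub⟩
    · have hD := isComp_comp (G := G) (S := (beta G w)ᶜ) hub
      set D := comp G (beta G w)ᶜ u with hDdef
      obtain ⟨hX, hDA⟩ := M.isComp hD
      have hne : ∃ D', IsComp G (beta G w)ᶜ D' ∧ M.sep D' = M.sep D := ⟨D, hD, rfl⟩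
      obtain ⟨L₁, L₂, h⟩ := S.exists_closedPair hX.1
      have hxX := h.setNbhd_comp_subset hDA
        ⟨fun e => hD.not_mem e hxb, u, mem_comp _ _, hux.symm⟩
      obtain ⟨_, -, -, hP⟩ := M.exists_isMarkerPath hX hne
      obtain ⟨s, hsP, t, htP, hs, ht, hst, hnst⟩ := hP.exists_ends
      have hclique : ∀ L, G.IsClique L → x ∈ L → s ∈ L ∨ t ∈ L →
          (s = x ∨ G.Adj x s) ∨ (t = x ∨ G.Adj x t) := by
        rintro L hL hxL (h | h)
        · by_cases h' : s = x
          exacts [Or.inl (Or.inl h'), Or.inl (Or.inr (hL hxL h (Ne.symm h')))]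
        · by_cases h' : t = x
          exacts [Or.inr (Or.inl h'), Or.inr (Or.inr (hL hxL h (Ne.symm h')))]
      -- each of the two cliques of `X` contains an end of the path
      have hsx : (s = x ∨ G.Adj x s) ∨ (t = x ∨ G.Adj x t) := by
        rw [h.eq] at hxX hs ht
        rcases hxX with h1 | h1
        · refine hclique L₁ h.clique₁ h1 ?_
          by_contra hcon
          push Not at hcon
          exact hnst (h.clique₂ (hs.resolve_left hcon.1) (ht.resolve_left hcon.2) hst)
        · refine hclique L₂ h.clique₂ h1 ?_
          by_contra hcon
          push Not at hcon
          exact hnst (h.clique₁ (hs.resolve_right hcon.1) (ht.resolve_right hcon.2) hst)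
      rcases hsx with h1 | h1
      exacts [key _ hX hne s hsP h1, key _ hX hne t htP h1]
  · obtain ⟨D, hD, hxD, hxP, -⟩ := M.exists_of_not_mem_beta hx hxb
    exact key _ (M.isComp hD).1 ⟨D, hD, rfl⟩ x hxP (Or.inl rfl)

/-- The neighbourhood in `β*` of a vertex of `β*` consists of a clique, one more vertex and vertices
outside `β`. -/
theorem exists_isClique_union (S : Setting G w) {x : V} (hx : x ∈ M.betaStar) :
    ∃ (K : Set V) (x' : V), G.IsClique K ∧ K ∪ {x'} ⊆ nbrs G M.betaStar x ∧
      ∀ v ∈ nbrs G M.betaStar x \ (K ∪ {x'}), v ∉ beta G w ∧ x ∈ beta G w := by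
  by_cases hxb : x ∈ beta G w
  · have hsub : nbrs G (beta G w) x ⊆ nbrs G M.betaStar x := fun v hv => ⟨hv.1, Or.inl hv.2⟩
    by_cases hne : (nbrs G (beta G w) x).Nonempty
    · obtain ⟨x', hx', hK⟩ := exists_isClique_diff S hxb hne
      have heq : nbrs G (beta G w) x \ {x'} ∪ {x'} = nbrs G (beta G w) x :=
        Set.sdiff_union_of_subset (Set.singleton_subset_iff.2 hx')
      refine ⟨_, x', hK, ?_⟩
      rw [heq]
      exact ⟨hsub, fun v hv => ⟨fun hvb => hv.2 ⟨hv.1.1, hvb⟩, hxb⟩⟩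
    · obtain ⟨x', hx'⟩ := M.nbrs_nonempty S hx
      refine ⟨∅, x', Set.pairwise_empty _, by simpa using hx', fun v hv => ⟨fun hvb => ?_, hxb⟩⟩
      exact hne ⟨v, hv.1.1, hvb⟩
  · -- an interior vertex of a marker path has at most two neighbours
    obtain ⟨a, ha⟩ := M.nbrs_nonempty S hx
    obtain ⟨b, hb, hab⟩ : ∃ b ∈ nbrs G M.betaStar x, nbrs G M.betaStar x ⊆ {a, b} := by
      by_cases h : nbrs G M.betaStar x ⊆ {a}
      · exact ⟨a, ha, h.trans (by simp)⟩
      · obtain ⟨b, hb, hba⟩ := Set.not_subset.1 h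
        refine ⟨b, hb, ?_⟩
        have h2 : ({a, b} : Set V).ncard = 2 := Set.ncard_pair fun e => hba e.symm
        have h3 : ({a, b} : Set V) ⊆ nbrs G M.betaStar x := by
          rintro v (rfl | rfl)
          exacts [ha, hb]
        have h4 := M.degIn_le_two S hx hxb
        rw [degIn, ← h2] at h4
        exact (Set.eq_of_subset_of_ncard_le h3 h4 (Set.toFinite _)).symm.subset
    refine ⟨{a}, b, SimpleGraph.isClique_singleton a, ?_, fun v hv => absurd (hab hv.1) hv.2⟩
    rintro v (rfl | rfl)
    exacts [ha, hb]

end Choices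

lemma degree_eq_ncard {W : Type*} (H : SimpleGraph W) (v : W) (i : Fintype (H.neighborSet v)) :
    H.degree v = (H.neighborSet v).ncard := by
  rw [← SimpleGraph.card_neighborSet_eq_degree, ← Nat.card_eq_fintype_card, Nat.card_coe_set_eq]

/-- The degree in `G[S]`, as an induced subgraph, is `degIn`. -/
lemma ncard_neighborSet_induce {W : Type*} (H : SimpleGraph W) (S : Set W) (x : S) :
    ((H.induce S).neighborSet x).ncard = degIn H S x := by
  rw [degIn, ← Nat.card_coe_set_eq, ← Nat.card_coe_set_eq]
  exact Nat.card_congr ⟨fun u => ⟨u.1, u.2, u.1.2⟩, fun u => ⟨⟨u.1, u.2.2⟩, u.2.1⟩,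
    fun _ => rfl, fun _ => rfl⟩

/-- A bound on the maximum degree, for any choice of the instances. -/
lemma maxDegree_le_of_ncard_le {W : Type*} (H : SimpleGraph W) (i₁ : Fintype W)
    (i₂ : DecidableRel H.Adj) {k : ℕ} (h : ∀ v, (H.neighborSet v).ncard ≤ k) : H.maxDegree ≤ k :=
  SimpleGraph.maxDegree_le_of_forall_degree_le _ _ fun v => (degree_eq_ncard H v _).trans_le (h v)

/-- If the neighbours of degree at least `d` in `G[S]` of every vertex lie in a set of at most `k`
vertices, then `γ_d(G[S]) ≤ k`. -/
lemma gammaDeg_induce_le {S : Set V} {d k : ℕ}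
    (h : ∀ x ∈ S, ∃ Z : Set V, Z.ncard ≤ k ∧ ∀ v ∈ nbrs G S x, d ≤ degIn G S v → v ∈ Z) :
    gammaDeg d (G.induce S) ≤ k := by
  unfold gammaDeg
  refine maxDegree_le_of_ncard_le _ _ _ fun v => ?_
  obtain ⟨Z, hZ, hv⟩ := h v.1.1 v.1.2
  refine le_trans ?_ hZ
  rw [← Nat.card_coe_set_eq, ← Nat.card_coe_set_eq]
  refine Nat.card_le_card_of_injective (fun u => ⟨u.1.1.1, hv _ ⟨u.2, u.1.1.2⟩ ?_⟩) ?_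
  · rw [← ncard_neighborSet_induce G S u.1.1]
    exact u.1.2.trans_eq (degree_eq_ncard _ _ _)
  · intro u u' huu'
    have h1 : u.1.1.1 = u'.1.1.1 := congrArg (fun z : Z => (z : V)) huu'
    exact Subtype.ext (Subtype.ext (Subtype.ext h1))

end BetaStar

end CentralBag

theorem mainTheorem7 {V : Type*} [Fintype V] (G : SimpleGraph V) (w : V → ℝ)
    (hclock : CentralBag.ClockFree G) (hdiamond : CentralBag.DiamondFree G)
    (hstar : ¬ ∃ X : Set V, CentralBag.IsStarCutset G X)
    (hw : CentralBag.IsWeight w)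
    (hsep : ¬ ∃ X : Set V, X.ncard ≤ 4 * G.cliqueNum ∧ CentralBag.IsBalancedSep G w (1 / 2) X) :
    Nonempty (CentralBag.Choices G w) ∧
    ∀ M : CentralBag.Choices G w,
      (∀ x ∈ M.betaStar, ∃ (K : Set V) (x' : V), G.IsClique K ∧
        K ∪ {x'} ⊆ CentralBag.nbrs G M.betaStar x ∧
        ∀ v ∈ CentralBag.nbrs G M.betaStar x \ (K ∪ {x'}),
          CentralBag.degIn G M.betaStar v ≤ 2) ∧
      (∀ x ∈ M.betaStar, CentralBag.IsClawCenter G M.betaStar x →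
        ∃ (K : Set V) (x' x'' : V), G.IsClique K ∧
          K ∪ {x', x''} ⊆ CentralBag.nbrs G M.betaStar x ∧
          ∀ y ∈ CentralBag.nbrs G M.betaStar x \ (K ∪ {x', x''}),
            ¬ ∃ X ∈ CentralBag.coreX G w, ∃ K₁ K₂ : Set V,
              G.IsClique K₁ ∧ G.IsClique K₂ ∧ X = K₁ ∪ K₂ ∧ X = CentralBag.cl G w K₁ K₂ ∧
              (∃ d ∈ M.compUnion X, G.Adj y d) ∧ x ∈ K₁ ∧ y ∈ K₁) ∧
      CentralBag.gammaDeg 3 (G.induce M.betaStar) ≤ G.cliqueNum := by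
  have S : CentralBag.Setting G w := ⟨hclock, hdiamond, hstar, hw, hsep⟩
  refine ⟨S.nonempty_choices, fun M => ?_⟩
  have hdeg : ∀ x ∈ M.betaStar, ∃ (K : Set V) (x' : V), G.IsClique K ∧
      K ∪ {x'} ⊆ CentralBag.nbrs G M.betaStar x ∧
      ∀ v ∈ CentralBag.nbrs G M.betaStar x \ (K ∪ {x'}), CentralBag.degIn G M.betaStar v ≤ 2 := by
    intro x hx
    obtain ⟨K, x', hK, hsub, h⟩ := M.exists_isClique_union S hx
    exact ⟨K, x', hK, hsub, fun v hv => M.degIn_le_two S hv.1.2 (h v hv).1⟩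
  refine ⟨hdeg, fun x hx _ => ?_, CentralBag.gammaDeg_induce_le fun x hx => ?_⟩
  · obtain ⟨K, x', hK, hsub, h⟩ := M.exists_isClique_union S hx
    refine ⟨K, x', x', hK, by simpa using hsub, fun y hy => ?_⟩
    rintro ⟨X, -, K₁, K₂, -, -, rfl, -, ⟨d, ⟨D, hD, hDX, hd⟩, hyd⟩, -, hyK⟩
    -- such a `y` sees a component `D` of `G \ β` without lying in it, so it lies in `β`
    rw [CentralBag.isComponent_iff] at hD
    have hyb := (h y (by simpa using hy)).1
    have hyD := hD.2.2 d hd y hyb hyd.symm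
    have hDA := (M.isComp hD).2
    rw [hDX] at hDA
    exact CentralBag.ClosedPair.not_mem_comp hDA (Or.inl hyK) hyD
  · obtain ⟨K, x', hK, hsub, h⟩ := hdeg x hx
    refine ⟨K ∪ {x'}, ?_, fun v hv h3 => ?_⟩
    · -- `K ∪ {x}` is a clique
      have hKx : ∀ k ∈ K, G.Adj x k := fun k hk => (hsub (Or.inl hk)).1
      have h1 : G.IsClique (insert x K) := hK.insert fun k hk _ => hKx k hk
      have h2 := CentralBag.ncard_le_cliqueNum h1
      rw [Set.ncard_insert_of_notMem (fun hxK => (hKx x hxK).ne rfl) (Set.toFinite _)] at h2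
      have h3 := Set.ncard_union_le K {x'}
      rw [Set.ncard_singleton] at h3
      omega
    · by_contra hvZ
      have := h v ⟨hv, hvZ⟩
      omega
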